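/- \textbf{Setting.} Let $k_1,k_2,Q_1,Q_2$ be positive integers and $\eta_1,\eta_2\in(0,1)$. A slotted system has state $(i,j)$, $0\le i\le Q_1$ (data packets), $0\le j\le Q_2$ (energy packets). In each slot, independently, $k_1$ data packets arrive with probability $\eta_1$ and $k_2$ energy packets with probability $\eta_2$; after the arrivals there are $x$ data packets and $y$ energy packets, $y$ being truncated at $Q_2$. If $x=0$ nothing is sent and the next state is $(0,y)$. If $x>0$ and $y>0$, one data packet is sent with one energy packet and the next state is $(\min\{x-1,Q_1\},y-1)$. If $x>0$ and $y=0$, one packet is sent with energy of the reliable energy source (RES), giving $(\min\{x-1,Q_1\},0)$, with probability $g_i$ if data arrived in the slot and $f_i$ if not, where $i$ is the queue length before the arrivals; otherwise the next state is $(\min\{x,Q_1\},0)$. Put $\mu_0=(1-\eta_1)\eta_2$, $\mu_1=(1-\eta_1)(1-\eta_2)$, $\mu_2=\eta_1(1-\eta_2)$, $\mu_3=\eta_1\eta_2$, $\tau=\eta_1/(1-\eta_1)$, $\phi=\mu_2/\mu_0$, $\bar\eta_2=1-\eta_2$, and, for a vector $\pi=(\pi_{(i,j)})$, $\pi_i=\sum_{j=0}^{Q_2}\pi_{(i,j)}$.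 Three cases are considered: Case I, $k_1=k_2=1$, $Q_2\ge1$; Case II, $k_1=1<k_2$, $Q_2\ge2$; Case III, $k_2=1<k_1$, $Q_2\ge2$. \textbf{Linear program.} Minimise $\bar D(\pi)=\frac1{k_1\eta_1}\sum_{i=1}^{Q_1}i\,\pi_i$ subject to (a) $\pi a_0:=\sum_{i=0}^{Q_1}\xi_i\pi_{(i,0)}-\sum_{i=0}^{Q_1}\zeta_i\pi_{(i,1)}\le p_{max}$; (b) $\Theta_l(i)\le\pi_i\le\Theta_u(i)$ for $1\le i\le Q_1$; (c) $\pi_{(i,j)}\ge0$; (d) $\sum_{i,j}\pi_{(i,j)}=1$; (e) the balance (stationarity) equations of the chain at all states $(i,j)$ with $j>0$ (these do not involve $g,f$). Here: \begin{itemize} \item Case I: $\xi_0=\mu_2$, $\xi_i=\mu_2-\mu_0$ for $i\ge1$, $\zeta_i=0$; $\Theta_u(i)=\phi\,\pi_{(i-1,0)}$, $\Theta_l(i)=0$. \item Case II: $\xi_i=\mu_2+\eta_2(Q_1-i)$, $\zeta_0=\mu_2Q_1$, $\zeta_i=\bar\eta_2(Q_1-i)+\mu_1$ for $i\ge1$;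 $\Theta_u(i)=\tau\bar\eta_2\pi_{(i-1,0)}+\bar\eta_2\pi_{(i,0)}$, $\Theta_l(i)=0$. \item Case III: $\xi_0=\mu_0Q_1-\mu_3+k_1\eta_1$, $\xi_i=k_1\eta_1-\eta_2$ for $1\le i\le Q_1-k_1$, $\xi_i=\eta_1(Q_1-i)-\eta_2$ for $i\ge1$, $Q_1-k_1<i\le Q_1$; $\zeta_0=\mu_2(Q_1-k_1+1)$, $\zeta_i=(\mu_1+\mu_2)(Q_1+1-i)-\mu_2k_1$ for $1\le i\le Q_1-k_1$, $\zeta_i=\mu_1(Q_1+1-i)$ for $i\ge1$, $Q_1-k_1<i\le Q_1$; $\Theta_l(i)=\tau\sum_{m=\max\{0,i-k_1+1\}}^{i-1}\pi_m$; $\Theta_u(i)=\bar\eta_2\pi_{(i,0)}+\tau\sum_{m=0}^{i-1}\pi_m$ if $i<k_1$ and $\Theta_u(i)=\tau\bar\eta_2\pi_{(i-k_1,0)}+\bar\eta_2\pi_{(i,0)}+\tau\sum_{m=i-k_1+1}^{i-1}\pi_m$ if $i\ge k_1$. \end{itemize} Write $\pi a_i^u=\pi_i-\Theta_u(i)$ and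 $\pi a_i^l=\Theta_l(i)-\pi_i$. For $0\le m\le Q_1$ let $\pi'_m$ be the solution of the linear system $\pi a_i^u=0$ $(1\le i\le m)$, $\pi a_i^l=0$ $(m<i\le Q_1)$, (e), (d), and let $\tilde p_m=\pi'_ma_0$. \textbf{Theorem.} Assume one of the three cases, $p_{max}>k_1\eta_1-k_2\eta_2$, and, in Case III, $p_{max}>0$. There is $Q_0$, depending only on $k_1,k_2,Q_2,\eta_1,\eta_2,p_{max}$, such that the following holds for all $Q_1\ge Q_0$; in Cases I and II one may take $Q_0=1$. The solution $\pi'_m$ exists and is unique for every $0\le m\le Q_1$. If $\tilde p_m\le p_{max}$ for some $m\le Q_1$, then the linear program has an optimal solution. For every optimal solution $\pi^*$, the number $i^*=\min\{m:0\le m\le Q_1,\ \tilde p_m\le p_{max}\}$ exists, and $$\pi^*a_0\le p_{max},\qquad \pi^*a_i^u=0\ (1\le i\le i^*-1),\qquad \pi^*a_i^l=0\ (i^*+1\le i\le Q_1).$$ Moreover $\pi^*$ is realised by a threshold policy: it is a stationary distribution of the chain for some $g_i,f_i\in[0,1]$ with $g_i=0$ if $i+k_1<i^*$, $g_i=1$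 if $i+k_1>i^*$ $(0\le i\le Q_1)$, $f_i=0$ if $1\le i<i^*$ and $f_i=1$ if $i^*<i\le Q_1$. -/

import Mathlib

open scoped BigOperators

noncomputable section

/-- The data of the communication link: sizes `k₁`, `k₂` of a data / energy arrival, capacities
`Q₁`, `Q₂` of the data queue and of the battery, arrival probabilities `η₁`, `η₂`. -/
structure Link where
  k₁ : ℕ
  k₂ : ℕ
  Q₁ : ℕ
  Q₂ : ℕ
  η₁ : ℝ
  η₂ : ℝ

namespace Link

variable (L : Link)

/-- Buffer states `(i, j)`: `i` data packets and `j` energy packets. -/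
abbrev State : Type := Fin (L.Q₁ + 1) × Fin (L.Q₂ + 1)

def μ₀ : ℝ := (1 - L.η₁) * L.η₂
def μ₁ : ℝ := (1 - L.η₁) * (1 - L.η₂)
def μ₂ : ℝ := L.η₁ * (1 - L.η₂)
def μ₃ : ℝ := L.η₁ * L.η₂
def τ : ℝ := L.η₁ / (1 - L.η₁)
def φ : ℝ := L.μ₂ / L.μ₀

/-! ### The Markov chain -/

/-- Probability that an arrival of probability `η` does (`true`) or does not (`false`) occur. -/
def arrivalProb (η : ℝ) : Bool → ℝ
  | true => η
  | false => 1 - η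

/-- Probability of ending the slot in state `t` when, after the arrivals of the slot, there are `x`
data packets and `y` energy packets, and, should there be data but no harvested energy, a packet is
sent with energy from the reliable source with probability `r`. Harvested energy is always used
when there is a data packet to send. -/
def serveProb (x y : ℕ) (r : ℝ) (t : L.State) : ℝ :=
  let toState (i j : ℕ) : ℝ := if (t.1 : ℕ) = i ∧ (t.2 : ℕ) = j then 1 else 0
  if x = 0 then toState 0 y
  else if 0 < y then toState (min (x - 1) L.Q₁) (y - 1)
  else r * toState (min (x - 1) L.Q₁) 0 + (1 - r) * toState (min x L.Q₁) 0

/-- The transition matrix of the chain under the transmission parameters `g`, `f`: with data queue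
length `i` and no harvested energy, the reliable source is used with probability `g i` if data
arrive in the slot, and with probability `f i` otherwise. -/
def transition (g f : ℕ → ℝ) (s t : L.State) : ℝ :=
  ∑ a : Bool, ∑ e : Bool, arrivalProb L.η₁ a * arrivalProb L.η₂ e *
    L.serveProb ((s.1 : ℕ) + if a then L.k₁ else 0) (min ((s.2 : ℕ) + if e then L.k₂ else 0) L.Q₂)
      (if a then g s.1 else f s.1) t

/-- The balance equations at all states `(i, j)` with `j > 0`. The columns `j > 0` of the
transition matrix do not depend on the transmission parameters
(`transition_eq_of_battery_pos`), so that they may be written with the parameters `0`. -/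
def BatteryBalance (π : L.State → ℝ) : Prop :=
  ∀ t : L.State, 0 < (t.2 : ℕ) → ∑ s, π s * L.transition 0 0 s t = π t

theorem transition_eq_of_battery_pos (g f g' f' : ℕ → ℝ) (s t : L.State) (ht : 0 < (t.2 : ℕ)) :
    L.transition g f s t = L.transition g' f' s t := by
  have key : ∀ (x y : ℕ) (r r' : ℝ), L.serveProb x y r t = L.serveProb x y r' t := by
    intro x y r r'
    have h0 : (t.2 : ℕ) ≠ 0 := ht.ne'
    simp [serveProb, h0]
  unfold transition
  refine Finset.sum_congr rfl fun a _ => Finset.sum_congr rfl fun e _ => ?_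
  rw [key _ _ (if a then g s.1 else f s.1) (if a then g' s.1 else f' s.1)]

/-- `π` is a stationary distribution of the chain with transmission parameters `g`, `f`. -/
structure IsStationary (g f : ℕ → ℝ) (π : L.State → ℝ) : Prop where
  nonneg : ∀ s, 0 ≤ π s
  sum_one : ∑ s, π s = 1
  balance : ∀ t, ∑ s, π s * L.transition g f s t = π t

/-- Threshold policies: the reliable source is never used if holding leaves fewer than `m` packets
in the data queue, and always used (in the absence of harvested energy) if holding would leave more
than `m` packets. -/
structure IsThresholdPolicy (m : ℕ) (g f : ℕ → ℝ) : Prop where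
  g_mem : ∀ i, g i ∈ Set.Icc (0 : ℝ) 1
  f_mem : ∀ i, f i ∈ Set.Icc (0 : ℝ) 1
  g_below : ∀ i, i ≤ L.Q₁ → i + L.k₁ < m → g i = 0
  g_above : ∀ i, i ≤ L.Q₁ → m < i + L.k₁ → g i = 1
  f_below : ∀ i, 1 ≤ i → i ≤ L.Q₁ → i < m → f i = 0
  f_above : ∀ i, 1 ≤ i → i ≤ L.Q₁ → m < i → f i = 1

/-! ### The linear program

Below, `k₁ = k₂ = 1` is Case I, `k₁ = 1 < k₂` is Case II, and `k₂ = 1 < k₁` is Case III. -/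

/-- `π (i, j)` for natural numbers `i`, `j` (zero outside the state space). -/
def prob (π : L.State → ℝ) (i j : ℕ) : ℝ :=
  if h : i < L.Q₁ + 1 ∧ j < L.Q₂ + 1 then π (⟨i, h.1⟩, ⟨j, h.2⟩) else 0

/-- The probability `π_i` that the data queue has length `i`. -/
def queueProb (π : L.State → ℝ) (i : ℕ) : ℝ :=
  ∑ j ∈ Finset.range (L.Q₂ + 1), L.prob π i j

/-- The average queueing delay. -/
def avgDelay (π : L.State → ℝ) : ℝ :=
  1 / (L.k₁ * L.η₁) * ∑ i ∈ Finset.Icc 1 L.Q₁, (i : ℝ) * L.queueProb π i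

def ξ (i : ℕ) : ℝ :=
  if L.k₁ = 1 then
    if L.k₂ = 1 then (if i = 0 then L.μ₂ else L.μ₂ - L.μ₀)
    else L.μ₂ + L.η₂ * ((L.Q₁ : ℝ) - i)
  else
    if i = 0 then L.μ₀ * L.Q₁ - L.μ₃ + L.k₁ * L.η₁
    else if i + L.k₁ ≤ L.Q₁ then L.k₁ * L.η₁ - L.η₂
    else L.η₁ * ((L.Q₁ : ℝ) - i) - L.η₂

def ζ (i : ℕ) : ℝ :=
  if L.k₁ = 1 then
    if L.k₂ = 1 then 0
    else (if i = 0 then L.μ₂ * L.Q₁ else (1 - L.η₂) * ((L.Q₁ : ℝ) - i) + L.μ₁)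
  else
    if i = 0 then L.μ₂ * ((L.Q₁ : ℝ) - L.k₁ + 1)
    else if i + L.k₁ ≤ L.Q₁ then (L.μ₁ + L.μ₂) * ((L.Q₁ : ℝ) + 1 - i) - L.μ₂ * L.k₁
    else L.μ₁ * ((L.Q₁ : ℝ) + 1 - i)

/-- The normalized average power `π a₀` drawn from the reliable source. -/
def avgPower (π : L.State → ℝ) : ℝ :=
  ∑ i ∈ Finset.range (L.Q₁ + 1), L.ξ i * L.prob π i 0
    - ∑ i ∈ Finset.range (L.Q₁ + 1), L.ζ i * L.prob π i 1

/-- The upper bound on `π_i`, for `1 ≤ i`. -/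
def upperBound (i : ℕ) (π : L.State → ℝ) : ℝ :=
  if L.k₁ = 1 then
    if L.k₂ = 1 then L.φ * L.prob π (i - 1) 0
    else L.τ * (1 - L.η₂) * L.prob π (i - 1) 0 + L.prob π i 0 * (1 - L.η₂)
  else
    if i < L.k₁ then
      L.prob π i 0 * (1 - L.η₂) + ∑ m ∈ Finset.range i, L.τ * L.queueProb π m
    else
      L.τ * (1 - L.η₂) * L.prob π (i - L.k₁) 0 + L.prob π i 0 * (1 - L.η₂)
        + ∑ m ∈ Finset.Ico (i + 1 - L.k₁) i, L.τ * L.queueProb π m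

/-- The lower bound on `π_i`, for `1 ≤ i`. The truncated subtraction in `i + 1 - k₁` is the
positive part. -/
def lowerBound (i : ℕ) (π : L.State → ℝ) : ℝ :=
  if L.k₁ = 1 then 0
  else ∑ m ∈ Finset.Ico (i + 1 - L.k₁) i, L.τ * L.queueProb π m

/-- `π a_i^u`. -/
def upperSlack (i : ℕ) (π : L.State → ℝ) : ℝ := L.queueProb π i - L.upperBound i π

/-- `π a_i^l`. -/
def lowerSlack (i : ℕ) (π : L.State → ℝ) : ℝ := L.lowerBound i π - L.queueProb π i

/-- The constraints of the linear program with power budget `p`. -/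
structure IsFeasible (p : ℝ) (π : L.State → ℝ) : Prop where
  power : L.avgPower π ≤ p
  bounds : ∀ i, 1 ≤ i → i ≤ L.Q₁ →
    L.lowerBound i π ≤ L.queueProb π i ∧ L.queueProb π i ≤ L.upperBound i π
  nonneg : ∀ s, 0 ≤ π s
  sum_one : ∑ s, π s = 1
  balance : L.BatteryBalance π

/-- Optimal solutions of the delay-minimisation linear program with power budget `p`. -/
def IsOptimal (p : ℝ) (π : L.State → ℝ) : Prop :=
  L.IsFeasible p π ∧ ∀ π', L.IsFeasible p π' → L.avgDelay π ≤ L.avgDelay π'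

/-- The linear system that describes the policy based strictly on the threshold `m`. -/
structure SolvesThresholdSystem (m : ℕ) (π : L.State → ℝ) : Prop where
  upper : ∀ i, 1 ≤ i → i ≤ m → L.upperSlack i π = 0
  lower : ∀ i, m < i → i ≤ L.Q₁ → L.lowerSlack i π = 0
  balance : L.BatteryBalance π
  sum_one : ∑ s, π s = 1

/-- The solution `π'_m` of the threshold system (meaningful when it exists and is unique). -/
def thresholdSolution (m : ℕ) : L.State → ℝ :=
  Classical.epsilon (L.SolvesThresholdSystem m)

/-- The power threshold `p̃_m = π'_m a₀`. -/
def powerThreshold (m : ℕ) : ℝ := L.avgPower (L.thresholdSolution m)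

end Link

end

/-!
The proof is Lagrangian: it compares every feasible vector with threshold policies through relative
values of the Markov decision problem in which a slot costs the queue length plus a price `lam` per
unit of power.

A policy uses the reliable source with a probability `c x` that depends on the number `x` of data
packets after the arrivals. By the cut equations of the data queue (`isBalanced_iff`), a vector is
invariant under such a policy iff it solves the battery balance equations and each `π_r` divides the
interval from the lower to the upper bound in the ratio given by `c r`. So feasible vectors are
stationary vectors of policies (`IsFeasible.exists_policy`), and the threshold system describes the
policy `thresholdPolicy m`, whose invariant vector is unique by Poisson's equation
(`exists_poisson`). Pairing the balance with a test function identifies the normalized power with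
the use of the reliable source (`avgPower_eq`).

If `h` is a relative value function of the threshold policy `m`, the cost of another policy exceeds
that of the threshold policy by a weighted sum of the terms `(c r - thresholdPolicy m r) * (lam -
(h r 0 - h (r - 1) 0))` (`cost_sub_eq`). Let `m` be the least threshold that respects the budget. If
`m = 0`, take `lam = 0`; otherwise take the price at which the thresholds `m - 1` and `m` cost the
same, which makes the term of `r = m` vanish (`exists_price`). When the gaps `h r 0 - h (r - 1) 0`
are less than `lam` below `m` and greater than `lam` above `m`, all terms are nonnegative, and a
mixture of the two threshold solutions that exhausts the budget shows that they vanish at every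
optimal solution (`IsOptimal.structure_of_convex`).

It remains to compare the gaps with the price, by minimum principles
(`nonneg_of_min_principle`).

* For `k₁ = 1`, the states lie on lines along which stored energy is used up and data accumulate
  thereafter, and relative values are convex along these lines (`lineDiff_strictMono`), for every
  capacity. The same differences show that the largest threshold draws the least power
  (`powerThreshold_le_avgPower`).
* For `k₁ > 1`, convexity can fail near a full data queue. If `k₁ η₁ < 1`, the price of a bounded
  threshold is bounded independently of `Q₁` (`lam_le_priceBound`), and the drift of the queue keeps
  the effect of the boundary away from the threshold when `Q₁` is large (`pos_of_recursion`); below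
  the threshold the gaps are then increasing (`relDiff_lt_below`). Quadratic test functions show
  that the power of the threshold `m` is at most `max 0 (k₁ η₁ - η₂) + O(1 / m)`, uniformly in `Q₁`,
  so that the least threshold that respects the budget is indeed bounded
  (`exists_powerThreshold_le`). If `k₁ η₁ ≥ 1`, the threshold `0` respects the budget.
-/

open scoped BigOperators

noncomputable section

namespace Link

/-! ### A minimum principle -/

/-- Discrete minimum principle: `x` is nonnegative on a bounded domain if, for every lower bound
`M ≤ 0` of `x`, each negative value of `x` is at least `M` up to a fixed positive weight that is
put either on a point of the domain of smaller rank, or on the value `0`. -/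
theorem nonneg_of_min_principle (x : ℕ → ℕ → ℝ) (dom : ℕ → ℕ → Prop) (rank : ℕ → ℕ → ℕ) (N : ℕ)
    (hN : ∀ i j, dom i j → i ≤ N ∧ j ≤ N) (a : ℝ) (ha : 0 < a)
    (H : ∀ M ≤ 0, (∀ i j, dom i j → M ≤ x i j) → ∀ i j, dom i j → x i j < 0 →
      (∃ i' j', dom i' j' ∧ rank i' j' < rank i j ∧ a * x i' j' + (1 - a) * M ≤ x i j) ∨
        (1 - a) * M ≤ x i j) :
    ∀ i j, dom i j → 0 ≤ x i j := by
  classical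
  by_contra hcon
  push Not at hcon
  obtain ⟨i₀, j₀, hd₀, hx₀⟩ := hcon
  set S : Finset (ℕ × ℕ) :=
    (Finset.range (N + 1) ×ˢ Finset.range (N + 1)).filter fun q => dom q.1 q.2 with hS
  have memS : ∀ i j, (i, j) ∈ S ↔ dom i j := by
    intro i j
    simp only [hS, Finset.mem_filter, Finset.mem_product, Finset.mem_range]
    constructor
    · exact fun h => h.2
    · intro h
      have := hN i j h
      exact ⟨⟨by omega, by omega⟩, h⟩
  obtain ⟨q, hqS, hq⟩ := S.exists_min_image (fun q => x q.1 q.2) ⟨(i₀, j₀), (memS _ _).2 hd₀⟩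
  have hlow : ∀ i j, dom i j → x q.1 q.2 ≤ x i j := fun i j h => hq (i, j) ((memS _ _).2 h)
  set M := x q.1 q.2 with hM
  have hM0 : M < 0 := lt_of_le_of_lt (hlow _ _ hd₀) hx₀
  set A := S.filter fun q => x q.1 q.2 = M with hA
  obtain ⟨s, hsA, hs⟩ := A.exists_min_image (fun q => rank q.1 q.2)
    ⟨q, Finset.mem_filter.2 ⟨hqS, rfl⟩⟩
  obtain ⟨hsS, hsM⟩ := Finset.mem_filter.1 hsA
  rcases H M hM0.le hlow s.1 s.2 ((memS _ _).1 hsS) (by rw [hsM]; exact hM0) with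
    ⟨i', j', hd', hr, hle⟩ | hle
  · rw [hsM] at hle
    have h1 : x i' j' = M := by
      have h2 := hlow i' j' hd'
      have h3 : a * (x i' j' - M) ≤ 0 := by linarith
      have h4 : x i' j' - M ≤ 0 := by
        by_contra h5
        push Not at h5
        nlinarith [mul_pos ha h5]
      linarith
    have := hs (i', j') (Finset.mem_filter.2 ⟨(memS _ _).2 hd', h1⟩)
    simp only at this
    omega
  · rw [hsM] at hle
    nlinarith [mul_pos_of_neg_of_neg hM0 (neg_lt_zero.2 ha)]

/-! ### One step of the chain as an operator on functions -/

/-- The standing assumptions on the parameters common to all cases. -/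
structure Regular (L : Link) : Prop where
  η₁_pos : 0 < L.η₁
  η₁_lt : L.η₁ < 1
  η₂_pos : 0 < L.η₂
  η₂_lt : L.η₂ < 1
  k₁_pos : 0 < L.k₁
  k₂_pos : 0 < L.k₂
  Q₂_pos : 0 < L.Q₂

variable {L : Link}

theorem Regular.μ₀_pos (hL : L.Regular) : 0 < L.μ₀ :=
  mul_pos (by linarith [hL.η₁_lt]) hL.η₂_pos
theorem Regular.μ₁_pos (hL : L.Regular) : 0 < L.μ₁ :=
  mul_pos (by linarith [hL.η₁_lt]) (by linarith [hL.η₂_lt])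
theorem Regular.μ₂_pos (hL : L.Regular) : 0 < L.μ₂ :=
  mul_pos hL.η₁_pos (by linarith [hL.η₂_lt])
theorem Regular.μ₃_pos (hL : L.Regular) : 0 < L.μ₃ := mul_pos hL.η₁_pos hL.η₂_pos

theorem μ_sum (L : Link) : L.μ₀ + L.μ₁ + L.μ₂ + L.μ₃ = 1 := by
  unfold μ₀ μ₁ μ₂ μ₃; ring

/-- Expected value of `h` at the end of a slot, plus `lam` times the expected use of the reliable
source, when there are `x` data and `y` energy packets after the arrivals. The reliable source is
used with a probability `c x` that depends only on the number of data packets after the arrivals. -/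
def serve (L : Link) (c : ℕ → ℝ) (lam : ℝ) (h : ℕ → ℕ → ℝ) (x y : ℕ) : ℝ :=
  if x = 0 then h 0 y
  else if 0 < y then h (min (x - 1) L.Q₁) (y - 1)
  else c x * (lam + h (min (x - 1) L.Q₁) 0) + (1 - c x) * h (min x L.Q₁) 0

/-- Expected value of `h` after one slot, plus `lam` times the expected use of the reliable source,
from the state `(i, j)`. -/
def step (L : Link) (c : ℕ → ℝ) (lam : ℝ) (h : ℕ → ℕ → ℝ) (i j : ℕ) : ℝ :=
  L.μ₀ * L.serve c lam h i (min (j + L.k₂) L.Q₂) + L.μ₁ * L.serve c lam h i j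
    + L.μ₂ * L.serve c lam h (i + L.k₁) j
    + L.μ₃ * L.serve c lam h (i + L.k₁) (min (j + L.k₂) L.Q₂)

theorem serve_zero (c : ℕ → ℝ) (lam : ℝ) (h : ℕ → ℕ → ℝ) (y : ℕ) :
    L.serve c lam h 0 y = h 0 y := by simp [serve]

theorem serve_pos (c : ℕ → ℝ) (lam : ℝ) (h : ℕ → ℕ → ℝ) {x y : ℕ} (hx : 0 < x) (hy : 0 < y) :
    L.serve c lam h x y = h (min (x - 1) L.Q₁) (y - 1) := by
  simp [serve, hx.ne', hy]

theorem serve_empty (c : ℕ → ℝ) (lam : ℝ) (h : ℕ → ℕ → ℝ) {x : ℕ} (hx : 0 < x) :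
    L.serve c lam h x 0
      = c x * (lam + h (min (x - 1) L.Q₁) 0) + (1 - c x) * h (min x L.Q₁) 0 := by
  simp [serve, hx.ne']

theorem prob_state (π : L.State → ℝ) (s : L.State) : L.prob π s.1 s.2 = π s :=
  dif_pos ⟨s.1.2, s.2.2⟩

/-- Sums over the states as double sums over natural numbers. -/
theorem sum_state (π : L.State → ℝ) (F : ℕ → ℕ → ℝ) :
    ∑ s : L.State, π s * F s.1 s.2
      = ∑ i ∈ Finset.range (L.Q₁ + 1), ∑ j ∈ Finset.range (L.Q₂ + 1), L.prob π i j * F i j := by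
  rw [Fintype.sum_prod_type, Finset.sum_range]
  refine Finset.sum_congr rfl fun i _ => ?_
  rw [Finset.sum_range]
  refine Finset.sum_congr rfl fun j _ => ?_
  rw [← prob_state π (i, j)]

theorem sum_indicator_mul (h : ℕ → ℕ → ℝ) {i j : ℕ} (hi : i ≤ L.Q₁) (hj : j ≤ L.Q₂) :
    ∑ t : L.State, (if (t.1 : ℕ) = i ∧ (t.2 : ℕ) = j then (1 : ℝ) else 0) * h t.1 t.2 = h i j := by
  rw [Finset.sum_eq_single (⟨i, by omega⟩, ⟨j, by omega⟩)]
  · simp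
  · rintro ⟨a, b⟩ _ hab
    rw [if_neg, zero_mul]
    rintro ⟨h1, h2⟩
    exact hab (Prod.ext (Fin.ext h1) (Fin.ext h2))
  · simp

theorem sum_serveProb (c : ℕ → ℝ) (h : ℕ → ℕ → ℝ) (x : ℕ) {y : ℕ} (hy : y ≤ L.Q₂) :
    ∑ t : L.State, L.serveProb x y (c x) t * h t.1 t.2 = L.serve c 0 h x y := by
  by_cases hx : x = 0
  · subst hx
    simp only [serveProb, serve, if_true]
    exact sum_indicator_mul h (Nat.zero_le _) hy
  by_cases hy0 : 0 < y
  · simp only [serveProb, serve, hx, hy0, if_true, if_false]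
    exact sum_indicator_mul h (min_le_right _ _) (by omega)
  · simp only [serveProb, serve, hx, hy0, if_false, add_mul, Finset.sum_add_distrib, mul_assoc,
      ← Finset.mul_sum, zero_add]
    rw [sum_indicator_mul h (min_le_right _ _) (Nat.zero_le _),
      sum_indicator_mul h (min_le_right _ _) (Nat.zero_le _)]

/-- The transition matrix of the policy that uses the reliable source with probability `c x` when
there are `x` data packets after the arrivals. -/
def policyMatrix (L : Link) (c : ℕ → ℝ) (s t : L.State) : ℝ :=
  L.transition (fun i => c (i + L.k₁)) c s t

theorem sum_policyMatrix (c : ℕ → ℝ) (h : ℕ → ℕ → ℝ) (s : L.State) :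
    ∑ t, L.policyMatrix c s t * h t.1 t.2 = L.step c 0 h s.1 s.2 := by
  have hj : (s.2 : ℕ) ≤ L.Q₂ := by have := s.2.2; omega
  have hsum : ∀ x, x = (s.1 : ℕ) ∨ x = s.1 + L.k₁ → ∀ y ≤ L.Q₂, ∀ p : ℝ,
      ∑ t : L.State, p * L.serveProb x y (c x) t * h t.1 t.2 = p * L.serve c 0 h x y := by
    intro x _ y hy p
    rw [← sum_serveProb c h x hy, Finset.mul_sum]
    exact Finset.sum_congr rfl fun t _ => by ring
  simp only [policyMatrix, transition, Fintype.sum_bool, arrivalProb, if_true,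
    add_mul, Finset.sum_add_distrib, Bool.false_eq_true, if_false, add_zero, min_eq_left hj]
  rw [hsum _ (Or.inr rfl) _ (min_le_right _ _), hsum _ (Or.inr rfl) _ hj,
    hsum _ (Or.inl rfl) _ (min_le_right _ _), hsum _ (Or.inl rfl) _ hj]
  unfold step μ₀ μ₁ μ₂ μ₃
  ring

theorem serve_affine (c : ℕ → ℝ) (l l' u v : ℝ) (h h' : ℕ → ℕ → ℝ) (x y : ℕ) :
    L.serve c (u * l + v * l') (fun i j => u * h i j + v * h' i j) x y
      = u * L.serve c l h x y + v * L.serve c l' h' x y := by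
  unfold serve; split_ifs <;> ring

theorem step_affine (c : ℕ → ℝ) (l l' u v : ℝ) (h h' : ℕ → ℕ → ℝ) (i j : ℕ) :
    L.step c (u * l + v * l') (fun i j => u * h i j + v * h' i j) i j
      = u * L.step c l h i j + v * L.step c l' h' i j := by
  unfold step; simp only [serve_affine]; ring

theorem step_const (c : ℕ → ℝ) (K : ℝ) (i j : ℕ) : L.step c 0 (fun _ _ => K) i j = K := by
  have h : ∀ x y, L.serve c 0 (fun _ _ => K) x y = K := by
    intro x y; unfold serve; split_ifs <;> ring
  unfold step
  simp only [h]
  linear_combination K * L.μ_sum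

/-- The use of the reliable source enters a step additively. -/
theorem step_lam (c : ℕ → ℝ) (l : ℝ) (h : ℕ → ℕ → ℝ) (i j : ℕ) :
    L.step c l h i j = L.step c 0 h i j + l * L.step c 1 (fun _ _ => 0) i j := by
  have := step_affine (L := L) c 0 1 1 l h (fun _ _ => 0) i j
  simpa using this

theorem serve_congr (c : ℕ → ℝ) (l : ℝ) {h h' : ℕ → ℕ → ℝ}
    (H : ∀ i ≤ L.Q₁, ∀ j ≤ L.Q₂, h i j = h' i j) (x : ℕ) {y : ℕ} (hy : y ≤ L.Q₂) :
    L.serve c l h x y = L.serve c l h' x y := by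
  unfold serve
  split_ifs
  · exact H _ (Nat.zero_le _) _ hy
  · exact H _ (min_le_right _ _) _ (by omega)
  · rw [H _ (min_le_right _ _) _ (Nat.zero_le _), H _ (min_le_right _ _) _ (Nat.zero_le _)]

theorem step_congr (c : ℕ → ℝ) (l : ℝ) {h h' : ℕ → ℕ → ℝ}
    (H : ∀ i ≤ L.Q₁, ∀ j ≤ L.Q₂, h i j = h' i j) (i : ℕ) {j : ℕ} (hj : j ≤ L.Q₂) :
    L.step c l h i j = L.step c l h' i j := by
  unfold step
  rw [serve_congr c l H _ hj, serve_congr c l H _ hj, serve_congr c l H _ (min_le_right _ _),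
    serve_congr c l H _ (min_le_right _ _)]

theorem serve_mono {c : ℕ → ℝ} (hc : ∀ i, c i ∈ Set.Icc (0 : ℝ) 1) (l : ℝ) {h h' : ℕ → ℕ → ℝ}
    (H : ∀ i ≤ L.Q₁, ∀ j ≤ L.Q₂, h i j ≤ h' i j) (x : ℕ) {y : ℕ} (hy : y ≤ L.Q₂) :
    L.serve c l h x y ≤ L.serve c l h' x y := by
  unfold serve
  split_ifs
  · exact H _ (Nat.zero_le _) _ hy
  · exact H _ (min_le_right _ _) _ (by omega)
  · have h1 := H _ (min_le_right (x - 1) _) _ (Nat.zero_le _)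
    have h2 := H _ (min_le_right x _) _ (Nat.zero_le _)
    have h3 := mul_le_mul_of_nonneg_left h1 (hc x).1
    have h4 := mul_le_mul_of_nonneg_left h2 (sub_nonneg.2 (hc x).2)
    linarith

/-! ### Balance in terms of test functions -/

/-- `π` is invariant under the policy `c`; `π` is not required to be a probability vector. -/
def IsBalanced (L : Link) (c : ℕ → ℝ) (π : L.State → ℝ) : Prop :=
  ∀ t, ∑ s, π s * L.policyMatrix c s t = π t

/-- The net flow of the test function `h` under `π` and the policy `c`. -/
def flow (L : Link) (c : ℕ → ℝ) (π : L.State → ℝ) (h : ℕ → ℕ → ℝ) : ℝ :=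
  ∑ s : L.State, π s * (L.step c 0 h s.1 s.2 - h s.1 s.2)

theorem flow_eq (c : ℕ → ℝ) (π : L.State → ℝ) (h : ℕ → ℕ → ℝ) :
    L.flow c π h = ∑ t : L.State, (∑ s, π s * L.policyMatrix c s t - π t) * h t.1 t.2 := by
  unfold flow
  simp only [mul_sub, sub_mul, Finset.sum_sub_distrib, Finset.sum_mul]
  rw [Finset.sum_comm]
  congr 1
  refine Finset.sum_congr rfl fun s _ => ?_
  rw [← sum_policyMatrix, Finset.mul_sum]
  exact Finset.sum_congr rfl fun t _ => by ring

theorem flow_eq_zero_of_isBalanced {c : ℕ → ℝ} {π : L.State → ℝ}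
    (hπ : L.IsBalanced c π) (h : ℕ → ℕ → ℝ) : L.flow c π h = 0 := by
  rw [flow_eq]
  exact Finset.sum_eq_zero fun t _ => by rw [hπ t, sub_self, zero_mul]

theorem batteryBalance_iff (π : L.State → ℝ) (c : ℕ → ℝ) :
    L.BatteryBalance π ↔
      ∀ t : L.State, 0 < (t.2 : ℕ) → ∑ s, π s * L.policyMatrix c s t = π t := by
  refine forall_congr' fun t => forall_congr' fun ht => ?_
  have : ∀ s, L.policyMatrix c s t = L.transition 0 0 s t := fun s =>
    L.transition_eq_of_battery_pos _ _ _ _ s t ht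
  simp only [this]

/-! ### Cut equations for the data queue -/

/-- The width of the interval allowed for the probability of queue length `r`. Up to the factor
`1 - η₁`, this is the rate at which a slot has no harvested energy and `r` data packets
after the arrivals. -/
def width (L : Link) (r : ℕ) (π : L.State → ℝ) : ℝ :=
  (1 - L.η₂) * (L.τ * (if L.k₁ ≤ r then L.prob π (r - L.k₁) 0 else 0) + L.prob π r 0)

theorem lowerBound_eq_sum (r : ℕ) (π : L.State → ℝ) :
    L.lowerBound r π = ∑ m ∈ Finset.Ico (r + 1 - L.k₁) r, L.τ * L.queueProb π m := by
  unfold lowerBound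
  split_ifs with h
  · simp [h]
  · rfl

theorem sum_prob_mul (π : L.State → ℝ) (i : ℕ) (u v : ℝ) :
    ∑ j ∈ Finset.range (L.Q₂ + 1), L.prob π i j * (u + if j = 0 then v else 0)
      = u * L.queueProb π i + v * L.prob π i 0 := by
  simp only [mul_add, Finset.sum_add_distrib, ← Finset.sum_mul, queueProb, mul_ite, mul_zero,
    Finset.sum_ite_eq', Finset.mem_range, Nat.succ_pos, if_true]
  ring

/-- Sums over the states of a function that depends on the battery only through its being empty. -/
theorem sum_state_mul (π : L.State → ℝ) (u v : ℕ → ℝ) :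
    ∑ s : L.State, π s * (u s.1 + if (s.2 : ℕ) = 0 then v s.1 else 0)
      = ∑ i ∈ Finset.range (L.Q₁ + 1), (u i * L.queueProb π i + v i * L.prob π i 0) := by
  rw [sum_state π fun i j => u i + if j = 0 then v i else 0]
  exact Finset.sum_congr rfl fun i _ => sum_prob_mul π i _ _

theorem step_indicator_ge (hL : L.Regular) (c : ℕ → ℝ) {r : ℕ} (hr : 1 ≤ r) (hr' : r ≤ L.Q₁)
    (i j : ℕ) :
    L.step c 0 (fun i _ => if r ≤ i then 1 else 0) i j - (if r ≤ i then 1 else 0)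
      = ((if r + 1 - L.k₁ ≤ i ∧ i < r then L.η₁ else 0) - (if i = r then 1 - L.η₁ else 0))
        + if j = 0 then ((if i + L.k₁ = r then L.μ₂ * (1 - c r) else 0)
            + (if i = r then L.μ₁ * (1 - c r) else 0)) else 0 := by
  have hk := hL.k₁_pos
  have hy : 0 < min (j + L.k₂) L.Q₂ := lt_min (by have := hL.k₂_pos; omega) hL.Q₂_pos
  have hsv : ∀ x y, L.serve c 0 (fun i _ => if r ≤ i then (1 : ℝ) else 0) x y
      = if r < x then 1 else if x = r ∧ y = 0 then 1 - c r else 0 := by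
    intro x y
    rcases Nat.eq_zero_or_pos x with hx | hx
    · subst hx
      rw [serve_zero, if_neg (by omega), if_neg (by omega), if_neg (by omega)]
    rcases Nat.eq_zero_or_pos y with hy | hy
    · subst hy
      rw [serve_empty _ _ _ hx]
      rcases lt_trichotomy r x with h | h | h
      · rw [if_pos (le_min (by omega) hr'), if_pos (le_min h.le hr'), if_pos h]; ring
      · subst h
        rw [if_neg (by simp; omega), if_pos (le_min le_rfl hr'), if_neg (lt_irrefl _),
          if_pos ⟨rfl, rfl⟩]
        ring
      · rw [if_neg (by simp; omega), if_neg (by simp; omega), if_neg (by omega),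
          if_neg (by omega)]
        ring
    · rw [serve_pos _ _ _ hx hy]
      by_cases h : r < x
      · rw [if_pos h, if_pos (le_min (by omega) hr')]
      · rw [if_neg h, if_neg (by simp; omega), if_neg (by omega)]
  unfold step
  simp only [hsv, hy.ne', and_false, if_false]
  have e0 : L.μ₀ + L.μ₁ = 1 - L.η₁ := by unfold μ₀ μ₁; ring
  have e1 : L.μ₂ + L.μ₃ = L.η₁ := by unfold μ₂ μ₃; ring
  rcases lt_trichotomy r i with h | h | h
  · have f1 : r < i + L.k₁ := by omega
    have f2 : ¬ i < r := by omega
    have f3 : ¬ i = r := by omega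
    have f4 : ¬ i + L.k₁ = r := by omega
    simp only [h, f1, f2, f3, f4, h.le, if_true, if_false, and_false, add_zero, ite_self]
    linear_combination e0 + e1
  · subst h
    have f1 : r < r + L.k₁ := by omega
    have f4 : ¬ r + L.k₁ = r := by omega
    simp only [f1, f4, lt_irrefl, le_refl, if_true, if_false, and_false, true_and, zero_add]
    by_cases hj : j = 0 <;> simp only [hj, if_true, if_false] <;> linear_combination e1
  · have f2 : ¬ r < i := by omega
    have f3 : ¬ i = r := by omega
    have f5 : ¬ r ≤ i := by omega
    simp only [h, f2, f3, f5, if_false, and_true, false_and, add_zero]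
    rcases lt_trichotomy r (i + L.k₁) with h' | h' | h'
    · have f4 : ¬ i + L.k₁ = r := by omega
      have f6 : r + 1 - L.k₁ ≤ i := by omega
      simp only [h', f4, f6, if_true, if_false, ite_self]
      linear_combination e1
    · have f6 : ¬ r + 1 - L.k₁ ≤ i := by omega
      simp only [f6, ← h', true_and, lt_irrefl, if_true, if_false]
      by_cases hj : j = 0 <;> simp only [hj, if_true, if_false] <;> ring
    · have f1 : ¬ r < i + L.k₁ := by omega
      have f4 : ¬ i + L.k₁ = r := by omega
      have f6 : ¬ r + 1 - L.k₁ ≤ i := by omega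
      simp only [f1, f4, f6, false_and, if_false, ite_self]
      ring

/-- The flow across the cut between the queue lengths `r - 1` and `r`. -/
theorem flow_indicator_ge (hL : L.Regular) (c : ℕ → ℝ) (π : L.State → ℝ) {r : ℕ} (hr : 1 ≤ r)
    (hr' : r ≤ L.Q₁) :
    L.flow c π (fun i _ => if r ≤ i then 1 else 0)
      = (1 - L.η₁) * (L.lowerBound r π + (1 - c r) * L.width r π - L.queueProb π r) := by
  have hk := hL.k₁_pos
  have h1 : 1 - L.η₁ ≠ 0 := by linarith [hL.η₁_lt]
  unfold flow
  simp only [step_indicator_ge hL c hr hr']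
  rw [sum_state_mul π (fun i => (if r + 1 - L.k₁ ≤ i ∧ i < r then L.η₁ else 0)
    - (if i = r then 1 - L.η₁ else 0)) (fun i => (if i + L.k₁ = r then L.μ₂ * (1 - c r) else 0)
            + (if i = r then L.μ₁ * (1 - c r) else 0))]
  simp only [add_mul, sub_mul, Finset.sum_add_distrib, Finset.sum_sub_distrib, ite_mul, zero_mul]
  rw [Finset.sum_ite_eq', Finset.sum_ite_eq', if_pos (by simp; omega), if_pos (by simp; omega)]
  have s1 : ∑ x ∈ Finset.range (L.Q₁ + 1),
      (if r + 1 - L.k₁ ≤ x ∧ x < r then L.η₁ * L.queueProb π x else 0)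
      = (1 - L.η₁) * L.lowerBound r π := by
    rw [lowerBound_eq_sum, ← Finset.sum_filter, Finset.mul_sum]
    have : (Finset.range (L.Q₁ + 1)).filter (fun x => r + 1 - L.k₁ ≤ x ∧ x < r)
        = Finset.Ico (r + 1 - L.k₁) r := by
      ext x; simp; omega
    rw [this]
    refine Finset.sum_congr rfl fun x _ => ?_
    unfold τ; field_simp
  have s2 : ∑ x ∈ Finset.range (L.Q₁ + 1),
      (if x + L.k₁ = r then L.μ₂ * (1 - c r) * L.prob π x 0 else 0)
      = L.μ₂ * (1 - c r) * (if L.k₁ ≤ r then L.prob π (r - L.k₁) 0 else 0) := by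
    split_ifs with h
    · rw [Finset.sum_eq_single (r - L.k₁)]
      · rw [if_pos (by omega)]
      · intro b _ hb; rw [if_neg (by omega)]
      · intro h; exact absurd (Finset.mem_range.2 (by omega)) h
    · rw [mul_zero]
      exact Finset.sum_eq_zero fun x _ => if_neg (by omega)
  rw [s1, s2]
  unfold width τ μ₁ μ₂
  field_simp
  ring

/-- A vector is balanced under a policy iff it satisfies the battery balance equations and, at each
queue length, the cut equation. -/
theorem isBalanced_iff (hL : L.Regular) (c : ℕ → ℝ) (π : L.State → ℝ) :
    L.IsBalanced c π ↔ L.BatteryBalance π ∧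
      ∀ r, 1 ≤ r → r ≤ L.Q₁ → L.queueProb π r = L.lowerBound r π + (1 - c r) * L.width r π := by
  have h1 : 1 - L.η₁ ≠ 0 := by linarith [hL.η₁_lt]
  constructor
  · intro h
    refine ⟨(batteryBalance_iff π c).2 fun t _ => h t, fun r hr hr' => ?_⟩
    have := flow_indicator_ge hL c π hr hr'
    rw [flow_eq_zero_of_isBalanced h] at this
    have := (mul_eq_zero.1 this.symm).resolve_left h1
    linarith
  · rintro ⟨hb, hcut⟩
    have hge : ∀ r, L.flow c π (fun i _ => if r ≤ i then 1 else 0) = 0 := by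
      intro r
      rcases Nat.eq_zero_or_pos r with h | h
      · subst h
        simp only [Nat.zero_le, if_true, flow, step_const, sub_self, mul_zero,
          Finset.sum_const_zero]
      · by_cases h' : r ≤ L.Q₁
        · rw [flow_indicator_ge hL c π h h', hcut r h h']; ring
        · have h0 : ∀ i ≤ L.Q₁, ∀ j ≤ L.Q₂, (if r ≤ i then (1 : ℝ) else 0) = 0 :=
            fun i hi j _ => if_neg (by omega)
          refine Finset.sum_eq_zero fun s _ => ?_
          have h1 := s.1.2
          have h2 := s.2.2
          rw [step_congr c 0 h0 _ (by omega), step_const]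
          simp only [if_neg (show ¬ r ≤ (s.1 : ℕ) by omega), sub_self, mul_zero]
    -- the balance defect `d` is only to be shown zero at the states with empty battery
    set d : L.State → ℝ := fun t => ∑ s, π s * L.policyMatrix c s t - π t with hd
    have hd0 : ∀ t : L.State, 0 < (t.2 : ℕ) → d t = 0 := fun t ht => by
      simp only [hd, (batteryBalance_iff π c).1 hb t ht, sub_self]
    intro t
    suffices hdt : d t = 0 from sub_eq_zero.1 hdt
    by_cases ht : 0 < (t.2 : ℕ)
    · exact hd0 t ht
    have e : L.flow c π (fun i _ => if (t.1 : ℕ) ≤ i then 1 else 0)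
        - L.flow c π (fun i _ => if (t.1 : ℕ) + 1 ≤ i then 1 else 0) = d t := by
      rw [flow_eq, flow_eq, ← Finset.sum_sub_distrib, Finset.sum_eq_single t]
      · simp [hd]
      · intro s _ hst
        by_cases hs : 0 < (s.2 : ℕ)
        · have := hd0 s hs
          simp only [hd] at this
          rw [this]; ring
        · have : (s.1 : ℕ) ≠ t.1 := by
            intro hc
            exact hst (Prod.ext (Fin.ext hc) (Fin.ext (by omega)))
          have : ((t.1 : ℕ) ≤ s.1) ↔ ((t.1 : ℕ) + 1 ≤ s.1) := by omega
          simp [this]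
      · simp
    rw [← e, hge, hge, sub_zero]

/-! ### Poisson's equation and stationary vectors -/

theorem serve_const (c : ℕ → ℝ) (K : ℝ) (x y : ℕ) : L.serve c 0 (fun _ _ => K) x y = K := by
  unfold serve; split_ifs <;> ring

/-- A superharmonic function is minimal at the state with empty data queue and full battery, which
is reached from every state when no data but energy arrive. -/
theorem min_of_superharmonic (hL : L.Regular) {c : ℕ → ℝ} (hc : ∀ i, c i ∈ Set.Icc (0 : ℝ) 1)
    {h : ℕ → ℕ → ℝ} (hh : ∀ i ≤ L.Q₁, ∀ j ≤ L.Q₂, L.step c 0 h i j ≤ h i j) :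
    ∀ i ≤ L.Q₁, ∀ j ≤ L.Q₂, h 0 L.Q₂ ≤ h i j := by
  have hk := hL.k₂_pos
  have hQ := hL.Q₂_pos
  have key := nonneg_of_min_principle (fun i j => h i j - h 0 L.Q₂)
    (fun i j => i ≤ L.Q₁ ∧ j ≤ L.Q₂) (fun i j => i * (L.Q₂ + 1) + (L.Q₂ - j)) (L.Q₁ + L.Q₂)
    (fun i j hij => ⟨by omega, by omega⟩) L.μ₀ hL.μ₀_pos ?_
  · exact fun i hi j hj => sub_nonneg.1 (key i j ⟨hi, hj⟩)
  rintro M hM hlow i j ⟨hi, hj⟩ hx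
  left
  have hlow' : ∀ i ≤ L.Q₁, ∀ j ≤ L.Q₂, h 0 L.Q₂ + M ≤ h i j := fun i hi j hj => by
    have := hlow i j ⟨hi, hj⟩; linarith
  have hs : ∀ x, ∀ y ≤ L.Q₂, h 0 L.Q₂ + M ≤ L.serve c 0 h x y := fun x y hy => by
    have := serve_mono hc 0 (h := fun _ _ => h 0 L.Q₂ + M) hlow' x hy
    rwa [serve_const] at this
  have hstep := hh i hi j hj
  unfold step at hstep
  have hμ := L.μ_sum
  have t1 := mul_le_mul_of_nonneg_left (hs i j hj) hL.μ₁_pos.le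
  have t2 := mul_le_mul_of_nonneg_left (hs (i + L.k₁) j hj) hL.μ₂_pos.le
  have t3 := mul_le_mul_of_nonneg_left (hs (i + L.k₁) _ (min_le_right (j + L.k₂) _)) hL.μ₃_pos.le
  have fin : ∀ v, L.serve c 0 h i (min (j + L.k₂) L.Q₂) = v →
      L.μ₀ * (v - h 0 L.Q₂) + (1 - L.μ₀) * M ≤ h i j - h 0 L.Q₂ := by
    intro v hv
    rw [hv] at hstep
    have e1 : L.μ₁ = 1 - L.μ₀ - L.μ₂ - L.μ₃ := by linarith
    rw [e1] at hstep t1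
    nlinarith
  rcases Nat.eq_zero_or_pos i with h0 | h0
  · subst h0
    have hjlt : j < L.Q₂ := by
      rcases Nat.lt_or_ge j L.Q₂ with h | h
      · exact h
      · have : j = L.Q₂ := by omega
        subst this; exact absurd hx (by simp)
    exact ⟨0, min (j + L.k₂) L.Q₂, ⟨Nat.zero_le _, min_le_right _ _⟩, by show _ + _ < _ + _; omega,
      fin _ (serve_zero _ _ _ _)⟩
  · obtain ⟨i, rfl⟩ : ∃ i', i = i' + 1 := ⟨i - 1, by omega⟩
    refine ⟨i, min (j + L.k₂) L.Q₂ - 1, ⟨by omega, by omega⟩, ?_, fin _ ?_⟩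
    · show _ + _ < _ + _
      rw [add_mul]; omega
    · rw [serve_pos _ _ _ (by omega) (by omega)]
      congr 1
      omega

/-- Poisson's equation is solvable for every cost function `r`: the operator that maps `h` to
`h - step h + h (0, Q₂)` is injective, by the minimum principle, hence surjective. -/
theorem exists_poisson (hL : L.Regular) {c : ℕ → ℝ} (hc : ∀ i, c i ∈ Set.Icc (0 : ℝ) 1)
    (r : ℕ → ℕ → ℝ) :
    ∃ (h : ℕ → ℕ → ℝ) (G : ℝ), ∀ i ≤ L.Q₁, ∀ j ≤ L.Q₂,
      h i j = r i j - G + L.step c 0 h i j := by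
  let s₀ : L.State := (⟨0, by omega⟩, ⟨L.Q₂, by omega⟩)
  let Φ : (L.State → ℝ) →ₗ[ℝ] (L.State → ℝ) :=
    { toFun := fun h s => h s - ∑ t, L.policyMatrix c s t * h t + h s₀
      map_add' := fun h h' => by
        funext s
        simp only [Pi.add_apply, mul_add, Finset.sum_add_distrib]; ring
      map_smul' := fun u h => by
        funext s
        simp only [Pi.smul_apply, smul_eq_mul, RingHom.id_apply, mul_left_comm _ u,
          ← Finset.mul_sum]
        ring }
  have hΦ : ∀ (h : L.State → ℝ) (i : ℕ) (hi : i ≤ L.Q₁) (j : ℕ) (hj : j ≤ L.Q₂),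
      Φ h (⟨i, by omega⟩, ⟨j, by omega⟩)
        = L.prob h i j - L.step c 0 (L.prob h) i j + L.prob h 0 L.Q₂ := by
    intro h i hi j hj
    have e := sum_policyMatrix c (L.prob h) ((⟨i, by omega⟩, ⟨j, by omega⟩) : L.State)
    simp only [prob_state] at e
    have e1 := prob_state h (⟨i, by omega⟩, ⟨j, by omega⟩)
    have e2 := prob_state h s₀
    simp only [s₀] at e1 e2
    simp only [Φ, LinearMap.coe_mk, AddHom.coe_mk, e, s₀, ← e1, ← e2]
  have hinj : Function.Injective Φ := by
    rw [← LinearMap.ker_eq_bot, LinearMap.ker_eq_bot']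
    -- it suffices that the value of a kernel element at `(0, Q₂)` cannot be negative
    have main : ∀ h, Φ h = 0 → L.prob h 0 L.Q₂ ≤ 0 →
        0 ≤ L.prob h 0 L.Q₂ ∧ ∀ i ≤ L.Q₁, ∀ j ≤ L.Q₂, L.prob h 0 L.Q₂ ≤ L.prob h i j := by
      intro h h0 hneg
      have hsup := min_of_superharmonic hL hc (h := L.prob h) (fun i hi j hj => by
        have := hΦ h i hi j hj
        rw [h0] at this
        simp only [Pi.zero_apply] at this
        linarith)
      refine ⟨?_, hsup⟩
      have e := hΦ h 0 (Nat.zero_le _) L.Q₂ le_rfl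
      rw [h0] at e
      simp only [Pi.zero_apply] at e
      have : L.prob h 0 L.Q₂ ≤ L.step c 0 (L.prob h) 0 L.Q₂ := by
        have hs : ∀ x, ∀ y ≤ L.Q₂, L.prob h 0 L.Q₂ ≤ L.serve c 0 (L.prob h) x y := fun x y hy => by
          have := serve_mono hc 0 (h := fun _ _ => L.prob h 0 L.Q₂) hsup x hy
          rwa [serve_const] at this
        unfold step
        have t0 := mul_le_mul_of_nonneg_left (hs 0 _ (min_le_right (L.Q₂ + L.k₂) _)) hL.μ₀_pos.le
        have t1 := mul_le_mul_of_nonneg_left (hs 0 _ le_rfl) hL.μ₁_pos.le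
        have t2 := mul_le_mul_of_nonneg_left (hs (0 + L.k₁) _ le_rfl) hL.μ₂_pos.le
        have t3 := mul_le_mul_of_nonneg_left
          (hs (0 + L.k₁) _ (min_le_right (L.Q₂ + L.k₂) _)) hL.μ₃_pos.le
        have hμ := L.μ_sum
        have : L.prob h 0 L.Q₂ = L.μ₀ * L.prob h 0 L.Q₂ + L.μ₁ * L.prob h 0 L.Q₂
          + L.μ₂ * L.prob h 0 L.Q₂ + L.μ₃ * L.prob h 0 L.Q₂ := by
          rw [← add_mul, ← add_mul, ← add_mul, hμ, one_mul]
        linarith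
      linarith
    have hneg : ∀ (h : L.State → ℝ) i j, L.prob (-h) i j = -L.prob h i j := by
      intro h i j; unfold prob; split_ifs <;> simp
    intro h h0
    have h0' : Φ (-h) = 0 := by rw [map_neg, h0, neg_zero]
    have hz : L.prob h 0 L.Q₂ = 0 := by
      rcases le_total (L.prob h 0 L.Q₂) 0 with hle | hle
      · exact le_antisymm hle (main h h0 hle).1
      · have := (main (-h) h0' (by rw [hneg]; linarith)).1
        rw [hneg] at this
        linarith
    have m1 := (main h h0 hz.le).2
    have m2 := (main (-h) h0' (by rw [hneg, hz, neg_zero])).2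
    funext s
    have b1 := s.1.2
    have b2 := s.2.2
    have p1 := m1 s.1 (by omega) s.2 (by omega)
    have p2 := m2 s.1 (by omega) s.2 (by omega)
    rw [hneg, hneg] at p2
    rw [prob_state, hz] at p1
    rw [prob_state, hz] at p2
    simp only [Pi.zero_apply]
    linarith
  obtain ⟨h, hh⟩ := (LinearMap.injective_iff_surjective.1 hinj) (fun s => r s.1 s.2)
  refine ⟨L.prob h, L.prob h 0 L.Q₂, fun i hi j hj => ?_⟩
  have := hΦ h i hi j hj
  rw [hh] at this
  simp only at this
  linarith

/-- Balanced vectors of the same total mass coincide. -/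
theorem IsBalanced.unique (hL : L.Regular) {c : ℕ → ℝ} (hc : ∀ i, c i ∈ Set.Icc (0 : ℝ) 1)
    {π π' : L.State → ℝ} (hπ : L.IsBalanced c π) (hπ' : L.IsBalanced c π')
    (hs : ∑ s, π s = ∑ s, π' s) : π = π' := by
  classical
  funext s
  -- pair both vectors with Poisson's equation for the indicator of the state `s`
  obtain ⟨h, G, hh⟩ := exists_poisson hL hc
    (fun i j => if i = s.1 ∧ j = s.2 then (1 : ℝ) else 0)
  have main : ∀ π : L.State → ℝ, L.IsBalanced c π → π s = G * ∑ t, π t := by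
    intro π hπ
    have hf := flow_eq_zero_of_isBalanced hπ h
    unfold flow at hf
    have : ∀ t : L.State, π t * (L.step c 0 h t.1 t.2 - h t.1 t.2)
        = G * π t - (if t = s then π t else 0) := by
      intro t
      have b1 := t.1.2
      have b2 := t.2.2
      rw [hh t.1 (by omega) t.2 (by omega)]
      have : ((t.1 : ℕ) = s.1 ∧ (t.2 : ℕ) = s.2) ↔ t = s :=
        ⟨fun h => Prod.ext (Fin.ext h.1) (Fin.ext h.2), fun h => by simp [h]⟩
      simp only [this]
      split_ifs <;> ring
    simp only [this, Finset.sum_sub_distrib, ← Finset.mul_sum, Finset.sum_ite_eq',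
      Finset.mem_univ, if_true] at hf
    linarith
  rw [main π hπ, main π' hπ', hs]

theorem policyMatrix_nonneg (hL : L.Regular) {c : ℕ → ℝ} (hc : ∀ i, c i ∈ Set.Icc (0 : ℝ) 1)
    (s t : L.State) : 0 ≤ L.policyMatrix c s t := by
  have hη := hL.η₁_pos
  have hη' := hL.η₁_lt
  have hθ := hL.η₂_pos
  have hθ' := hL.η₂_lt
  have ha : ∀ η : ℝ, 0 < η → η < 1 → ∀ b, 0 ≤ arrivalProb η b := by
    intro η h0 h1 b
    cases b
    · exact sub_nonneg.2 h1.le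
    · exact h0.le
  unfold policyMatrix transition
  refine Finset.sum_nonneg fun a _ => Finset.sum_nonneg fun e _ =>
    mul_nonneg (mul_nonneg (ha _ hη hη' a) (ha _ hθ hθ' e)) ?_
  have hr : ∀ x y r, 0 ≤ r → r ≤ 1 → 0 ≤ L.serveProb x y r t := by
    intro x y r h0 h1
    have h2 : 0 ≤ 1 - r := sub_nonneg.2 h1
    unfold serveProb
    dsimp only
    split_ifs <;> simp [h0, h2]
  cases a
  · exact hr _ _ _ (hc _).1 (hc _).2
  · exact hr _ _ _ (hc _).1 (hc _).2

theorem sum_policyMatrix_eq_one (c : ℕ → ℝ) (s : L.State) : ∑ t, L.policyMatrix c s t = 1 := by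
  have := sum_policyMatrix c (fun _ _ => 1) s
  simpa [step_const] using this

/-- Every policy has a stationary distribution: the absolute value of a vector fixed by a
stochastic matrix is fixed as well. -/
theorem exists_isBalanced (hL : L.Regular) {c : ℕ → ℝ} (hc : ∀ i, c i ∈ Set.Icc (0 : ℝ) 1) :
    ∃ π, L.IsBalanced c π ∧ (∀ s, 0 ≤ π s) ∧ ∑ s, π s = 1 := by
  classical
  let A : Matrix L.State L.State ℝ := Matrix.of (L.policyMatrix c) - 1
  have hdet : A.det = 0 := by
    refine Matrix.exists_mulVec_eq_zero_iff.1 ⟨fun _ => 1, ?_, ?_⟩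
    · intro h
      have := congrFun h (0, 0)
      simp at this
    · funext s
      rw [Matrix.sub_mulVec, Matrix.one_mulVec]
      simp only [Pi.sub_apply, Pi.zero_apply, Matrix.mulVec, dotProduct, Matrix.of_apply, mul_one,
        sum_policyMatrix_eq_one, sub_self]
  obtain ⟨v, hv0, hv⟩ := Matrix.exists_vecMul_eq_zero_iff.2 hdet
  have hvb : ∀ t, ∑ s, v s * L.policyMatrix c s t = v t := by
    intro t
    have := congrFun hv t
    rw [Matrix.vecMul_sub, Matrix.vecMul_one] at this
    simp only [Pi.sub_apply, Pi.zero_apply, Matrix.vecMul, dotProduct, Matrix.of_apply] at this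
    linarith
  have hle : ∀ t, |v t| ≤ ∑ s, |v s| * L.policyMatrix c s t := by
    intro t
    conv_lhs => rw [← hvb t]
    refine (Finset.abs_sum_le_sum_abs _ _).trans (le_of_eq (Finset.sum_congr rfl fun s _ => ?_))
    rw [abs_mul, abs_of_nonneg (policyMatrix_nonneg hL hc s t)]
  have htot : ∑ t, (∑ s, |v s| * L.policyMatrix c s t - |v t|) = 0 := by
    rw [Finset.sum_sub_distrib, Finset.sum_comm]
    simp only [← Finset.mul_sum, sum_policyMatrix_eq_one, mul_one, sub_self]
  have hbal : ∀ t, ∑ s, |v s| * L.policyMatrix c s t = |v t| := by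
    intro t
    have := (Finset.sum_eq_zero_iff_of_nonneg fun t _ => sub_nonneg.2 (hle t)).1 htot t
      (Finset.mem_univ t)
    linarith
  have hS : 0 < ∑ s, |v s| := by
    obtain ⟨s, hs⟩ := Function.ne_iff.1 hv0
    exact Finset.sum_pos' (fun s _ => abs_nonneg _) ⟨s, Finset.mem_univ _, abs_pos.2 hs⟩
  refine ⟨fun s => |v s| / ∑ s, |v s|, fun t => ?_, fun s => by positivity, ?_⟩
  · simp only [div_mul_eq_mul_div, ← Finset.sum_div, hbal t]
  · rw [← Finset.sum_div, div_self hS.ne']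

/-! ### The constraints in the three cases -/

/-- The three cases for the sizes of the arrivals. -/
def SmallArrivals (L : Link) : Prop :=
  (L.k₁ = 1 ∧ L.k₂ = 1) ∨ (L.k₁ = 1 ∧ 1 < L.k₂ ∧ 2 ≤ L.Q₂) ∨ (1 < L.k₁ ∧ L.k₂ = 1 ∧ 2 ≤ L.Q₂)

/-- If single packets arrive in both queues, data and stored energy never coexist. The vector `π`
is not required to be nonnegative. -/
theorem prob_eq_zero_of_unit_arrivals (hL : L.Regular) (hk₁ : L.k₁ = 1) (hk₂ : L.k₂ = 1)
    {π : L.State → ℝ} (hπ : L.BatteryBalance π) {i j : ℕ} (hi : 1 ≤ i) (hj : 1 ≤ j) :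
    L.prob π i j = 0 := by
  by_cases hij : i ≤ L.Q₁ ∧ j ≤ L.Q₂
  swap
  · unfold prob; rw [dif_neg (by omega)]
  -- the weight `w` strictly decreases in expectation at the states in question, and `|π|`
  -- cannot lose weight
  set w : ℕ → ℕ → ℝ := fun i j => if j = 0 then 0 else i with hw
  set c : ℕ → ℝ := fun _ => 0 with hc
  have hw0 : ∀ i j, 0 ≤ w i j := by
    intro i j; simp only [hw]; split_ifs <;> positivity
  have hsv : ∀ x y, L.serve c 0 w x y ≤ if y ≤ 1 then 0 else ((x - 1 : ℕ) : ℝ) := by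
    intro x y
    rcases Nat.eq_zero_or_pos x with h | h
    · subst h; rw [serve_zero]; simp [hw]
    rcases Nat.eq_zero_or_pos y with h' | h'
    · subst h'; rw [serve_empty _ _ _ h]; simp [hw]
    rw [serve_pos _ _ _ h h']
    simp only [hw]
    by_cases hy : y ≤ 1
    · rw [if_pos hy, if_pos (by omega)]
    · rw [if_neg hy, if_neg (by omega)]
      exact_mod_cast min_le_left _ _
  have hstep : ∀ i j, L.step c 0 w i j ≤ w i j - if 1 ≤ i ∧ 1 ≤ j then 1 - L.η₁ else 0 := by
    intro i j
    unfold step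
    rw [hk₁, hk₂]
    have m0 := hL.μ₀_pos.le
    have m1 := hL.μ₁_pos.le
    have m2 := hL.μ₂_pos.le
    have m3 := hL.μ₃_pos.le
    by_cases hj : 1 ≤ j
    · have hsv' : ∀ x y, L.serve c 0 w x y ≤ ((x - 1 : ℕ) : ℝ) := by
        intro x y
        refine (hsv x y).trans ?_
        split_ifs
        · positivity
        · exact le_rfl
      have hwj : w i j = i := by simp only [hw]; rw [if_neg (by omega)]
      have a0 := mul_le_mul_of_nonneg_left (hsv' i (min (j + 1) L.Q₂)) m0
      have a1 := mul_le_mul_of_nonneg_left (hsv' i j) m1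
      have a2 := mul_le_mul_of_nonneg_left (hsv' (i + 1) j) m2
      have a3 := mul_le_mul_of_nonneg_left (hsv' (i + 1) (min (j + 1) L.Q₂)) m3
      rw [hwj]
      have e0 : L.μ₀ + L.μ₁ = 1 - L.η₁ := by unfold μ₀ μ₁; ring
      have e1 : L.μ₂ + L.μ₃ = L.η₁ := by unfold μ₂ μ₃; ring
      rw [Nat.add_sub_cancel] at a2 a3
      by_cases hi : 1 ≤ i
      · rw [if_pos ⟨hi, hj⟩]
        rw [Nat.cast_sub hi] at a0 a1
        push_cast at a0 a1
        have f0 : L.μ₀ * ((i : ℝ) - 1) + L.μ₁ * (i - 1) = (1 - L.η₁) * (i - 1) := by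
          rw [← add_mul, e0]
        have f1 : L.μ₂ * (i : ℝ) + L.μ₃ * i = L.η₁ * i := by rw [← add_mul, e1]
        linarith
      · have : i = 0 := by omega
        subst this
        rw [if_neg (by omega)]
        simp at a0 a1 a2 a3 ⊢
        linarith
    · have hj0 : j = 0 := by omega
      subst hj0
      have hsv' : ∀ x y, y ≤ 1 → L.serve c 0 w x y ≤ 0 := fun x y hy => by
        have := hsv x y
        rwa [if_pos hy] at this
      have a0 := mul_le_mul_of_nonneg_left (hsv' i (min (0 + 1) L.Q₂) (by omega)) m0
      have a1 := mul_le_mul_of_nonneg_left (hsv' i 0 (by omega)) m1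
      have a2 := mul_le_mul_of_nonneg_left (hsv' (i + 1) 0 (by omega)) m2
      have a3 := mul_le_mul_of_nonneg_left (hsv' (i + 1) (min (0 + 1) L.Q₂) (by omega)) m3
      rw [if_neg (by omega)]
      simp only [hw, if_true]
      linarith
  have hcm : ∀ i, c i ∈ Set.Icc (0 : ℝ) 1 := fun i => by simp [hc]
  have h1 : ∑ t : L.State, |π t| * w t.1 t.2 ≤ ∑ s : L.State, |π s| * L.step c 0 w s.1 s.2 := by
    simp only [← sum_policyMatrix c w, Finset.mul_sum]
    rw [Finset.sum_comm]
    refine Finset.sum_le_sum fun t _ => ?_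
    by_cases ht : 0 < (t.2 : ℕ)
    · rw [← (batteryBalance_iff π c).1 hπ t ht]
      calc |∑ s, π s * L.policyMatrix c s t| * w t.1 t.2
          ≤ (∑ s, |π s * L.policyMatrix c s t|) * w t.1 t.2 :=
            mul_le_mul_of_nonneg_right (Finset.abs_sum_le_sum_abs _ _) (hw0 _ _)
        _ = _ := by
            rw [Finset.sum_mul]
            refine Finset.sum_congr rfl fun s _ => ?_
            rw [abs_mul, abs_of_nonneg (policyMatrix_nonneg hL hcm s t), mul_assoc]
    · have : w t.1 t.2 = 0 := by simp only [hw]; rw [if_pos (by omega)]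
      simp [this]
  have h2 : ∑ s : L.State, |π s| * (if 1 ≤ (s.1 : ℕ) ∧ 1 ≤ (s.2 : ℕ) then 1 - L.η₁ else 0) ≤ 0 := by
    have : ∀ s : L.State, |π s| * (if 1 ≤ (s.1 : ℕ) ∧ 1 ≤ (s.2 : ℕ) then 1 - L.η₁ else 0)
        ≤ |π s| * w s.1 s.2 - |π s| * L.step c 0 w s.1 s.2 := by
      intro s
      have := mul_le_mul_of_nonneg_left (hstep s.1 s.2) (abs_nonneg (π s))
      linarith
    have := Finset.sum_le_sum fun s (_ : s ∈ Finset.univ) => this s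
    rw [Finset.sum_sub_distrib] at this
    linarith
  have hη : 0 < 1 - L.η₁ := sub_pos.2 hL.η₁_lt
  have h3 : ∀ s : L.State,
      0 ≤ |π s| * (if 1 ≤ (s.1 : ℕ) ∧ 1 ≤ (s.2 : ℕ) then 1 - L.η₁ else 0) := by
    intro s
    split_ifs <;> positivity
  have h4 := (Finset.sum_eq_zero_iff_of_nonneg fun s _ => h3 s).1
    (le_antisymm h2 (Finset.sum_nonneg fun s _ => h3 s))
    ((⟨i, by omega⟩, ⟨j, by omega⟩) : L.State) (Finset.mem_univ _)
  simp only [hi, hj, and_self, if_true] at h4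
  have h5 := (mul_eq_zero.1 h4).resolve_right hη.ne'
  have h6 := prob_state π ((⟨i, by omega⟩, ⟨j, by omega⟩) : L.State)
  exact h6.trans (abs_eq_zero.1 h5)

theorem queueProb_eq_of_unit_arrivals (hL : L.Regular) (hk₁ : L.k₁ = 1) (hk₂ : L.k₂ = 1)
    {π : L.State → ℝ} (hπ : L.BatteryBalance π) {i : ℕ} (hi : 1 ≤ i) :
    L.queueProb π i = L.prob π i 0 := by
  unfold queueProb
  refine Finset.sum_eq_single 0 (fun j _ hj => ?_) (fun h => absurd (by simp) h)
  exact prob_eq_zero_of_unit_arrivals hL hk₁ hk₂ hπ hi (by omega)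

/-- The upper slack, expressed through the lower bound and the width, up to a positive factor. -/
theorem exists_upperSlack_eq (hL : L.Regular) (hC : L.SmallArrivals) :
    ∃ κ : ℝ, 0 < κ ∧ ∀ π : L.State → ℝ, L.BatteryBalance π → ∀ r, 1 ≤ r →
      κ * L.upperSlack r π = L.queueProb π r - (L.lowerBound r π + L.width r π) := by
  have h0 := hL.η₂_pos
  have h1 : 0 < 1 - L.η₁ := sub_pos.2 hL.η₁_lt
  rcases hC with ⟨hk₁, hk₂⟩ | ⟨hk₁, hk₂, -⟩ | ⟨hk₁, -, -⟩
  · refine ⟨L.η₂, h0, fun π hπ r hr => ?_⟩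
    have hr' : L.k₁ ≤ r := by omega
    simp only [upperSlack, upperBound, lowerBound, width, if_pos hk₁, if_pos hk₂, if_pos hr']
    rw [queueProb_eq_of_unit_arrivals hL hk₁ hk₂ hπ hr, hk₁]
    unfold φ τ μ₂ μ₀
    field_simp
    ring
  · refine ⟨1, one_pos, fun π hπ r hr => ?_⟩
    have hr' : L.k₁ ≤ r := by omega
    simp only [upperSlack, upperBound, lowerBound, width, if_pos hk₁, if_neg hk₂.ne', if_pos hr']
    rw [hk₁]
    ring
  · refine ⟨1, one_pos, fun π hπ r hr => ?_⟩
    simp only [upperSlack, upperBound, lowerBound, width, if_neg hk₁.ne']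
    by_cases h : r < L.k₁
    · rw [if_pos h, if_neg (by omega), Finset.range_eq_Ico, show r + 1 - L.k₁ = 0 by omega]
      ring
    · rw [if_neg h, if_pos (by omega)]
      ring

/-- The policy based strictly on the threshold `m`: the reliable source is used iff there are more
than `m` data packets after the arrivals. -/
def thresholdPolicy (m : ℕ) (i : ℕ) : ℝ := if m < i then 1 else 0

theorem thresholdPolicy_mem (m i : ℕ) : thresholdPolicy m i ∈ Set.Icc (0 : ℝ) 1 := by
  unfold thresholdPolicy; split_ifs <;> simp

/-- The threshold system describes the vectors of total mass one that are balanced under the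
threshold policy. -/
theorem solvesThresholdSystem_iff (hL : L.Regular) (hC : L.SmallArrivals) {m : ℕ} (hm : m ≤ L.Q₁)
    (π : L.State → ℝ) :
    L.SolvesThresholdSystem m π ↔ L.IsBalanced (thresholdPolicy m) π ∧ ∑ s, π s = 1 := by
  obtain ⟨κ, hκ, hu⟩ := exists_upperSlack_eq hL hC
  rw [isBalanced_iff hL]
  constructor
  · rintro ⟨h1, h2, h3, h4⟩
    refine ⟨⟨h3, fun r hr hr' => ?_⟩, h4⟩
    unfold thresholdPolicy
    by_cases h : m < r
    · have := h2 r h hr'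
      unfold lowerSlack at this
      rw [if_pos h]
      linarith
    · have := hu π h3 r hr
      rw [h1 r hr (by omega), mul_zero] at this
      rw [if_neg h]
      linarith
  · rintro ⟨⟨h3, hcut⟩, h4⟩
    refine ⟨fun r hr hr' => ?_, fun r hr hr' => ?_, h3, h4⟩
    · have h5 := hcut r hr (by omega)
      unfold thresholdPolicy at h5
      rw [if_neg (by omega)] at h5
      have := hu π h3 r hr
      have h6 : κ * L.upperSlack r π = 0 := by rw [this]; linarith
      exact (mul_eq_zero.1 h6).resolve_left hκ.ne'
    · have h5 := hcut r (by omega) hr'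
      unfold thresholdPolicy at h5
      rw [if_pos hr] at h5
      unfold lowerSlack
      linarith

theorem existsUnique_thresholdSystem (hL : L.Regular) (hC : L.SmallArrivals) {m : ℕ}
    (hm : m ≤ L.Q₁) : ∃! π, L.SolvesThresholdSystem m π := by
  obtain ⟨π, hπ, -, hs⟩ := exists_isBalanced hL (thresholdPolicy_mem m)
  refine ⟨π, (solvesThresholdSystem_iff hL hC hm π).2 ⟨hπ, hs⟩, fun π' hπ' => ?_⟩
  obtain ⟨hb, hs'⟩ := (solvesThresholdSystem_iff hL hC hm π').1 hπ'
  exact hb.unique hL (thresholdPolicy_mem m) hπ (by rw [hs, hs'])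

theorem thresholdSolution_spec (hL : L.Regular) (hC : L.SmallArrivals) {m : ℕ} (hm : m ≤ L.Q₁) :
    L.IsBalanced (thresholdPolicy m) (L.thresholdSolution m) ∧
      (∀ s, 0 ≤ L.thresholdSolution m s) ∧ ∑ s, L.thresholdSolution m s = 1 := by
  have h : L.SolvesThresholdSystem m (L.thresholdSolution m) :=
    Classical.epsilon_spec (existsUnique_thresholdSystem hL hC hm).exists
  obtain ⟨hb, hs⟩ := (solvesThresholdSystem_iff hL hC hm _).1 h
  obtain ⟨π, hπ, hπ0, hπs⟩ := exists_isBalanced hL (thresholdPolicy_mem m)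
  have : L.thresholdSolution m = π := hb.unique hL (thresholdPolicy_mem m) hπ (by rw [hs, hπs])
  exact ⟨hb, this ▸ hπ0, hs⟩

/-! ### The average power -/

/-- The amount by which, with batch data arrivals, the normalized power falls short of the use of
the reliable source at the state `(i, j)`; it is supported where an arrival overflows the data
queue. -/
def topCredit (L : Link) (i j : ℕ) : ℝ :=
  if L.k₁ ≠ 1 ∧ j = 0 ∧ L.Q₁ < i + L.k₁ then L.η₁ else 0

/-- The normalized power equals the credited use of the reliable source as soon as some test
function has these quantities as the two parts of its expected increment. -/
theorem avgPower_eq_of_test (π : L.State → ℝ) {c : ℕ → ℝ} (hπ : L.IsBalanced c π)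
    (hQ : 0 < L.Q₂) (h : ℕ → ℕ → ℝ)
    (hh : ∀ i ≤ L.Q₁, ∀ j ≤ L.Q₂, L.prob π i j * (L.step c (-1) h i j - h i j)
      = L.prob π i j * ((if j = 1 then L.ζ i else 0) - (if j = 0 then L.ξ i else 0)
        - L.topCredit i j)) :
    L.avgPower π
      = ∑ s : L.State, π s * (L.step c 1 (fun _ _ => 0) s.1 s.2 - L.topCredit s.1 s.2) := by
  have hf := flow_eq_zero_of_isBalanced hπ h
  have e : ∀ s : L.State, π s * (L.step c 0 h s.1 s.2 - h s.1 s.2)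
      = π s * (L.step c 1 (fun _ _ => 0) s.1 s.2 - L.topCredit s.1 s.2)
        + π s * ((if (s.2 : ℕ) = 1 then L.ζ s.1 else 0)
          - (if (s.2 : ℕ) = 0 then L.ξ s.1 else 0)) := by
    intro s
    have b1 := s.1.2
    have b2 := s.2.2
    have := hh s.1 (by omega) s.2 (by omega)
    rw [prob_state, step_lam] at this
    linear_combination this
  unfold flow at hf
  simp only [e, Finset.sum_add_distrib] at hf
  rw [sum_state π fun i j => (if j = 1 then L.ζ i else 0) - (if j = 0 then L.ξ i else 0)] at hf
  simp only [mul_sub, mul_ite, mul_zero, Finset.sum_sub_distrib, Finset.sum_ite_eq',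
    Finset.mem_range, Nat.succ_pos, if_true, show 1 < L.Q₂ + 1 by omega] at hf
  unfold avgPower
  simp only [mul_comm (L.ξ _), mul_comm (L.ζ _), mul_sub, Finset.sum_sub_distrib]
  linarith

/-- The normalized power of a vector that is balanced under a policy that always uses the reliable
source when the data queue overflows, through the use of the reliable source. The test function is
the free space `Q₁ - i` of the data queue, restricted to the empty battery unless data and stored
energy never coexist. -/
theorem avgPower_eq (hL : L.Regular) (hC : L.SmallArrivals) (hQ : 1 < L.k₁ → L.k₁ ≤ L.Q₁)
    {c : ℕ → ℝ} (hc : ∀ i, L.Q₁ < i → c i = 1) {π : L.State → ℝ} (hπ : L.IsBalanced c π) :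
    L.avgPower π
      = ∑ s : L.State, π s * (L.step c 1 (fun _ _ => 0) s.1 s.2 - L.topCredit s.1 s.2) := by
  have hQ₂ := hL.Q₂_pos
  rcases hC with ⟨hk₁, hk₂⟩ | ⟨hk₁, hk₂, hQ2⟩ | ⟨hk₁, hk₂, hQ2⟩
  · have hbat := ((isBalanced_iff hL c π).1 hπ).1
    refine avgPower_eq_of_test π hπ hQ₂ (fun i _ => (L.Q₁ : ℝ) - i) fun i hi j hj => ?_
    by_cases hij : 1 ≤ i ∧ 1 ≤ j
    · rw [prob_eq_zero_of_unit_arrivals hL hk₁ hk₂ hbat hij.1 hij.2, zero_mul, zero_mul]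
    congr 1
    have hy : 0 < min (j + 1) L.Q₂ := by omega
    simp only [topCredit, ξ, ζ, step, hk₁, hk₂, ne_eq, not_true, false_and, if_true, if_false]
    rw [serve_pos _ _ _ (by omega : 0 < i + 1) hy, Nat.add_sub_cancel, min_eq_left hi]
    rcases Nat.eq_zero_or_pos j with h | h
    · subst h
      have hmin : min (0 + 1) L.Q₂ = 1 := by omega
      rw [hmin, serve_empty _ _ _ (by omega : 0 < i + 1), Nat.add_sub_cancel, min_eq_left hi]
      have htop : (1 - c (i + 1)) * ((L.Q₁ : ℝ) - (min (i + 1) L.Q₁ : ℕ))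
          = (1 - c (i + 1)) * (L.Q₁ - i - 1) := by
        by_cases h : L.Q₁ < i + 1
        · rw [hc _ h]; ring
        · rw [min_eq_left (by omega)]; push_cast; ring
      rcases Nat.eq_zero_or_pos i with h0 | h0
      · subst h0
        rw [serve_zero, serve_zero, htop]
        simp only [if_true, Nat.cast_zero, zero_ne_one, if_false]
        linear_combination (L.Q₁ : ℝ) * L.μ_sum
      · rw [serve_pos _ _ _ h0 one_pos, serve_empty _ _ _ h0, htop, min_eq_left hi,
          min_eq_left (by omega), Nat.cast_sub h0]
        simp only [if_true, h0.ne', zero_ne_one, if_false]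
        push_cast
        linear_combination ((L.Q₁ : ℝ) - i) * L.μ_sum
    · have h0 : i = 0 := by omega
      subst h0
      rw [serve_pos _ _ _ (by omega : 0 < 0 + 1) h, serve_zero, serve_zero]
      simp [h.ne']
      linear_combination (L.Q₁ : ℝ) * L.μ_sum
  · refine avgPower_eq_of_test π hπ hQ₂ (fun i j => if j = 0 then (L.Q₁ : ℝ) - i else 0)
      fun i hi j hj => ?_
    congr 1
    have hs : ∀ x, L.serve c (-1) (fun i j => if j = 0 then (L.Q₁ : ℝ) - i else 0) x
        (min (j + L.k₂) L.Q₂) = 0 := by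
      intro x
      rcases Nat.eq_zero_or_pos x with h | h
      · subst h; rw [serve_zero, if_neg (by omega)]
      · rw [serve_pos _ _ _ h (by omega), if_neg (by omega)]
    have e1 : L.μ₁ + L.μ₂ = 1 - L.η₂ := by unfold μ₁ μ₂; ring
    simp only [topCredit, ξ, ζ, step, hk₁, hk₂.ne', ne_eq, not_true, false_and, if_true, if_false,
      hs]
    rcases Nat.eq_zero_or_pos j with h | h
    · subst h
      rw [serve_empty _ _ _ (by omega : 0 < i + 1), Nat.add_sub_cancel, min_eq_left hi]
      have htop : (1 - c (i + 1)) * ((L.Q₁ : ℝ) - (min (i + 1) L.Q₁ : ℕ))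
          = (1 - c (i + 1)) * (L.Q₁ - i - 1) := by
        by_cases h : L.Q₁ < i + 1
        · rw [hc _ h]; ring
        · rw [min_eq_left (by omega)]; push_cast; ring
      rcases Nat.eq_zero_or_pos i with h0 | h0
      · subst h0
        simp only [if_true, zero_ne_one, if_false, serve_zero, htop]
        push_cast
        linear_combination (L.Q₁ : ℝ) * e1
      · rw [serve_empty _ _ _ h0, min_eq_left hi, min_eq_left (by omega), Nat.cast_sub h0]
        simp only [if_true, zero_ne_one, if_false, htop]
        push_cast
        linear_combination ((L.Q₁ : ℝ) - i) * e1
    · rw [serve_pos _ _ _ (by omega : 0 < i + 1) h, Nat.add_sub_cancel, min_eq_left hi]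
      rcases Nat.eq_zero_or_pos i with h0 | h0
      · subst h0
        rw [serve_zero]
        by_cases h1 : j = 1
        · subst h1; simp
        · have h2 : ¬ j - 1 = 0 := by omega
          simp [h1, h2, h.ne']
      · rw [serve_pos _ _ _ h0 h, min_eq_left (by omega : i - 1 ≤ L.Q₁), Nat.cast_sub h0]
        by_cases h1 : j = 1
        · subst h1
          simp [h0.ne']
          linear_combination ((L.Q₁ : ℝ) - i) * e1
        · have h2 : ¬ j - 1 = 0 := by omega
          simp [h1, h2, h.ne']
  · refine avgPower_eq_of_test π hπ hQ₂ (fun i j => if j = 0 then (L.Q₁ : ℝ) - i else 0)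
      fun i hi j hj => ?_
    congr 1
    have e1 : L.μ₁ + L.μ₂ = 1 - L.η₂ := by unfold μ₁ μ₂; ring
    have hQ := hQ hk₁
    simp only [topCredit, ξ, ζ, step, hk₁.ne', hk₂, ne_eq, not_false_eq_true, true_and, if_false]
    have hx : 0 < i + L.k₁ := by omega
    rcases Nat.eq_zero_or_pos j with h | h
    · subst h
      have hmin : min (0 + 1) L.Q₂ = 1 := by omega
      rw [hmin, serve_empty _ _ _ hx, serve_pos _ _ _ hx one_pos]
      by_cases htop : L.Q₁ < i + L.k₁
      · rw [hc _ htop, min_eq_right (by omega : L.Q₁ ≤ i + L.k₁ - 1)]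
        rw [serve_pos _ _ _ (by omega : 0 < i) one_pos, serve_empty _ _ _ (by omega : 0 < i),
          min_eq_left hi, min_eq_left (by omega), Nat.cast_sub (by omega : 1 ≤ i)]
        have f1 : ¬ i = 0 := by omega
        have f2 : ¬ i + L.k₁ ≤ L.Q₁ := by omega
        simp only [htop, f1, f2, if_true, zero_ne_one, if_false, and_true]
        push_cast
        unfold μ₀ μ₁ μ₂ μ₃
        ring
      · rw [min_eq_left (by omega : i + L.k₁ - 1 ≤ L.Q₁), min_eq_left (by omega : i + L.k₁ ≤ L.Q₁),
          Nat.cast_sub (by omega : 1 ≤ i + L.k₁)]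
        have f2 : i + L.k₁ ≤ L.Q₁ := by omega
        rcases Nat.eq_zero_or_pos i with h0 | h0
        · subst h0
          rw [serve_zero, serve_zero]
          simp only [htop, if_true, zero_ne_one, one_ne_zero, if_false, and_false]
          push_cast
          unfold μ₀ μ₁ μ₂ μ₃
          ring
        · rw [serve_pos _ _ _ h0 one_pos, serve_empty _ _ _ h0, min_eq_left hi,
            min_eq_left (by omega), Nat.cast_sub h0]
          simp only [htop, f2, h0.ne', if_true, zero_ne_one, if_false, and_false]
          push_cast
          unfold μ₀ μ₁ μ₂ μ₃
          ring
    · have hs : ∀ x, L.serve c (-1) (fun i j => if j = 0 then (L.Q₁ : ℝ) - i else 0) x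
          (min (j + 1) L.Q₂) = 0 := by
        intro x
        rcases Nat.eq_zero_or_pos x with h' | h'
        · subst h'; rw [serve_zero, if_neg (by omega)]
        · rw [serve_pos _ _ _ h' (by omega), if_neg (by omega)]
      rw [hs, hs, serve_pos _ _ _ hx h]
      by_cases h1 : j = 1
      · subst h1
        by_cases htop : L.Q₁ < i + L.k₁
        · rw [serve_pos _ _ _ (by omega : 0 < i) one_pos,
            min_eq_right (by omega : L.Q₁ ≤ i + L.k₁ - 1), min_eq_left (by omega : i - 1 ≤ L.Q₁),
            Nat.cast_sub (by omega : 1 ≤ i)]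
          have f1 : ¬ i = 0 := by omega
          have f2 : ¬ i + L.k₁ ≤ L.Q₁ := by omega
          simp [f1, f2]
          left; ring
        · rw [min_eq_left (by omega : i + L.k₁ - 1 ≤ L.Q₁), Nat.cast_sub (by omega : 1 ≤ i + L.k₁)]
          have f2 : i + L.k₁ ≤ L.Q₁ := by omega
          rcases Nat.eq_zero_or_pos i with h0 | h0
          · subst h0
            rw [serve_zero]
            simp
            left; ring
          · rw [serve_pos _ _ _ h0 one_pos, min_eq_left (by omega), Nat.cast_sub h0]
            simp [f2, h0.ne']
            ring
      · have h2 : ¬ j - 1 = 0 := by omega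
        rcases Nat.eq_zero_or_pos i with h0 | h0
        · subst h0
          rw [serve_zero]
          simp [h1, h2, h.ne']
        · rw [serve_pos _ _ _ h0 h]
          simp [h1, h2, h.ne']

/-! ### Linearity and continuity of the constraints -/

/-- The average length of the data queue. -/
def queueLength (L : Link) (π : L.State → ℝ) : ℝ := ∑ s : L.State, π s * ((s.1 : ℕ) : ℝ)

theorem avgDelay_eq (π : L.State → ℝ) :
    L.avgDelay π = 1 / (L.k₁ * L.η₁) * L.queueLength π := by
  unfold avgDelay queueLength
  rw [sum_state π fun i _ => (i : ℝ)]
  simp only [← Finset.sum_mul]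
  congr 1
  rw [Finset.range_eq_Ico, Finset.sum_eq_sum_Ico_succ_bot (Nat.succ_pos _)]
  simp only [Nat.cast_zero, mul_zero, zero_add]
  refine Finset.sum_congr ?_ fun i _ => mul_comm _ _
  ext i; simp

theorem avgDelay_le_iff (hL : L.Regular) (π π' : L.State → ℝ) :
    L.avgDelay π ≤ L.avgDelay π' ↔ L.queueLength π ≤ L.queueLength π' := by
  have h1 : (0 : ℝ) < L.k₁ := by exact_mod_cast hL.k₁_pos
  have h2 := hL.η₁_pos
  rw [avgDelay_eq, avgDelay_eq]
  exact mul_le_mul_iff_right₀ (by positivity)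

theorem prob_comb (t u : ℝ) (π π' : L.State → ℝ) (i j : ℕ) :
    L.prob (fun s => t * π s + u * π' s) i j = t * L.prob π i j + u * L.prob π' i j := by
  unfold prob; split_ifs <;> ring

theorem queueProb_comb (t u : ℝ) (π π' : L.State → ℝ) (i : ℕ) :
    L.queueProb (fun s => t * π s + u * π' s) i = t * L.queueProb π i + u * L.queueProb π' i := by
  simp only [queueProb, prob_comb, Finset.sum_add_distrib, Finset.mul_sum]

theorem sum_queueProb_comb (S : Finset ℕ) (t u : ℝ) (π π' : L.State → ℝ) :
    ∑ m ∈ S, L.τ * L.queueProb (fun s => t * π s + u * π' s) m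
      = t * ∑ m ∈ S, L.τ * L.queueProb π m + u * ∑ m ∈ S, L.τ * L.queueProb π' m := by
  simp only [queueProb_comb, Finset.mul_sum, ← Finset.sum_add_distrib]
  exact Finset.sum_congr rfl fun _ _ => by ring

theorem lowerBound_comb (t u : ℝ) (π π' : L.State → ℝ) (i : ℕ) :
    L.lowerBound i (fun s => t * π s + u * π' s)
      = t * L.lowerBound i π + u * L.lowerBound i π' := by
  simp only [lowerBound_eq_sum, sum_queueProb_comb]

theorem upperBound_comb (t u : ℝ) (π π' : L.State → ℝ) (i : ℕ) :
    L.upperBound i (fun s => t * π s + u * π' s)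
      = t * L.upperBound i π + u * L.upperBound i π' := by
  unfold upperBound
  split_ifs <;> simp only [prob_comb, sum_queueProb_comb] <;> ring

theorem queueLength_comb (t u : ℝ) (π π' : L.State → ℝ) :
    L.queueLength (fun s => t * π s + u * π' s) = t * L.queueLength π + u * L.queueLength π' := by
  simp only [queueLength, Finset.mul_sum, ← Finset.sum_add_distrib]
  exact Finset.sum_congr rfl fun _ _ => by ring

theorem avgPower_comb (t u : ℝ) (π π' : L.State → ℝ) :
    L.avgPower (fun s => t * π s + u * π' s) = t * L.avgPower π + u * L.avgPower π' := by
  unfold avgPower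
  simp only [prob_comb, Finset.mul_sum, mul_sub, mul_add, Finset.sum_add_distrib,
    mul_left_comm _ t, mul_left_comm _ u]
  ring

theorem IsFeasible.comb {p q : ℝ} {π π' : L.State → ℝ} (h : L.IsFeasible p π)
    (h' : L.IsFeasible q π') {t u : ℝ} (ht : 0 ≤ t) (hu : 0 ≤ u) (htu : t + u = 1) :
    L.IsFeasible (t * L.avgPower π + u * L.avgPower π') (fun s => t * π s + u * π' s) where
  power := (avgPower_comb t u π π').le
  bounds i hi hi' := by
    rw [lowerBound_comb, upperBound_comb, queueProb_comb]
    obtain ⟨a, b⟩ := h.bounds i hi hi'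
    obtain ⟨a', b'⟩ := h'.bounds i hi hi'
    constructor <;> gcongr
  nonneg s := add_nonneg (mul_nonneg ht (h.nonneg s)) (mul_nonneg hu (h'.nonneg s))
  sum_one := by
    rw [Finset.sum_add_distrib, ← Finset.mul_sum, ← Finset.mul_sum, h.sum_one, h'.sum_one]
    linarith
  balance s hs := by
    simp only [add_mul, mul_assoc, Finset.sum_add_distrib, ← Finset.mul_sum, h.balance s hs,
      h'.balance s hs]

theorem prob_nonneg {π : L.State → ℝ} (h : ∀ s, 0 ≤ π s) (i j : ℕ) : 0 ≤ L.prob π i j := by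
  unfold prob; split_ifs
  · exact h _
  · exact le_rfl

theorem τ_pos (hL : L.Regular) : 0 < L.τ := div_pos hL.η₁_pos (sub_pos.2 hL.η₁_lt)

theorem width_nonneg (hL : L.Regular) {π : L.State → ℝ} (h : ∀ s, 0 ≤ π s) (r : ℕ) :
    0 ≤ L.width r π := by
  have h1 := τ_pos hL
  have h2 : 0 < 1 - L.η₂ := sub_pos.2 hL.η₂_lt
  have h3 := prob_nonneg h r 0
  have h4 := prob_nonneg h (r - L.k₁) 0
  unfold width
  split_ifs <;> positivity

/-- Stationary vectors of policies satisfy the constraints of the linear program, by the cut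
equations. -/
theorem isFeasible_of_isBalanced (hL : L.Regular) (hC : L.SmallArrivals) {c : ℕ → ℝ}
    (hc : ∀ i, c i ∈ Set.Icc (0 : ℝ) 1) {π : L.State → ℝ} (hπ : L.IsBalanced c π)
    (h0 : ∀ s, 0 ≤ π s) (h1 : ∑ s, π s = 1) : L.IsFeasible (L.avgPower π) π := by
  obtain ⟨κ, hκ, hu⟩ := exists_upperSlack_eq hL hC
  obtain ⟨hb, hcut⟩ := (isBalanced_iff hL c π).1 hπ
  refine ⟨le_rfl, fun r hr hr' => ?_, h0, h1, hb⟩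
  have hw := width_nonneg hL h0 r
  have e := hcut r hr hr'
  have e1 := mul_nonneg (hc r).1 hw
  have e2 := mul_nonneg (sub_nonneg.2 (hc r).2) hw
  refine ⟨by linarith, ?_⟩
  have e3 := hu π hb r hr
  have e4 : L.upperSlack r π ≤ 0 := by
    by_contra hcon
    push Not at hcon
    have := mul_pos hκ hcon
    linarith
  unfold upperSlack at e4
  linarith

theorem thresholdSolution_isFeasible (hL : L.Regular) (hC : L.SmallArrivals) {m : ℕ}
    (hm : m ≤ L.Q₁) : L.IsFeasible (L.powerThreshold m) (L.thresholdSolution m) := by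
  obtain ⟨h1, h2, h3⟩ := thresholdSolution_spec hL hC hm
  exact isFeasible_of_isBalanced hL hC (thresholdPolicy_mem m) h1 h2 h3

theorem continuous_prob (i j : ℕ) : Continuous fun π : L.State → ℝ => L.prob π i j := by
  unfold prob
  split_ifs
  · exact continuous_apply _
  · exact continuous_const

theorem continuous_queueProb (i : ℕ) : Continuous fun π : L.State → ℝ => L.queueProb π i :=
  continuous_finsetSum _ fun _ _ => continuous_prob _ _

theorem continuous_upperBound (i : ℕ) : Continuous fun π : L.State → ℝ => L.upperBound i π := by
  have h1 := fun i j => continuous_prob (L := L) i j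
  have h2 := fun i => continuous_queueProb (L := L) i
  unfold upperBound
  split_ifs <;> fun_prop

theorem continuous_lowerBound (i : ℕ) : Continuous fun π : L.State → ℝ => L.lowerBound i π := by
  have h2 := fun i => continuous_queueProb (L := L) i
  unfold lowerBound
  split_ifs <;> fun_prop

theorem continuous_avgPower : Continuous fun π : L.State → ℝ => L.avgPower π := by
  have h1 := fun i j => continuous_prob (L := L) i j
  unfold avgPower
  fun_prop

/-- A feasible linear program has an optimal solution, by compactness. -/
theorem exists_isOptimal {p : ℝ} {π₀ : L.State → ℝ} (h₀ : L.IsFeasible p π₀) :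
    ∃ π, L.IsOptimal p π := by
  have hset : {π | L.IsFeasible p π} =
      {π : L.State → ℝ | L.avgPower π ≤ p} ∩
      ((⋂ i, ⋂ (_ : 1 ≤ i), ⋂ (_ : i ≤ L.Q₁),
          ({π : L.State → ℝ | L.lowerBound i π ≤ L.queueProb π i} ∩
            {π : L.State → ℝ | L.queueProb π i ≤ L.upperBound i π})) ∩
      ((⋂ s, {π : L.State → ℝ | 0 ≤ π s}) ∩ ({π : L.State → ℝ | ∑ s, π s = 1} ∩
      ⋂ t : L.State, ⋂ (_ : 0 < (t.2 : ℕ)),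
        {π : L.State → ℝ | ∑ s, π s * L.transition 0 0 s t = π t}))) := by
    ext π
    simp only [Set.mem_ofPred_eq, Set.mem_inter_iff, Set.mem_iInter]
    exact ⟨fun h => ⟨h.power, h.bounds, h.nonneg, h.sum_one, h.balance⟩,
      fun h => ⟨h.1, h.2.1, h.2.2.1, h.2.2.2.1, h.2.2.2.2⟩⟩
  have hclosed : IsClosed {π | L.IsFeasible p π} := by
    rw [hset]
    refine (isClosed_le continuous_avgPower continuous_const).inter (IsClosed.inter
      (isClosed_iInter fun i => isClosed_iInter fun _ => isClosed_iInter fun _ =>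
        (isClosed_le (continuous_lowerBound i) (continuous_queueProb i)).inter
          (isClosed_le (continuous_queueProb i) (continuous_upperBound i)))
      ((isClosed_iInter fun s => isClosed_le continuous_const (continuous_apply s)).inter
        ((isClosed_eq (by fun_prop) continuous_const).inter
          (isClosed_iInter fun t => isClosed_iInter fun _ =>
            isClosed_eq (by fun_prop) (continuous_apply t)))))
  have hcompact : IsCompact {π | L.IsFeasible p π} := by
    refine IsCompact.of_isClosed_subset (isCompact_univ_pi fun _ : L.State =>
      isCompact_Icc (a := (0 : ℝ)) (b := 1)) hclosed fun π hπ s _ => ⟨hπ.nonneg s, ?_⟩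
    rw [← hπ.sum_one]
    exact Finset.single_le_sum (fun s _ => hπ.nonneg s) (Finset.mem_univ s)
  have hcont : Continuous fun π : L.State → ℝ => L.avgDelay π := by
    have h2 := fun i => continuous_queueProb (L := L) i
    unfold avgDelay
    fun_prop
  obtain ⟨π, hπ, hmin⟩ := hcompact.exists_isMinOn ⟨π₀, h₀⟩ hcont.continuousOn
  exact ⟨π, hπ, fun π' hπ' => hmin hπ'⟩

/-! ### Feasible vectors are stationary under some policy -/

/-- A feasible vector is stationary under a policy, which is determined at the queue lengths of
positive width and may be prescribed (by `d`) elsewhere. -/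
theorem IsFeasible.exists_policy (hL : L.Regular) (hC : L.SmallArrivals) {p : ℝ}
    {π : L.State → ℝ} (hπ : L.IsFeasible p π) {d : ℕ → ℝ} (hd : ∀ i, d i ∈ Set.Icc (0 : ℝ) 1) :
    ∃ c : ℕ → ℝ, (∀ i, c i ∈ Set.Icc (0 : ℝ) 1) ∧ (∀ i, L.Q₁ < i → c i = 1) ∧ L.IsBalanced c π ∧
      ∀ r, 1 ≤ r → r ≤ L.Q₁ → (L.width r π = 0 → c r = d r) ∧
        (L.width r π ≠ 0 → (L.upperSlack r π = 0 → c r = 0) ∧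
          (L.lowerSlack r π = 0 → c r = 1)) := by
  classical
  obtain ⟨κ, hκ, hu⟩ := exists_upperSlack_eq hL hC
  have hupper : ∀ r, 1 ≤ r → r ≤ L.Q₁ →
      L.queueProb π r ≤ L.lowerBound r π + L.width r π := by
    intro r hr hr'
    have h1 := (hπ.bounds r hr hr').2
    have h2 := hu π hπ.balance r hr
    have h3 : κ * L.upperSlack r π ≤ 0 :=
      mul_nonpos_of_nonneg_of_nonpos hκ.le (by unfold upperSlack; linarith)
    linarith
  let c : ℕ → ℝ := fun r => if L.Q₁ < r then 1 else if L.width r π = 0 ∨ r = 0 then d r else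
    (L.lowerBound r π + L.width r π - L.queueProb π r) / L.width r π
  refine ⟨c, fun r => ?_, fun r hr => if_pos hr, (isBalanced_iff hL c π).2
    ⟨hπ.balance, fun r hr hr' => ?_⟩, fun r hr hr' => ⟨fun hw => ?_, fun hw => ⟨fun hs => ?_,
      fun hs => ?_⟩⟩⟩
  · simp only [c]
    split_ifs with h1 h2
    · simp
    · exact hd r
    · push Not at h1 h2
      have hr : 1 ≤ r := by omega
      have hw : 0 < L.width r π := lt_of_le_of_ne (width_nonneg hL hπ.nonneg r) (Ne.symm h2.1)
      have := hupper r hr h1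
      have := (hπ.bounds r hr h1).1
      refine ⟨div_nonneg (by linarith) hw.le, ?_⟩
      rw [div_le_one hw]
      linarith
  · simp only [c]
    rw [if_neg (by omega)]
    split_ifs with h
    · have hw := h.resolve_right (by omega)
      have := hupper r hr hr'
      have := (hπ.bounds r hr hr').1
      rw [hw] at *
      linarith
    · push Not at h
      have := h.1
      field_simp
      ring
  · simp only [c]
    rw [if_neg (by omega), if_pos (Or.inl hw)]
  · simp only [c]
    rw [if_neg (by omega), if_neg (by push Not; exact ⟨hw, by omega⟩)]
    have := hu π hπ.balance r hr
    rw [hs, mul_zero] at this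
    rw [div_eq_zero_iff]
    left; linarith
  · simp only [c]
    rw [if_neg (by omega), if_neg (by push Not; exact ⟨hw, by omega⟩), div_eq_one_iff_eq hw]
    unfold lowerSlack at hs
    linarith

/-- A feasible vector with the slacks of the threshold `m` is realised by a threshold policy. -/
theorem IsFeasible.exists_thresholdPolicy (hL : L.Regular) (hC : L.SmallArrivals) {p : ℝ}
    {π : L.State → ℝ} (hπ : L.IsFeasible p π) {m : ℕ} (hm : m ≤ L.Q₁)
    (hup : ∀ i, 1 ≤ i → i < m → L.upperSlack i π = 0)
    (hlow : ∀ i, m < i → i ≤ L.Q₁ → L.lowerSlack i π = 0) :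
    ∃ g f : ℕ → ℝ, L.IsThresholdPolicy m g f ∧ L.IsStationary g f π := by
  obtain ⟨c, hc, hc1, hb, hw⟩ := hπ.exists_policy hL hC (thresholdPolicy_mem m)
  have hk := hL.k₁_pos
  have below : ∀ r, 1 ≤ r → r < m → c r = 0 := by
    intro r hr hrm
    by_cases h : L.width r π = 0
    · rw [(hw r hr (by omega)).1 h, thresholdPolicy, if_neg (by omega)]
    · exact ((hw r hr (by omega)).2 h).1 (hup r hr hrm)
  have above : ∀ r, m < r → c r = 1 := by
    intro r hrm
    by_cases hr : L.Q₁ < r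
    · exact hc1 r hr
    by_cases h : L.width r π = 0
    · rw [(hw r (by omega) (by omega)).1 h, thresholdPolicy, if_pos (by omega)]
    · exact ((hw r (by omega) (by omega)).2 h).2 (hlow r hrm (by omega))
  exact ⟨fun i => c (i + L.k₁), c, ⟨fun i => hc _, hc, fun i _ h => below _ (by omega) h,
    fun i _ h => above _ h, fun i h _ h' => below i h h', fun i _ _ h => above i h⟩,
    ⟨hπ.nonneg, hπ.sum_one, hb⟩⟩

/-! ### Relative values and the optimality certificate -/

/-- `h` is a relative value function, and `G` the average cost, of the threshold policy `m` when
each slot costs `a` per data packet in the queue and each unit of normalized power costs `lam`. -/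
def IsRelValue (L : Link) (m : ℕ) (a lam : ℝ) (h : ℕ → ℕ → ℝ) (G : ℝ) : Prop :=
  ∀ i ≤ L.Q₁, ∀ j ≤ L.Q₂,
    h i j + G = a * i - lam * L.topCredit i j + L.step (thresholdPolicy m) lam h i j

theorem exists_isRelValue (hL : L.Regular) (m : ℕ) (a lam : ℝ) :
    ∃ h G, L.IsRelValue m a lam h G := by
  obtain ⟨h, G, hh⟩ := exists_poisson hL (thresholdPolicy_mem m) (fun i j =>
    a * i - lam * L.topCredit i j + lam * L.step (thresholdPolicy m) 1 (fun _ _ => 0) i j)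
  refine ⟨h, G, fun i hi j hj => ?_⟩
  rw [hh i hi j hj, step_lam (l := lam)]
  ring

/-- The cost, per visit to the queue length `i` with empty battery, of using the policy `c` in a
single slot instead of the threshold policy `m`. -/
def deviation (L : Link) (m : ℕ) (lam : ℝ) (h : ℕ → ℕ → ℝ) (c : ℕ → ℝ) (i : ℕ) : ℝ :=
  (if 1 ≤ i then L.μ₁ * ((c i - thresholdPolicy m i) * (lam - (h i 0 - h (i - 1) 0))) else 0)
    + if i + L.k₁ ≤ L.Q₁ then L.μ₂ * ((c (i + L.k₁) - thresholdPolicy m (i + L.k₁))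
        * (lam - (h (i + L.k₁) 0 - h (i + L.k₁ - 1) 0))) else 0

theorem step_sub_step (hL : L.Regular) {m : ℕ} (hm : m ≤ L.Q₁) (lam : ℝ) (h : ℕ → ℕ → ℝ)
    {c : ℕ → ℝ} (hc : ∀ i, L.Q₁ < i → c i = 1) {i : ℕ} (hi : i ≤ L.Q₁) (j : ℕ) :
    L.step c lam h i j - L.step (thresholdPolicy m) lam h i j
      = 0 + if j = 0 then L.deviation m lam h c i else 0 := by
  have hk := hL.k₁_pos
  have hk₂ := hL.k₂_pos
  have hQ₂ := hL.Q₂_pos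
  have hs : ∀ x y, L.serve c lam h x y = L.serve (thresholdPolicy m) lam h x y
      + if 0 < x ∧ y = 0 then (c x - thresholdPolicy m x)
        * (lam - (h (min x L.Q₁) 0 - h (min (x - 1) L.Q₁) 0)) else 0 := by
    intro x y
    unfold serve
    split_ifs <;> first | omega | ring
  unfold step
  rw [hs, hs i j, hs _ j, hs _ (min (j + L.k₂) L.Q₂), if_neg (by omega),
    if_neg (by omega : ¬ (0 < i + L.k₁ ∧ min (j + L.k₂) L.Q₂ = 0))]
  by_cases hj : j = 0
  · simp only [hj, deviation, if_true, and_true]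
    rw [if_pos (by omega : 0 < i + L.k₁)]
    have e2 : (if 0 < i then (c i - thresholdPolicy m i)
        * (lam - (h (min i L.Q₁) 0 - h (min (i - 1) L.Q₁) 0)) else 0)
        = if 1 ≤ i then (c i - thresholdPolicy m i) * (lam - (h i 0 - h (i - 1) 0)) else 0 := by
      rw [min_eq_left hi, min_eq_left (by omega)]
      rfl
    rw [e2]
    by_cases htop : i + L.k₁ ≤ L.Q₁
    · rw [if_pos htop, min_eq_left htop, min_eq_left (by omega : i + L.k₁ - 1 ≤ L.Q₁)]
      split_ifs <;> ring
    · have e3 : thresholdPolicy m (i + L.k₁) = 1 := if_pos (by omega)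
      rw [if_neg htop, hc (i + L.k₁) (by omega), e3]
      split_ifs <;> ring
  · simp only [hj, if_false, and_false]
    ring

/-- The performance difference formula: the cost of a policy exceeds that of the threshold policy
by the deviations of its single slots, valued by the relative values of the threshold policy. -/
theorem cost_sub_eq (hL : L.Regular) (hC : L.SmallArrivals) (hQ : 1 < L.k₁ → L.k₁ ≤ L.Q₁)
    {m : ℕ} (hm : m ≤ L.Q₁) {a lam : ℝ} {h : ℕ → ℕ → ℝ} {G : ℝ} (hh : L.IsRelValue m a lam h G)
    {c : ℕ → ℝ} (hc : ∀ i, L.Q₁ < i → c i = 1) {π : L.State → ℝ} (hπ : L.IsBalanced c π)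
    (h1 : ∑ s, π s = 1) :
    a * L.queueLength π + lam * L.avgPower π - G
      = ∑ i ∈ Finset.range (L.Q₁ + 1), L.deviation m lam h c i * L.prob π i 0 := by
  have e := sum_state_mul π (fun _ => 0) (L.deviation m lam h c)
  have hf := flow_eq_zero_of_isBalanced hπ h
  have hp : ∀ s : L.State, π s * (0 + if (s.2 : ℕ) = 0 then L.deviation m lam h c s.1 else 0)
      = a * (π s * ((s.1 : ℕ) : ℝ))
        + lam * (π s * (L.step c 1 (fun _ _ => 0) s.1 s.2 - L.topCredit s.1 s.2)) - G * π s
        + π s * (L.step c 0 h s.1 s.2 - h s.1 s.2) := by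
    intro s
    have b1 := s.1.2
    have b2 := s.2.2
    have h3 := hh s.1 (by omega) s.2 (by omega)
    rw [← step_sub_step hL hm lam h hc (i := s.1) (by omega) s.2, step_lam c lam]
    linear_combination (π s) * h3
  rw [Finset.sum_congr rfl fun s _ => hp s] at e
  simp only [Finset.sum_add_distrib, Finset.sum_sub_distrib, ← Finset.mul_sum, h1,
    zero_mul, zero_add] at e
  unfold flow at hf
  rw [avgPower_eq hL hC hQ hc hπ, queueLength, ← e, hf]
  ring

/-- Feasible vectors whose cost does not exceed that of the threshold policy `m` have the slacks of
the threshold `m`, provided that an additional packet in the queue costs less than a use of the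
reliable source below the threshold, and more above it. -/
theorem slack_of_cost_le (hL : L.Regular) (hC : L.SmallArrivals) (hQ : 1 < L.k₁ → L.k₁ ≤ L.Q₁)
    {m : ℕ} (hm : m ≤ L.Q₁) {a lam : ℝ} {h : ℕ → ℕ → ℝ} {G : ℝ} (hh : L.IsRelValue m a lam h G)
    (below : ∀ i, 1 ≤ i → i < m → h i 0 - h (i - 1) 0 < lam)
    (tie : 1 ≤ m → h m 0 - h (m - 1) 0 = lam)
    (above : ∀ i, m < i → i ≤ L.Q₁ → lam < h i 0 - h (i - 1) 0)
    {p : ℝ} {π : L.State → ℝ} (hπ : L.IsFeasible p π)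
    (hle : a * L.queueLength π + lam * L.avgPower π ≤ G) :
    (∀ i, 1 ≤ i → i < m → L.upperSlack i π = 0) ∧
      ∀ i, m < i → i ≤ L.Q₁ → L.lowerSlack i π = 0 := by
  obtain ⟨c, hc, hc1, hb, -⟩ := hπ.exists_policy hL hC (thresholdPolicy_mem m)
  have hcost := cost_sub_eq hL hC hQ hm hh hc1 hb hπ.sum_one
  have hk := hL.k₁_pos
  have m1 := hL.μ₁_pos
  have m2 := hL.μ₂_pos
  have hp := fun i => prob_nonneg hπ.nonneg i 0
  set gap : ℕ → ℝ := fun r => (c r - thresholdPolicy m r) * (lam - (h r 0 - h (r - 1) 0)) with hgap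
  have hgap0 : ∀ r, 1 ≤ r → r ≤ L.Q₁ → 0 ≤ gap r := by
    intro r hr hr'
    simp only [hgap, thresholdPolicy]
    rcases lt_trichotomy m r with h' | h' | h'
    · rw [if_pos h']
      exact mul_nonneg_of_nonpos_of_nonpos (by linarith [(hc r).2]) (by linarith [above r h' hr'])
    · subst h'
      rw [tie hr, sub_self, mul_zero]
    · rw [if_neg (by omega), sub_zero]
      exact mul_nonneg (hc r).1 (by linarith [below r hr h'])
  have hdev : ∀ i, L.deviation m lam h c i = (if 1 ≤ i then L.μ₁ * gap i else 0)
      + if i + L.k₁ ≤ L.Q₁ then L.μ₂ * gap (i + L.k₁) else 0 := fun i => rfl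
  have hA : ∀ i, i ≤ L.Q₁ → 0 ≤ if 1 ≤ i then L.μ₁ * gap i else 0 := by
    intro i hi
    split_ifs with h'
    · exact mul_nonneg m1.le (hgap0 i h' hi)
    · exact le_rfl
  have hB : ∀ i, 0 ≤ if i + L.k₁ ≤ L.Q₁ then L.μ₂ * gap (i + L.k₁) else 0 := by
    intro i
    split_ifs with h'
    · exact mul_nonneg m2.le (hgap0 _ (by omega) h')
    · exact le_rfl
  have hz : ∀ i, i ≤ L.Q₁ → L.deviation m lam h c i * L.prob π i 0 = 0 := by
    have hnn : ∀ i ∈ Finset.range (L.Q₁ + 1), 0 ≤ L.deviation m lam h c i * L.prob π i 0 := by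
      intro i hi
      rw [hdev]
      exact mul_nonneg (add_nonneg (hA i (by simp at hi; omega)) (hB i)) (hp i)
    have := (Finset.sum_eq_zero_iff_of_nonneg hnn).1
      (le_antisymm (by linarith) (Finset.sum_nonneg hnn))
    exact fun i hi => this i (Finset.mem_range.2 (by omega))
  have hz1 : ∀ r, 1 ≤ r → r ≤ L.Q₁ → gap r * L.prob π r 0 = 0 := by
    intro r hr hr'
    have h1 := hz r hr'
    rw [hdev, add_mul] at h1
    have h2 := (add_eq_zero_iff_of_nonneg (mul_nonneg (hA r hr') (hp r))
      (mul_nonneg (hB r) (hp r))).1 h1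
    have h3 := h2.1
    rw [if_pos hr, mul_assoc] at h3
    exact (mul_eq_zero.1 h3).resolve_left m1.ne'
  have hz2 : ∀ r, L.k₁ ≤ r → r ≤ L.Q₁ → gap r * L.prob π (r - L.k₁) 0 = 0 := by
    intro r hr hr'
    have h1 := hz (r - L.k₁) (by omega)
    rw [hdev, add_mul] at h1
    have h2 := (add_eq_zero_iff_of_nonneg (mul_nonneg (hA _ (by omega)) (hp _))
      (mul_nonneg (hB _) (hp _))).1 h1
    have h3 := h2.2
    rw [Nat.sub_add_cancel hr, if_pos hr', mul_assoc] at h3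
    exact (mul_eq_zero.1 h3).resolve_left m2.ne'
  have hw : ∀ r, 1 ≤ r → r ≤ L.Q₁ → r ≠ m → (c r - thresholdPolicy m r) * L.width r π = 0 := by
    intro r hr hr' hrm
    have hne : lam - (h r 0 - h (r - 1) 0) ≠ 0 := by
      rcases lt_or_gt_of_ne hrm with h' | h'
      · exact (sub_pos.2 (below r hr h')).ne'
      · exact (sub_neg.2 (above r h' hr')).ne
    have e : (lam - (h r 0 - h (r - 1) 0)) * ((c r - thresholdPolicy m r) * L.width r π)
        = (1 - L.η₂) * (L.τ * (if L.k₁ ≤ r then gap r * L.prob π (r - L.k₁) 0 else 0)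
          + gap r * L.prob π r 0) := by
      simp only [hgap, width]
      split_ifs <;> ring
    rw [hz1 r hr hr'] at e
    have e2 : (if L.k₁ ≤ r then gap r * L.prob π (r - L.k₁) 0 else 0) = 0 := by
      split_ifs with h'
      · exact hz2 r h' hr'
      · rfl
    rw [e2, mul_zero, add_zero, mul_zero] at e
    exact (mul_eq_zero.1 e).resolve_left hne
  obtain ⟨-, hcut⟩ := (isBalanced_iff hL c π).1 hb
  obtain ⟨κ, hκ, hu⟩ := exists_upperSlack_eq hL hC
  refine ⟨fun r hr hrm => ?_, fun r hrm hr => ?_⟩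
  · have h1 := hw r hr (by omega) hrm.ne
    rw [thresholdPolicy, if_neg (by omega), sub_zero] at h1
    have h2 := hu π hπ.balance r hr
    have h3 := hcut r hr (by omega)
    have h4 : κ * L.upperSlack r π = 0 := by rw [h2]; linarith
    exact (mul_eq_zero.1 h4).resolve_left hκ.ne'
  · have h1 := hw r (by omega) hr hrm.ne'
    rw [thresholdPolicy, if_pos hrm] at h1
    have h3 := hcut r (by omega) hr
    unfold lowerSlack
    linarith

theorem cost_thresholdSolution (hL : L.Regular) (hC : L.SmallArrivals)
    (hQ : 1 < L.k₁ → L.k₁ ≤ L.Q₁) {m : ℕ} (hm : m ≤ L.Q₁) {a lam : ℝ} {h : ℕ → ℕ → ℝ} {G : ℝ}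
    (hh : L.IsRelValue m a lam h G) :
    a * L.queueLength (L.thresholdSolution m) + lam * L.powerThreshold m = G := by
  obtain ⟨hb, -, h1⟩ := thresholdSolution_spec hL hC hm
  have := cost_sub_eq hL hC hQ hm hh
    (fun i hi => by rw [thresholdPolicy, if_pos (by omega)]) hb h1
  have e : ∀ i, L.deviation m lam h (thresholdPolicy m) i = 0 := by
    intro i; unfold deviation; simp
  simp only [e, zero_mul, Finset.sum_const_zero] at this
  unfold powerThreshold
  linarith

/-- The price of power at which the threshold policies `m - 1` and `m` cost the same, and its
relative value function. At this price, sending and holding cost the same at the queue length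
`m`. -/
theorem exists_price (hL : L.Regular) (hC : L.SmallArrivals) (hQ : 1 < L.k₁ → L.k₁ ≤ L.Q₁)
    {m : ℕ} (hm1 : 1 ≤ m) (hm : m ≤ L.Q₁) (hlt : L.powerThreshold m < L.powerThreshold (m - 1)) :
    ∃ lam h G, L.IsRelValue m 1 lam h G ∧ h m 0 - h (m - 1) 0 = lam ∧
      L.queueLength (L.thresholdSolution m) + lam * L.powerThreshold m = G ∧
      L.queueLength (L.thresholdSolution (m - 1)) + lam * L.powerThreshold (m - 1) = G := by
  set lam := (L.queueLength (L.thresholdSolution m) - L.queueLength (L.thresholdSolution (m - 1)))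
    / (L.powerThreshold (m - 1) - L.powerThreshold m) with hlam
  obtain ⟨h, G, hh⟩ := exists_isRelValue hL m 1 lam
  have e1 := cost_thresholdSolution hL hC hQ hm hh
  rw [one_mul] at e1
  have e2 : L.queueLength (L.thresholdSolution (m - 1)) + lam * L.powerThreshold (m - 1) = G := by
    have : L.powerThreshold (m - 1) - L.powerThreshold m ≠ 0 := (sub_pos.2 hlt).ne'
    have : lam * (L.powerThreshold (m - 1) - L.powerThreshold m)
        = L.queueLength (L.thresholdSolution m) - L.queueLength (L.thresholdSolution (m - 1)) := by
      rw [hlam]; field_simp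
    linarith
  refine ⟨lam, h, G, hh, ?_, e1, e2⟩
  obtain ⟨hb, h0, h1⟩ := thresholdSolution_spec hL hC (show m - 1 ≤ L.Q₁ by omega)
  have hcost := cost_sub_eq hL hC hQ hm hh
    (fun i hi => by rw [thresholdPolicy, if_pos (by omega)]) hb h1
  unfold powerThreshold at e2
  rw [one_mul, e2, sub_self] at hcost
  have hk := hL.k₁_pos
  have hthr : ∀ r, r ≠ m → thresholdPolicy (m - 1) r - thresholdPolicy m r = 0 := by
    intro r hr
    unfold thresholdPolicy
    by_cases h' : m < r
    · rw [if_pos (by omega), if_pos h', sub_self]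
    · rw [if_neg (by omega), if_neg h', sub_self]
  have hthr' : thresholdPolicy (m - 1) m - thresholdPolicy m m = 1 := by
    unfold thresholdPolicy
    rw [if_pos (by omega), if_neg (lt_irrefl m), sub_zero]
  set π := L.thresholdSolution (m - 1) with hπ
  have hsum : (1 - L.η₁) * (lam - (h m 0 - h (m - 1) 0)) * L.width m π = 0 := by
    rw [hcost]
    have hd : ∀ i, L.deviation m lam h (thresholdPolicy (m - 1)) i * L.prob π i 0
        = (if i = m then L.μ₁ * (lam - (h m 0 - h (m - 1) 0)) * L.prob π i 0 else 0)
          + if i + L.k₁ = m then L.μ₂ * (lam - (h m 0 - h (m - 1) 0)) * L.prob π i 0 else 0 := by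
      intro i
      unfold deviation
      rw [add_mul]
      congr 1
      · by_cases h' : i = m
        · subst h'
          rw [if_pos hm1, if_pos rfl, hthr', one_mul]
        · rw [hthr i h', if_neg h', zero_mul, mul_zero, ite_self, zero_mul]
      · by_cases h' : i + L.k₁ = m
        · rw [h', if_pos hm, if_pos rfl, hthr', one_mul]
        · rw [hthr _ h', if_neg h', zero_mul, mul_zero, ite_self, zero_mul]
    simp only [hd, Finset.sum_add_distrib]
    rw [Finset.sum_ite_eq', if_pos (Finset.mem_range.2 (by omega))]
    have s2 : ∑ i ∈ Finset.range (L.Q₁ + 1),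
        (if i + L.k₁ = m then L.μ₂ * (lam - (h m 0 - h (m - 1) 0)) * L.prob π i 0 else 0)
        = L.μ₂ * (lam - (h m 0 - h (m - 1) 0))
          * (if L.k₁ ≤ m then L.prob π (m - L.k₁) 0 else 0) := by
      split_ifs with h'
      · rw [Finset.sum_eq_single (m - L.k₁)]
        · rw [if_pos (by omega)]
        · intro b _ hb; rw [if_neg (by omega)]
        · intro h; exact absurd (Finset.mem_range.2 (by omega)) h
      · rw [mul_zero]
        exact Finset.sum_eq_zero fun x _ => if_neg (by omega)
    rw [s2]
    have : 1 - L.η₁ ≠ 0 := (sub_pos.2 hL.η₁_lt).ne'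
    unfold width τ μ₁ μ₂
    field_simp
    ring
  by_contra hne
  have hwidth : L.width m π = 0 := by
    refine (mul_eq_zero.1 hsum).resolve_left (mul_ne_zero (sub_pos.2 hL.η₁_lt).ne' ?_)
    exact fun h' => hne (by linarith)
  -- with zero width the thresholds `m - 1` and `m` would have the same solution
  have hbal : L.IsBalanced (thresholdPolicy m) π := by
    rw [isBalanced_iff hL] at hb ⊢
    refine ⟨hb.1, fun r hr hr' => ?_⟩
    rw [hb.2 r hr hr']
    by_cases h' : r = m
    · subst h'; rw [hwidth, mul_zero, mul_zero]
    · have := hthr r h'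
      rw [sub_eq_zero] at this
      rw [this]
  obtain ⟨hb', -, h1'⟩ := thresholdSolution_spec hL hC hm
  have := hbal.unique hL (thresholdPolicy_mem m) hb' (by rw [h1, h1'])
  unfold powerThreshold at hlt
  rw [← this] at hlt
  exact lt_irrefl _ hlt

/-! ### From a certificate to the structure of optimal solutions -/

/-- The structure of the optimal solutions when `m` is the least threshold that respects the power
budget, given that relative values are convex in the queue length near the threshold. -/
theorem IsOptimal.structure_of_convex (hL : L.Regular) (hC : L.SmallArrivals)
    (hQ : 1 < L.k₁ → L.k₁ ≤ L.Q₁) {p : ℝ} {m : ℕ}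
    (hleast : IsLeast {m : ℕ | m ≤ L.Q₁ ∧ L.powerThreshold m ≤ p} m)
    (hfree : m = 0 → ∀ h G, L.IsRelValue 0 1 0 h G →
      ∀ i, 1 ≤ i → i ≤ L.Q₁ → 0 < h i 0 - h (i - 1) 0)
    (hprice : 1 ≤ m → ∀ lam h G, L.IsRelValue m 1 lam h G → h m 0 - h (m - 1) 0 = lam →
      0 ≤ lam ∧ (∀ i, 1 ≤ i → i < m → h i 0 - h (i - 1) 0 < lam) ∧
        ∀ i, m < i → i ≤ L.Q₁ → lam < h i 0 - h (i - 1) 0)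
    {π : L.State → ℝ} (hπ : L.IsOptimal p π) :
    L.avgPower π ≤ p ∧
      (∀ i, 1 ≤ i → i < m → L.upperSlack i π = 0) ∧
      (∀ i, m < i → i ≤ L.Q₁ → L.lowerSlack i π = 0) ∧
      ∃ g f : ℕ → ℝ, L.IsThresholdPolicy m g f ∧ L.IsStationary g f π := by
  obtain ⟨⟨hm, hpm⟩, hmin⟩ := hleast
  have hfeas_m := thresholdSolution_isFeasible hL hC hm
  refine ⟨hπ.1.power, ?_⟩
  suffices hs : (∀ i, 1 ≤ i → i < m → L.upperSlack i π = 0) ∧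
      ∀ i, m < i → i ≤ L.Q₁ → L.lowerSlack i π = 0 from
    ⟨hs.1, hs.2, hπ.1.exists_thresholdPolicy hL hC hm hs.1 hs.2⟩
  rcases Nat.eq_zero_or_pos m with h0 | h0
  · subst h0
    obtain ⟨h, G, hh⟩ := exists_isRelValue hL 0 1 0
    have e := cost_thresholdSolution hL hC hQ hm hh
    have hopt := hπ.2 (L.thresholdSolution 0) { hfeas_m with power := hpm }
    rw [avgDelay_le_iff hL] at hopt
    exact slack_of_cost_le hL hC hQ hm hh (fun i _ h' => absurd h' (by omega))
      (fun h' => absurd h' (by omega)) (fun i hi hi' => hfree rfl h G hh i hi hi')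
      hπ.1 (by linarith)
  · have hprev : p < L.powerThreshold (m - 1) := by
      by_contra hcon
      push Not at hcon
      have := hmin (show m - 1 ∈ {m : ℕ | m ≤ L.Q₁ ∧ L.powerThreshold m ≤ p} from
        ⟨by omega, hcon⟩)
      omega
    obtain ⟨lam, h, G, hh, htie, e1, e2⟩ := exists_price hL hC hQ h0 hm (hpm.trans_lt hprev)
    obtain ⟨hlam, hbelow, habove⟩ := hprice h0 lam h G hh htie
    have hfeas := thresholdSolution_isFeasible hL hC (show m - 1 ≤ L.Q₁ by omega)
    -- the mixture of the two threshold solutions that uses up the power budget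
    have hd : 0 < L.powerThreshold (m - 1) - L.powerThreshold m := by linarith
    set t := (L.powerThreshold (m - 1) - p) / (L.powerThreshold (m - 1) - L.powerThreshold m)
      with ht
    have ht0 : 0 ≤ t := div_nonneg (by linarith) hd.le
    have ht1 : 0 ≤ 1 - t := by
      rw [sub_nonneg, ht, div_le_one hd]; linarith
    have htp : t * L.powerThreshold m + (1 - t) * L.powerThreshold (m - 1) = p := by
      rw [ht]; field_simp; ring
    have hmix := hfeas_m.comb hfeas ht0 ht1 (by ring)
    change L.IsFeasible (t * L.powerThreshold m + (1 - t) * L.powerThreshold (m - 1)) _ at hmix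
    rw [htp] at hmix
    have hopt := hπ.2 _ hmix
    rw [avgDelay_le_iff hL, queueLength_comb] at hopt
    refine slack_of_cost_le hL hC hQ hm hh hbelow (fun _ => htie) habove hπ.1 ?_
    have := mul_le_mul_of_nonneg_left hπ.1.power hlam
    have f1 : t * L.queueLength (L.thresholdSolution m)
        + (1 - t) * L.queueLength (L.thresholdSolution (m - 1)) = G - lam * p := by
      rw [← htp]
      linear_combination t * e1 + (1 - t) * e2
    linarith

/-! ### Single data arrivals: convexity of relative values -/

/-- The values of `h` along a line of states, indexed by a battery level `j`. The position `k ≥ Q₂`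
stands for the state `(k - Q₂, j)`, the position `k ≤ Q₂` for `(0, j + (Q₂ - k))`: along the line,
surplus energy is used up until the level `j` is reached, and data accumulate thereafter. Positions
`k ≥ j` are states of the chain. -/
def line (L : Link) (h : ℕ → ℕ → ℝ) (j k : ℕ) : ℝ := h (k - L.Q₂) (j + (L.Q₂ - k))

/-- The value of a line after the arrival of `e` data packets and of energy that raises the battery
level of the line to `Y`, and after the service under the threshold policy `m`. -/
def lineNext (L : Link) (m : ℕ) (lam : ℝ) (h : ℕ → ℕ → ℝ) (e Y k : ℕ) : ℝ :=
  if Y = 0 then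
    if k + e ≤ m + L.Q₂ then L.line h 0 (k + e) else lam + L.line h 0 (k + e - 1)
  else L.line h (Y - 1) (max k Y + e - 1)

/-- First differences of `h` along a line. -/
def lineDiff (L : Link) (h : ℕ → ℕ → ℝ) (j k : ℕ) : ℝ := L.line h j (k + 1) - L.line h j k

theorem serve_line {m : ℕ} (hm : m ≤ L.Q₁) (lam : ℝ) (h : ℕ → ℕ → ℝ) {e Y k y : ℕ} (he : e ≤ 1)
    (hY : Y ≤ L.Q₂) (hk : k ≤ L.Q₁ + L.Q₂) (hy : y = min (Y + (L.Q₂ - k)) L.Q₂) :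
    L.serve (thresholdPolicy m) lam h (k - L.Q₂ + e) y = L.lineNext m lam h e Y k := by
  unfold lineNext line
  rcases Nat.eq_zero_or_pos Y with h0 | h0
  · rw [if_pos h0]
    rcases Nat.eq_zero_or_pos y with hy0 | hy0
    · rw [hy0]
      rcases Nat.eq_zero_or_pos (k - L.Q₂ + e) with hx | hx
      · rw [hx, serve_zero, if_pos (by omega)]
        congr 1 <;> omega
      · rw [serve_empty _ _ _ hx, thresholdPolicy]
        by_cases ht : k + e ≤ m + L.Q₂
        · rw [if_neg (by omega), if_pos ht, zero_mul, zero_add, sub_zero, one_mul]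
          congr 1 <;> omega
        · rw [if_pos (by omega), if_neg ht, one_mul, sub_self, zero_mul, add_zero]
          congr 2 <;> omega
    · rw [if_pos (by omega)]
      rcases Nat.eq_zero_or_pos (k - L.Q₂ + e) with hx | hx
      · rw [hx, serve_zero]
        congr 1 <;> omega
      · rw [serve_pos _ _ _ hx hy0]
        congr 1 <;> omega
  · rw [if_neg h0.ne']
    rcases Nat.eq_zero_or_pos (k - L.Q₂ + e) with hx | hx
    · rw [hx, serve_zero]
      congr 1 <;> omega
    · rw [serve_pos _ _ _ hx (by omega)]
      congr 1 <;> omega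

theorem line_eq (hk₁ : L.k₁ = 1) {m : ℕ} (hm : m ≤ L.Q₁) {a lam : ℝ} {h : ℕ → ℕ → ℝ} {G : ℝ}
    (hh : L.IsRelValue m a lam h G) {j k : ℕ} (hj : j ≤ L.Q₂) (hjk : j ≤ k)
    (hk : k ≤ L.Q₁ + L.Q₂) :
    L.line h j k + G = a * ((k - L.Q₂ : ℕ) : ℝ)
      + (L.μ₀ * L.lineNext m lam h 0 (min (j + L.k₂) L.Q₂) k + L.μ₁ * L.lineNext m lam h 0 j k
        + L.μ₂ * L.lineNext m lam h 1 j k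
        + L.μ₃ * L.lineNext m lam h 1 (min (j + L.k₂) L.Q₂) k) := by
  have e := hh (k - L.Q₂) (by omega) (j + (L.Q₂ - k)) (by omega)
  unfold line
  rw [e, topCredit, if_neg (by simp [hk₁]), mul_zero, sub_zero, step, hk₁]
  rw [serve_line hm lam h (e := 1) (Y := j) le_rfl hj hk (by omega),
    serve_line hm lam h (e := 1) (Y := min (j + L.k₂) L.Q₂) le_rfl (by omega) hk (by omega)]
  rw [← serve_line hm lam h (e := 0) (Y := j) (k := k) (y := j + (L.Q₂ - k)) zero_le_one hj hk
    (by omega), ← serve_line hm lam h (e := 0) (Y := min (j + L.k₂) L.Q₂) (k := k)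
    (y := min (j + (L.Q₂ - k) + L.k₂) L.Q₂) zero_le_one (by omega) hk (by omega)]
  rfl

/-- First differences of the values of a line after a slot. -/
theorem lineNext_succ_sub {m : ℕ} (lam : ℝ) (h : ℕ → ℕ → ℝ) (e Y k : ℕ) :
    L.lineNext m lam h e Y (k + 1) - L.lineNext m lam h e Y k =
      if Y = 0 then
        if k + e < m + L.Q₂ then L.lineDiff h 0 (k + e)
        else if k + e = m + L.Q₂ then lam else L.lineDiff h 0 (k + e - 1)
      else if Y ≤ k then L.lineDiff h (Y - 1) (k + e - 1) else 0 := by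
  unfold lineNext lineDiff
  by_cases h0 : Y = 0
  · simp only [h0, if_true]
    rcases lt_trichotomy (k + e) (m + L.Q₂) with h1 | h1 | h1
    · rw [if_pos (by omega), if_pos (by omega), if_pos h1, show k + 1 + e = k + e + 1 by omega]
    · rw [if_neg (by omega), if_pos (by omega), if_neg (by omega), if_pos h1,
        show k + 1 + e - 1 = k + e by omega]
      ring
    · rw [if_neg (by omega), if_neg (by omega), if_neg (by omega), if_neg (by omega),
        show k + 1 + e - 1 = k + e - 1 + 1 by omega]
      ring
  · rw [if_neg h0, if_neg h0, if_neg h0]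
    by_cases h1 : Y ≤ k
    · rw [if_pos h1, show max (k + 1) Y + e - 1 = k + e - 1 + 1 by omega,
        show max k Y + e - 1 = k + e - 1 by omega]
    · rw [if_neg h1, show max (k + 1) Y = max k Y by omega, sub_self]

theorem lineDiff_eq (hk₁ : L.k₁ = 1) {m : ℕ} (hm : m ≤ L.Q₁) {a lam : ℝ} {h : ℕ → ℕ → ℝ} {G : ℝ}
    (hh : L.IsRelValue m a lam h G) {j k : ℕ} (hj : j ≤ L.Q₂) (hjk : j ≤ k)
    (hk : k < L.Q₁ + L.Q₂) :
    L.lineDiff h j k = a * (if L.Q₂ ≤ k then 1 else 0)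
      + (L.μ₀ * (L.lineNext m lam h 0 (min (j + L.k₂) L.Q₂) (k + 1)
          - L.lineNext m lam h 0 (min (j + L.k₂) L.Q₂) k)
        + L.μ₁ * (L.lineNext m lam h 0 j (k + 1) - L.lineNext m lam h 0 j k)
        + L.μ₂ * (L.lineNext m lam h 1 j (k + 1) - L.lineNext m lam h 1 j k)
        + L.μ₃ * (L.lineNext m lam h 1 (min (j + L.k₂) L.Q₂) (k + 1)
          - L.lineNext m lam h 1 (min (j + L.k₂) L.Q₂) k)) := by
  have e1 := line_eq hk₁ hm hh hj hjk hk.le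
  have e2 := line_eq hk₁ hm hh hj (Nat.le_succ_of_le hjk) hk
  have e3 : ((k + 1 - L.Q₂ : ℕ) : ℝ) - ((k - L.Q₂ : ℕ) : ℝ) = if L.Q₂ ≤ k then 1 else 0 := by
    split_ifs with h'
    · rw [show k + 1 - L.Q₂ = k - L.Q₂ + 1 by omega]; push_cast; ring
    · rw [show k + 1 - L.Q₂ = k - L.Q₂ by omega, sub_self]
  unfold lineDiff
  rw [← e3]
  linear_combination e2 - e1

/-- Lower bound for the first differences of relative values along the lines. A slot carries each
difference to differences of the same kind, to `0` or, at the threshold, to the price, so that the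
minimum principle applies; the rank decreases when energy but no data arrive. -/
theorem le_lineDiff (hL : L.Regular) (hk₁ : L.k₁ = 1) {m : ℕ} (hm : m ≤ L.Q₁) {a lam : ℝ}
    {h : ℕ → ℕ → ℝ} {G : ℝ} (hh : L.IsRelValue m a lam h G) (ha : 0 ≤ a) {v : ℝ} (hv : v ≤ 0)
    (hvl : v ≤ lam) {j k : ℕ} (hj : j ≤ L.Q₂) (hjk : j ≤ k) (hk : k < L.Q₁ + L.Q₂) :
    v + a * (if L.Q₂ ≤ k then 1 else 0) ≤ L.lineDiff h j k := by
  have hk₂ := hL.k₂_pos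
  have hQ₂ := hL.Q₂_pos
  have hμ := L.μ_sum
  have m1 := hL.μ₁_pos.le
  have m2 := hL.μ₂_pos.le
  have m3 := hL.μ₃_pos.le
  have hcost : ∀ k, 0 ≤ a * (if L.Q₂ ≤ k then (1 : ℝ) else 0) := fun k =>
    mul_nonneg ha (by split_ifs <;> norm_num)
  have hnext : ∀ M ≤ 0, (∀ k j, j ≤ k ∧ k < L.Q₁ + L.Q₂ ∧ j ≤ L.Q₂ → M ≤ L.lineDiff h j k - v) →
      ∀ k < L.Q₁ + L.Q₂, ∀ e ≤ 1, ∀ Y ≤ L.Q₂,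
        v + M ≤ L.lineNext m lam h e Y (k + 1) - L.lineNext m lam h e Y k := by
    intro M hM hlow k hk e he Y hY
    rw [lineNext_succ_sub lam h e Y k]
    split_ifs
    · linarith [hlow (k + e) 0 (by omega)]
    · linarith
    · linarith [hlow (k + e - 1) 0 (by omega)]
    · linarith [hlow (k + e - 1) (Y - 1) (by omega)]
    · linarith
  have key := nonneg_of_min_principle (fun k j => L.lineDiff h j k - v)
    (fun k j => j ≤ k ∧ k < L.Q₁ + L.Q₂ ∧ j ≤ L.Q₂) (fun k _ => k) (L.Q₁ + L.Q₂)
    (fun k j h => ⟨by omega, by omega⟩) L.μ₀ hL.μ₀_pos ?_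
  · have hn := hnext 0 le_rfl key k hk
    simp only [add_zero] at hn
    rw [lineDiff_eq hk₁ hm hh hj hjk hk]
    have t0 := mul_le_mul_of_nonneg_left (hn 0 zero_le_one _ (min_le_right (j + L.k₂) L.Q₂))
      hL.μ₀_pos.le
    have t1 := mul_le_mul_of_nonneg_left (hn 0 zero_le_one j hj) m1
    have t2 := mul_le_mul_of_nonneg_left (hn 1 le_rfl j hj) m2
    have t3 := mul_le_mul_of_nonneg_left (hn 1 le_rfl _ (min_le_right (j + L.k₂) L.Q₂)) m3
    have : v = L.μ₀ * v + L.μ₁ * v + L.μ₂ * v + L.μ₃ * v := by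
      rw [← add_mul, ← add_mul, ← add_mul, hμ, one_mul]
    linarith
  rintro M hM hlow k j ⟨hjk, hk, hj⟩ -
  have hn := hnext M hM hlow k hk
  have t1 := mul_le_mul_of_nonneg_left (hn 0 zero_le_one j hj) m1
  have t2 := mul_le_mul_of_nonneg_left (hn 1 le_rfl j hj) m2
  have t3 := mul_le_mul_of_nonneg_left (hn 1 le_rfl _ (min_le_right (j + L.k₂) L.Q₂)) m3
  have e := lineDiff_eq hk₁ hm hh hj hjk hk
  have hc := hcost k
  have e1 : L.μ₁ * (v + M) + L.μ₂ * (v + M) + L.μ₃ * (v + M) = (1 - L.μ₀) * (v + M) := by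
    rw [← hμ]; ring
  rw [lineNext_succ_sub lam h 0 _ k, if_neg (by omega : ¬ min (j + L.k₂) L.Q₂ = 0)] at e
  by_cases hYk : min (j + L.k₂) L.Q₂ ≤ k
  · left
    refine ⟨k - 1, min (j + L.k₂) L.Q₂ - 1, by omega, by omega, ?_⟩
    rw [if_pos hYk, Nat.add_zero] at e
    linarith
  · right
    rw [if_neg hYk, mul_zero] at e
    have := mul_nonpos_of_nonneg_of_nonpos hL.μ₀_pos.le hv
    linarith

/-- Second differences of the values of a line after a slot, when holding and sending cost the same
at the threshold. -/
theorem lineNext_second_diff {m : ℕ} (hm : 1 ≤ m) (lam : ℝ) (h : ℕ → ℕ → ℝ)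
    (htie : L.lineDiff h 0 (m + L.Q₂ - 1) = lam) (e Y k : ℕ) :
    (L.lineNext m lam h e Y (k + 2) - L.lineNext m lam h e Y (k + 1))
      - (L.lineNext m lam h e Y (k + 1) - L.lineNext m lam h e Y k) =
      if Y = 0 then
        if k + e + 1 < m + L.Q₂ then L.lineDiff h 0 (k + e + 1) - L.lineDiff h 0 (k + e)
        else if k + e + 1 = m + L.Q₂ then 0
        else L.lineDiff h 0 (k + e - 1 + 1) - L.lineDiff h 0 (k + e - 1)
      else if Y ≤ k then L.lineDiff h (Y - 1) (k + e - 1 + 1) - L.lineDiff h (Y - 1) (k + e - 1)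
      else if Y = k + 1 then L.lineDiff h (Y - 1) (k + e) else 0 := by
  rw [lineNext_succ_sub lam h e Y k, lineNext_succ_sub lam h e Y (k + 1)]
  by_cases h0 : Y = 0
  · simp only [h0, if_true]
    rcases lt_trichotomy (k + e + 1) (m + L.Q₂) with h1 | h1 | h1
    · rw [if_pos (by omega), if_pos (by omega), if_pos h1, show k + 1 + e = k + e + 1 by omega]
    · rw [if_neg (by omega), if_pos (by omega), if_pos (by omega), if_neg (by omega), if_pos h1,
        ← htie, show k + e = m + L.Q₂ - 1 by omega, sub_self]
    · have e1 : k + 1 + e - 1 = k + e - 1 + 1 := by omega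
      have n1 : ¬ k + 1 + e < m + L.Q₂ := by omega
      have n2 : ¬ k + 1 + e = m + L.Q₂ := by omega
      have n3 : ¬ k + e < m + L.Q₂ := by omega
      have n4 : ¬ k + e + 1 < m + L.Q₂ := by omega
      have n5 : ¬ k + e + 1 = m + L.Q₂ := by omega
      rw [if_neg n1, if_neg n2, if_neg n3, if_neg n4, if_neg n5, e1]
      by_cases h2 : k + e = m + L.Q₂
      · rw [if_pos h2, ← htie, h2]
      · rw [if_neg h2]
  · rw [if_neg h0, if_neg h0, if_neg h0]
    by_cases h1 : Y ≤ k
    · rw [if_pos h1, if_pos h1, if_pos (by omega), show k + 1 + e - 1 = k + e - 1 + 1 by omega]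
    · rw [if_neg h1, if_neg h1, sub_zero]
      by_cases h2 : Y = k + 1
      · rw [if_pos h2, if_pos (by omega), show k + 1 + e - 1 = k + e by omega]
      · rw [if_neg h2, if_neg (by omega)]

/-- Relative values are strictly convex along the lines, from the kink at the empty queue onwards.
The price `lam` is such that the threshold creates no kink of the wrong sign; the cost has a kink
where the queue becomes nonempty, and the strict convexity there propagates upwards. -/
theorem lineDiff_strictMono (hL : L.Regular) (hk₁ : L.k₁ = 1) {m : ℕ} (hm1 : 1 ≤ m)
    (hm : m ≤ L.Q₁) {lam : ℝ} (hlam : 0 ≤ lam) {h : ℕ → ℕ → ℝ} {G : ℝ}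
    (hh : L.IsRelValue m 1 lam h G) (htie : L.lineDiff h 0 (m + L.Q₂ - 1) = lam) :
    ∀ k, L.Q₂ ≤ k + 1 → k + 1 < L.Q₁ + L.Q₂ → ∀ j ≤ k, j ≤ L.Q₂ →
      L.lineDiff h j k < L.lineDiff h j (k + 1) := by
  have hk₂ := hL.k₂_pos
  have hQ₂ := hL.Q₂_pos
  have hμ := L.μ_sum
  have m0 := hL.μ₀_pos
  have m1 := hL.μ₁_pos.le
  have m2 := hL.μ₂_pos.le
  have m3 := hL.μ₃_pos.le
  have hpos : ∀ j k, j ≤ L.Q₂ → j ≤ k → k < L.Q₁ + L.Q₂ → 0 ≤ L.lineDiff h j k := by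
    intro j k hj hjk hk
    have := le_lineDiff hL hk₁ hm hh zero_le_one le_rfl hlam hj hjk hk
    have h0 : (0 : ℝ) ≤ if L.Q₂ ≤ k then 1 else 0 := by split_ifs <;> norm_num
    linarith
  set D : ℕ → ℕ → ℝ := fun k j => L.lineDiff h j (k + 1) - L.lineDiff h j k with hD
  set N : ℕ → ℕ → ℕ → ℝ := fun e Y k =>
    (L.lineNext m lam h e Y (k + 2) - L.lineNext m lam h e Y (k + 1))
      - (L.lineNext m lam h e Y (k + 1) - L.lineNext m lam h e Y k) with hN
  have hDeq : ∀ k j, j ≤ k → k + 1 < L.Q₁ + L.Q₂ → j ≤ L.Q₂ →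
      D k j = (if k + 1 = L.Q₂ then 1 else 0) + (L.μ₀ * N 0 (min (j + L.k₂) L.Q₂) k
        + L.μ₁ * N 0 j k + L.μ₂ * N 1 j k + L.μ₃ * N 1 (min (j + L.k₂) L.Q₂) k) := by
    intro k j hjk hk hj
    have e1 := lineDiff_eq hk₁ hm hh hj hjk (by omega)
    have e2 := lineDiff_eq hk₁ hm hh hj (Nat.le_succ_of_le hjk) hk
    have e3 : (if L.Q₂ ≤ k + 1 then (1 : ℝ) else 0) - (if L.Q₂ ≤ k then 1 else 0)
        = if k + 1 = L.Q₂ then 1 else 0 := by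
      rcases lt_trichotomy (k + 1) L.Q₂ with h' | h' | h'
      · rw [if_neg (by omega), if_neg (by omega), if_neg (by omega), sub_self]
      · rw [if_pos (by omega), if_neg (by omega), if_pos h', sub_zero]
      · rw [if_pos (by omega), if_pos (by omega), if_neg (by omega), sub_self]
    simp only [hD, hN]
    rw [← e3]
    linear_combination e2 - e1
  have hnext : ∀ M ≤ 0, (∀ k j, j ≤ k ∧ k + 1 < L.Q₁ + L.Q₂ ∧ j ≤ L.Q₂ → M ≤ D k j) →
      ∀ k, k + 1 < L.Q₁ + L.Q₂ → ∀ e ≤ 1, ∀ Y ≤ L.Q₂, M ≤ N e Y k := by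
    intro M hM hlow k hk e he Y hY
    simp only [hN]
    rw [lineNext_second_diff hm1 lam h htie]
    split_ifs
    · exact hlow (k + e) 0 (by omega)
    · exact hM
    · exact hlow (k + e - 1) 0 (by omega)
    · exact hlow (k + e - 1) (Y - 1) (by omega)
    · exact hM.trans (hpos _ _ (by omega) (by omega) (by omega))
    · exact hM
  have hkink : ∀ k, (0 : ℝ) ≤ if k + 1 = L.Q₂ then 1 else 0 := fun k => by
    split_ifs <;> norm_num
  -- the successor when energy but no data arrive
  have hsucc : ∀ k j, k + 1 < L.Q₁ + L.Q₂ → 0 ≤ N 0 (min (j + L.k₂) L.Q₂) k ∨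
      (min (j + L.k₂) L.Q₂ ≤ k ∧
        N 0 (min (j + L.k₂) L.Q₂) k = D (k - 1) (min (j + L.k₂) L.Q₂ - 1)) := by
    intro k j hk
    simp only [hN, hD]
    rw [lineNext_second_diff hm1 lam h htie, if_neg (by omega)]
    by_cases h1 : min (j + L.k₂) L.Q₂ ≤ k
    · right
      refine ⟨h1, ?_⟩
      rw [if_pos h1]
      rfl
    · left
      rw [if_neg h1]
      split_ifs with h2
      · exact hpos _ _ (by omega) (by omega) (by omega)
      · exact le_rfl
  have key := nonneg_of_min_principle D (fun k j => j ≤ k ∧ k + 1 < L.Q₁ + L.Q₂ ∧ j ≤ L.Q₂)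
    (fun k _ => k) (L.Q₁ + L.Q₂) (fun k j h => ⟨by omega, by omega⟩) L.μ₀ m0 ?_
  swap
  · rintro M hM hlow k j ⟨hjk, hk, hj⟩ -
    have hn := hnext M hM hlow k hk
    have t1 := mul_le_mul_of_nonneg_left (hn 0 zero_le_one j hj) m1
    have t2 := mul_le_mul_of_nonneg_left (hn 1 le_rfl j hj) m2
    have t3 := mul_le_mul_of_nonneg_left (hn 1 le_rfl _ (min_le_right (j + L.k₂) L.Q₂)) m3
    have e := hDeq k j hjk hk hj
    have hc := hkink k
    have e1 : L.μ₁ * M + L.μ₂ * M + L.μ₃ * M = (1 - L.μ₀) * M := by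
      rw [← hμ]; ring
    rcases hsucc k j hk with h1 | ⟨h1, h2⟩
    · right
      have := mul_nonneg m0.le h1
      linarith
    · left
      refine ⟨k - 1, min (j + L.k₂) L.Q₂ - 1, by omega, by omega, ?_⟩
      rw [h2] at e
      linarith
  have hlower : ∀ k j, j ≤ k → k + 1 < L.Q₁ + L.Q₂ → j ≤ L.Q₂ →
      (if k + 1 = L.Q₂ then 1 else 0) + L.μ₀ * N 0 (min (j + L.k₂) L.Q₂) k ≤ D k j := by
    intro k j hjk hk hj
    have hn := hnext 0 le_rfl key k hk
    have t1 := mul_nonneg m1 (hn 0 zero_le_one j hj)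
    have t2 := mul_nonneg m2 (hn 1 le_rfl j hj)
    have t3 := mul_nonneg m3 (hn 1 le_rfl _ (min_le_right (j + L.k₂) L.Q₂))
    linarith [hDeq k j hjk hk hj]
  intro k hQk
  -- starting from the kink, strict convexity propagates upwards
  obtain ⟨d, rfl⟩ : ∃ d, k = L.Q₂ - 1 + d := ⟨k + 1 - L.Q₂, by omega⟩
  induction d with
  | zero =>
    intro hk j hjk hj
    have h1 := hlower _ j hjk hk hj
    rw [if_pos (by omega)] at h1
    have h2 := mul_nonneg m0.le (hnext 0 le_rfl key (L.Q₂ - 1 + 0) hk 0 zero_le_one _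
      (min_le_right (j + L.k₂) L.Q₂))
    exact sub_pos.1 (show 0 < D (L.Q₂ - 1 + 0) j by linarith)
  | succ d ih =>
    intro hk j hjk hj
    have h1 := hlower _ j hjk hk hj
    rw [if_neg (by omega), zero_add] at h1
    have h2 : N 0 (min (j + L.k₂) L.Q₂) (L.Q₂ - 1 + (d + 1))
        = D (L.Q₂ - 1 + d) (min (j + L.k₂) L.Q₂ - 1) := by
      simp only [hN, hD]
      rw [lineNext_second_diff hm1 lam h htie, if_neg (by omega), if_pos (by omega)]
      rfl
    have h3 := ih (by omega) (by omega) (min (j + L.k₂) L.Q₂ - 1) (by omega) (by omega)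
    have h4 : 0 < D (L.Q₂ - 1 + d) (min (j + L.k₂) L.Q₂ - 1) := sub_pos.2 h3
    rw [h2] at h1
    exact sub_pos.1 (lt_of_lt_of_le (mul_pos m0 h4) h1)

theorem gap_eq_lineDiff (h : ℕ → ℕ → ℝ) {i : ℕ} (hi : 1 ≤ i) :
    h i 0 - h (i - 1) 0 = L.lineDiff h 0 (i - 1 + L.Q₂) := by
  unfold lineDiff line
  rw [show i - 1 + L.Q₂ + 1 - L.Q₂ = i by omega, show i - 1 + L.Q₂ - L.Q₂ = i - 1 by omega,
    show L.Q₂ - (i - 1 + L.Q₂ + 1) = 0 by omega, show L.Q₂ - (i - 1 + L.Q₂) = 0 by omega]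

/-- With single data arrivals, an additional packet in the queue has a positive cost when power is
free. -/
theorem gap_pos_of_single (hL : L.Regular) (hk₁ : L.k₁ = 1) {h : ℕ → ℕ → ℝ} {G : ℝ}
    (hh : L.IsRelValue 0 1 0 h G) {i : ℕ} (hi : 1 ≤ i) (hi' : i ≤ L.Q₁) :
    0 < h i 0 - h (i - 1) 0 := by
  rw [gap_eq_lineDiff h hi]
  have := le_lineDiff hL hk₁ (Nat.zero_le _) hh zero_le_one le_rfl le_rfl (Nat.zero_le _)
    (Nat.zero_le _) (show i - 1 + L.Q₂ < L.Q₁ + L.Q₂ by omega)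
  rw [if_pos (by omega)] at this
  linarith

/-- With single data arrivals, the price of power for which the threshold `m` is optimal separates
the gains from sending below and above the threshold. -/
theorem price_of_single (hL : L.Regular) (hk₁ : L.k₁ = 1) {m : ℕ} (hm1 : 1 ≤ m) (hm : m ≤ L.Q₁)
    {lam : ℝ} {h : ℕ → ℕ → ℝ} {G : ℝ} (hh : L.IsRelValue m 1 lam h G)
    (htie : h m 0 - h (m - 1) 0 = lam) :
    0 ≤ lam ∧ (∀ i, 1 ≤ i → i < m → h i 0 - h (i - 1) 0 < lam) ∧
      ∀ i, m < i → i ≤ L.Q₁ → lam < h i 0 - h (i - 1) 0 := by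
  have htie' : L.lineDiff h 0 (m + L.Q₂ - 1) = lam := by
    rw [← htie, gap_eq_lineDiff h hm1, show m - 1 + L.Q₂ = m + L.Q₂ - 1 by omega]
  have hlam : 0 ≤ lam := by
    by_contra hneg
    push Not at hneg
    have := le_lineDiff hL hk₁ hm hh zero_le_one hneg.le le_rfl (Nat.zero_le _)
      (Nat.zero_le _) (show m + L.Q₂ - 1 < L.Q₁ + L.Q₂ by omega)
    rw [if_pos (by omega), htie'] at this
    linarith
  have hmono := lineDiff_strictMono hL hk₁ hm1 hm hlam hh htie'
  have hlt : ∀ d i, 1 ≤ i → i + (d + 1) ≤ L.Q₁ →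
      h i 0 - h (i - 1) 0 < h (i + (d + 1)) 0 - h (i + (d + 1) - 1) 0 := by
    have hstep : ∀ i, 1 ≤ i → i + 1 ≤ L.Q₁ →
        h i 0 - h (i - 1) 0 < h (i + 1) 0 - h (i + 1 - 1) 0 := by
      intro i hi hi'
      rw [gap_eq_lineDiff h hi, gap_eq_lineDiff h (Nat.le_succ_of_le hi),
        show i + 1 - 1 + L.Q₂ = i - 1 + L.Q₂ + 1 by omega]
      exact hmono _ (by omega) (by omega) 0 (Nat.zero_le _) (Nat.zero_le _)
    intro d
    induction d with
    | zero => intro i hi hi'; exact hstep i hi hi'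
    | succ d ih =>
      intro i hi hi'
      exact (ih i hi (by omega)).trans (hstep (i + (d + 1)) (by omega) (by omega))
  refine ⟨hlam, fun i hi him => ?_, fun i hmi hi => ?_⟩
  · have := hlt (m - i - 1) i hi (by omega)
    rw [show i + (m - i - 1 + 1) = m by omega, htie] at this
    exact this
  · have := hlt (i - m - 1) m hm1 (by omega)
    rw [show m + (i - m - 1 + 1) = i by omega, htie] at this
    exact this

theorem IsRelValue.neg {m : ℕ} {a lam : ℝ} {h : ℕ → ℕ → ℝ} {G : ℝ}
    (hh : L.IsRelValue m a lam h G) :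
    L.IsRelValue m (-a) (-lam) (fun i j => -h i j) (-G) := by
  intro i hi j hj
  have e := hh i hi j hj
  have e1 := step_affine (L := L) (thresholdPolicy m) lam 0 (-1) 0 h (fun _ _ => 0) i j
  simp only [neg_one_mul, mul_zero, add_zero, zero_mul] at e1
  rw [e1]
  linarith

/-- With single data arrivals, the largest threshold minimises the power: if only power is charged
for, at price `1`, the presence of an additional packet costs at most `1`. -/
theorem powerThreshold_le_avgPower (hL : L.Regular) (hC : L.SmallArrivals) (hk₁ : L.k₁ = 1)
    {p : ℝ} {π : L.State → ℝ} (hπ : L.IsFeasible p π) :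
    L.powerThreshold L.Q₁ ≤ L.avgPower π := by
  have hQ : 1 < L.k₁ → L.k₁ ≤ L.Q₁ := fun h' => absurd h' (by omega)
  obtain ⟨h, G, hh⟩ := exists_isRelValue hL L.Q₁ 0 1
  have hG := cost_thresholdSolution hL hC hQ le_rfl hh
  obtain ⟨c, hc, hc1, hb, -⟩ := hπ.exists_policy hL hC (thresholdPolicy_mem L.Q₁)
  have hcost := cost_sub_eq hL hC hQ le_rfl hh hc1 hb hπ.sum_one
  have hgap : ∀ i, 1 ≤ i → i ≤ L.Q₁ → 0 ≤ 1 - (h i 0 - h (i - 1) 0) := by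
    intro i hi hi'
    have hh' := hh.neg
    rw [neg_zero] at hh'
    have := le_lineDiff hL hk₁ le_rfl hh' le_rfl (v := -1) (by norm_num) le_rfl
      (Nat.zero_le _) (Nat.zero_le _) (show i - 1 + L.Q₂ < L.Q₁ + L.Q₂ by omega)
    rw [← gap_eq_lineDiff _ hi] at this
    linarith
  have hthr : ∀ i ≤ L.Q₁, thresholdPolicy L.Q₁ i = 0 := fun i hi => if_neg (by omega)
  have : 0 ≤ ∑ i ∈ Finset.range (L.Q₁ + 1), L.deviation L.Q₁ 1 h c i * L.prob π i 0 := by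
    refine Finset.sum_nonneg fun i hi => mul_nonneg ?_ (prob_nonneg hπ.nonneg i 0)
    have hi' : i ≤ L.Q₁ := by simp at hi; omega
    have m1 := hL.μ₁_pos.le
    have m2 := hL.μ₂_pos.le
    unfold deviation
    refine add_nonneg ?_ ?_
    · split_ifs with h'
      · rw [hthr i hi', sub_zero]
        exact mul_nonneg m1 (mul_nonneg (hc i).1 (hgap i h' hi'))
      · exact le_rfl
    · split_ifs with h'
      · rw [hthr _ h', sub_zero]
        exact mul_nonneg m2 (mul_nonneg (hc _).1 (hgap _ (by omega) h'))
      · exact le_rfl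
  linarith

/-! ### Batch data arrivals: differences of relative values -/

/-- The decrease of the cost `h` between neighbouring states: for `j = 0`, by removing a data packet
from the state `(i, 0)`, and for `j > 0` by an additional energy packet in the state
`(i, j - 1)`. -/
def relDiff (h : ℕ → ℕ → ℝ) (i j : ℕ) : ℝ :=
  if j = 0 then h i 0 - h (i - 1) 0 else h i (j - 1) - h i j

/-- The pairs of neighbouring states that `relDiff` compares. -/
def IsPair (L : Link) (i j : ℕ) : Prop := i ≤ L.Q₁ ∧ j ≤ L.Q₂ ∧ 0 < i + j

/-- The difference that `V i j` turns into after a slot with an energy arrival, where `x` is the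
queue length (of the longer queue, if `j = 0`) after the data arrivals. It is zero if the two states
merge. -/
def sendNext (L : Link) (V : ℕ → ℕ → ℝ) (x j : ℕ) : ℝ :=
  if j = 0 then if x = 1 then V 0 1 else if x ≤ L.Q₁ + 1 then V (x - 1) 0 else 0
  else if j = L.Q₂ then 0 else if x = 0 then V 0 (j + 1) else V (min (x - 1) L.Q₁) j

/-- The difference that `V i j` turns into after a slot without energy arrival under the threshold
policy `m`, where `x` is the queue length (of the longer queue, if `j = 0`) after the data arrivals.
It is the price `lam` if the two states merge at the expense of a use of the reliable source. -/
def holdNext (L : Link) (m : ℕ) (lam : ℝ) (V : ℕ → ℕ → ℝ) (x j : ℕ) : ℝ :=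
  if j = 0 then
    if x ≤ m then V x 0 else if x = m + 1 then lam else if x ≤ L.Q₁ + 1 then V (x - 1) 0 else 0
  else if x = 0 then V 0 j else if 2 ≤ j then V (min (x - 1) L.Q₁) (j - 1)
  else if x ≤ m then V x 0 else lam

/-- Expectation of the differences `V` after a slot. -/
def diffStep (L : Link) (m : ℕ) (lam : ℝ) (V : ℕ → ℕ → ℝ) (i j : ℕ) : ℝ :=
  L.μ₀ * L.sendNext V i j + L.μ₁ * L.holdNext m lam V i j
    + L.μ₂ * L.holdNext m lam V (i + L.k₁) j + L.μ₃ * L.sendNext V (i + L.k₁) j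

/-- Difference of the costs per slot of neighbouring states. -/
def diffCost (L : Link) (lam : ℝ) (i j : ℕ) : ℝ :=
  (if j = 0 then 1 else 0)
    - lam * if (j = 0 ∧ i + L.k₁ = L.Q₁ + 1) ∨ (j = 1 ∧ L.Q₁ < i + L.k₁) then L.η₁ else 0

theorem relDiff_zero (h : ℕ → ℕ → ℝ) (i : ℕ) : relDiff h i 0 = h i 0 - h (i - 1) 0 := if_pos rfl

theorem relDiff_pos (h : ℕ → ℕ → ℝ) (i : ℕ) {j : ℕ} (hj : 0 < j) :
    relDiff h i j = h i (j - 1) - h i j := if_neg hj.ne'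

theorem serve_sub_serve_of_energy (c : ℕ → ℝ) (lam : ℝ) (h : ℕ → ℕ → ℝ) {x : ℕ} (hx : 0 < x) :
    L.serve c lam h x 1 - L.serve c lam h (x - 1) 1 = L.sendNext (relDiff h) x 0 := by
  rw [serve_pos c lam h hx one_pos, sendNext, if_pos rfl]
  rcases Nat.lt_or_ge 1 x with h1 | h1
  · rw [serve_pos c lam h (by omega) one_pos, if_neg (by omega)]
    split_ifs with h2
    · rw [relDiff_zero, min_eq_left (by omega), min_eq_left (by omega), Nat.sub_self]
    · rw [min_eq_right (by omega), min_eq_right (by omega), sub_self]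
  · obtain rfl : x = 1 := by omega
    rw [show 1 - 1 = 0 from rfl, serve_zero, if_pos rfl, relDiff_pos _ _ one_pos, Nat.zero_min,
      Nat.sub_self]

theorem serve_sub_serve_of_no_energy {m : ℕ} (hm : m ≤ L.Q₁) (lam : ℝ) (h : ℕ → ℕ → ℝ) {x : ℕ}
    (hx : 0 < x) :
    L.serve (thresholdPolicy m) lam h x 0 - L.serve (thresholdPolicy m) lam h (x - 1) 0
      = L.holdNext m lam (relDiff h) x 0 := by
  have hs : ∀ x, x ≤ m → L.serve (thresholdPolicy m) lam h x 0 = h x 0 := by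
    intro x hxm
    rcases Nat.eq_zero_or_pos x with rfl | h0
    · exact serve_zero _ _ _ _
    · rw [serve_empty _ _ _ h0, thresholdPolicy, if_neg (by omega), min_eq_left (hxm.trans hm)]
      ring
  have hs' : ∀ x, m < x →
      L.serve (thresholdPolicy m) lam h x 0 = lam + h (min (x - 1) L.Q₁) 0 := by
    intro x hxm
    rw [serve_empty _ _ _ (by omega), thresholdPolicy, if_pos hxm]
    ring
  rw [holdNext, if_pos rfl]
  split_ifs with h1 h2 h3
  · rw [hs x h1, hs _ (by omega), relDiff_zero]
  · rw [hs' x (by omega), hs _ (by omega), h2, Nat.add_sub_cancel, min_eq_left hm]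
    ring
  · rw [hs' x (by omega), hs' _ (by omega), relDiff_zero, min_eq_left (by omega),
      min_eq_left (by omega)]
    ring
  · rw [hs' x (by omega), hs' _ (by omega), min_eq_right (by omega), min_eq_right (by omega)]
    ring

theorem serve_sub_serve_battery_of_energy (c : ℕ → ℝ) (lam : ℝ) (h : ℕ → ℕ → ℝ) (x : ℕ) {j : ℕ}
    (hj : 0 < j) (hj' : j ≤ L.Q₂) :
    L.serve c lam h x j - L.serve c lam h x (min (j + 1) L.Q₂) = L.sendNext (relDiff h) x j := by
  rw [sendNext, if_neg hj.ne']
  split_ifs with h1 h2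
  · rw [min_eq_right (by omega), h1, sub_self]
  · rw [h2, serve_zero, serve_zero, relDiff_pos _ _ (Nat.succ_pos j), min_eq_left (by omega),
      Nat.succ_eq_add_one, Nat.add_sub_cancel]
  · rw [serve_pos c lam h (by omega) hj, serve_pos c lam h (by omega) (by omega),
      relDiff_pos _ _ hj, min_eq_left (by omega : j + 1 ≤ L.Q₂), Nat.add_sub_cancel]

theorem serve_sub_serve_battery_of_no_energy {m : ℕ} (hm : m ≤ L.Q₁) (lam : ℝ) (h : ℕ → ℕ → ℝ)
    (x : ℕ) {j : ℕ} (hj : 0 < j) :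
    L.serve (thresholdPolicy m) lam h x (j - 1) - L.serve (thresholdPolicy m) lam h x j
      = L.holdNext m lam (relDiff h) x j := by
  rw [holdNext, if_neg hj.ne']
  split_ifs with h1 h2 h3
  · rw [h1, serve_zero, serve_zero, relDiff_pos _ _ hj]
  · rw [serve_pos _ lam h (by omega) (by omega), serve_pos _ lam h (by omega) hj,
      relDiff_pos _ _ (by omega)]
  · obtain rfl : j = 1 := by omega
    rw [serve_empty _ _ _ (by omega), serve_pos _ lam h (by omega) one_pos, thresholdPolicy,
      if_neg (by omega), relDiff_zero, min_eq_left (h3.trans hm), min_eq_left (by omega),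
      Nat.sub_self]
    ring
  · obtain rfl : j = 1 := by omega
    rw [serve_empty _ _ _ (by omega), serve_pos _ lam h (by omega) one_pos, thresholdPolicy,
      if_pos (by omega), Nat.sub_self]
    ring

/-- The differences of relative values satisfy a recursion among themselves, with single energy
arrivals. -/
theorem relDiff_eq (hL : L.Regular) (hk₁ : 1 < L.k₁) (hk₂ : L.k₂ = 1) {m : ℕ} (hm : m ≤ L.Q₁)
    {lam : ℝ} {h : ℕ → ℕ → ℝ} {G : ℝ} (hh : L.IsRelValue m 1 lam h G) {i j : ℕ}
    (hij : L.IsPair i j) :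
    relDiff h i j = L.diffCost lam i j + L.diffStep m lam (relDiff h) i j := by
  obtain ⟨hi, hj, hpos⟩ := hij
  have hQ₂ := hL.Q₂_pos
  rcases Nat.eq_zero_or_pos j with rfl | hj0
  · have hi0 : 0 < i := by omega
    have e1 := hh i hi 0 hj
    have e2 := hh (i - 1) (by omega) 0 hj
    rw [step, hk₂, zero_add, min_eq_left (by omega : 1 ≤ L.Q₂)] at e1 e2
    have s0 := serve_sub_serve_of_energy (L := L) (thresholdPolicy m) lam h hi0
    have s1 := serve_sub_serve_of_no_energy hm lam h hi0
    have s2 := serve_sub_serve_of_no_energy hm lam h (Nat.add_pos_left hi0 L.k₁)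
    have s3 := serve_sub_serve_of_energy (L := L) (thresholdPolicy m) lam h
      (Nat.add_pos_left hi0 L.k₁)
    rw [show i + L.k₁ - 1 = i - 1 + L.k₁ by omega] at s2 s3
    have ht : L.topCredit i 0 - L.topCredit (i - 1) 0
        = if (0 = 0 ∧ i + L.k₁ = L.Q₁ + 1) ∨ (0 = 1 ∧ L.Q₁ < i + L.k₁) then L.η₁ else 0 := by
      unfold topCredit
      rcases lt_trichotomy (i + L.k₁) (L.Q₁ + 1) with h1 | h1 | h1
      · rw [if_neg (by omega), if_neg (by omega), if_neg (by omega), sub_self]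
      · rw [if_pos (by omega), if_neg (by omega), if_pos (by omega), sub_zero]
      · rw [if_pos (by omega), if_pos (by omega), if_neg (by omega), sub_self]
    have hc : ((i - 1 : ℕ) : ℝ) = i - 1 := by rw [Nat.cast_sub hi0, Nat.cast_one]
    rw [relDiff_zero, diffCost, if_pos rfl, ← ht, diffStep, ← s0, ← s1, ← s2, ← s3]
    rw [hc] at e2
    linear_combination e1 - e2
  · have e1 := hh i hi (j - 1) (by omega)
    have e2 := hh i hi j hj
    rw [step, hk₂, Nat.sub_add_cancel hj0, min_eq_left hj] at e1
    rw [step, hk₂] at e2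
    have ht : L.topCredit i (j - 1) - L.topCredit i j
        = if (j = 0 ∧ i + L.k₁ = L.Q₁ + 1) ∨ (j = 1 ∧ L.Q₁ < i + L.k₁) then L.η₁ else 0 := by
      unfold topCredit
      by_cases h1 : j = 1 ∧ L.Q₁ < i + L.k₁
      · rw [if_pos (by omega), if_neg (by omega), if_pos (by omega), sub_zero]
      · rw [if_neg (by omega), if_neg (by omega), if_neg (by omega), sub_self]
    rw [relDiff_pos _ _ hj0, diffCost, if_neg hj0.ne', ← ht, diffStep,
      ← serve_sub_serve_battery_of_energy (thresholdPolicy m) lam h i hj0 hj,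
      ← serve_sub_serve_battery_of_energy (thresholdPolicy m) lam h (i + L.k₁) hj0 hj,
      ← serve_sub_serve_battery_of_no_energy hm lam h i hj0,
      ← serve_sub_serve_battery_of_no_energy hm lam h (i + L.k₁) hj0]
    linear_combination e1 - e2

/-- Comparison principle for the recursion of the differences: a subsolution `V` lies below a
supersolution `U`. -/
theorem le_of_diffStep (hL : L.Regular) {m : ℕ} (hm : m ≤ L.Q₁) {lam : ℝ} {C V U : ℕ → ℕ → ℝ}
    (hV : ∀ i j, L.IsPair i j → V i j ≤ C i j + L.diffStep m lam V i j)
    (hU : ∀ i j, L.IsPair i j → C i j + L.diffStep m lam U i j ≤ U i j) {i j : ℕ}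
    (hij : L.IsPair i j) : V i j ≤ U i j := by
  have hQ₂ := hL.Q₂_pos
  have hk := hL.k₁_pos
  have hμ := L.μ_sum
  have m1 := hL.μ₁_pos.le
  have m2 := hL.μ₂_pos.le
  have m3 := hL.μ₃_pos.le
  refine sub_nonneg.1 (nonneg_of_min_principle (fun i j => U i j - V i j) L.IsPair
    (fun i j => i + (L.Q₂ - j)) (L.Q₁ + L.Q₂) (fun i j h => ⟨by have := h.1; omega,
      by have := h.2.1; omega⟩) L.μ₀ hL.μ₀_pos ?_ i j hij)
  rintro M hM hlow i j ⟨hi, hj, hpos⟩ -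
  have hhold : ∀ x, i ≤ x → M ≤ L.holdNext m lam U x j - L.holdNext m lam V x j := by
    intro x hx
    unfold holdNext
    split_ifs <;> first
      | (rw [sub_self]; exact hM)
      | exact hlow _ _ ⟨by omega, by omega, by omega⟩
  have hsend : ∀ x, i ≤ x → M ≤ L.sendNext U x j - L.sendNext V x j := by
    intro x hx
    unfold sendNext
    split_ifs <;> first
      | (rw [sub_self]; exact hM)
      | exact hlow _ _ ⟨by omega, by omega, by omega⟩
  have e1 := hV i j ⟨hi, hj, hpos⟩
  have e2 := hU i j ⟨hi, hj, hpos⟩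
  have t1 := mul_le_mul_of_nonneg_left (hhold i le_rfl) m1
  have t2 := mul_le_mul_of_nonneg_left (hhold (i + L.k₁) (by omega)) m2
  have t3 := mul_le_mul_of_nonneg_left (hsend (i + L.k₁) (by omega)) m3
  have e3 : L.μ₁ * M + L.μ₂ * M + L.μ₃ * M = (1 - L.μ₀) * M := by rw [← hμ]; ring
  unfold diffStep at e1 e2
  have hfin : ∀ z, L.sendNext U i j - L.sendNext V i j = z →
      L.μ₀ * z + (1 - L.μ₀) * M ≤ U i j - V i j := by
    rintro z rfl
    linarith
  by_cases h0 : j = L.Q₂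
  · right
    have := hfin 0 (by unfold sendNext; rw [if_neg (by omega), if_pos h0, if_neg (by omega),
      if_pos h0, sub_self])
    linarith
  left
  by_cases hj0 : j = 0
  · by_cases h1 : i = 1
    · exact ⟨0, 1, ⟨by omega, by omega, by omega⟩, by omega, hfin _ (by
        unfold sendNext; rw [if_pos hj0, if_pos h1, if_pos hj0, if_pos h1])⟩
    · refine ⟨i - 1, 0, ⟨by omega, by omega, by omega⟩, by omega, hfin _ ?_⟩
      unfold sendNext
      rw [if_pos hj0, if_neg h1, if_pos (by omega), if_pos hj0, if_neg h1, if_pos (by omega)]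
  · by_cases h1 : i = 0
    · refine ⟨0, j + 1, ⟨by omega, by omega, by omega⟩, by omega, hfin _ ?_⟩
      unfold sendNext
      rw [if_neg hj0, if_neg h0, if_pos h1, if_neg hj0, if_neg h0, if_pos h1]
    · refine ⟨i - 1, j, ⟨by omega, by omega, by omega⟩, by omega, hfin _ ?_⟩
      unfold sendNext
      rw [if_neg hj0, if_neg h0, if_neg h1, if_neg hj0, if_neg h0, if_neg h1,
        min_eq_left (by omega)]

/-- When power is a reward, each difference of relative values is at least the price. -/
theorem le_relDiff_of_nonpos (hL : L.Regular) (hk₁ : 1 < L.k₁) (hk₂ : L.k₂ = 1) {m : ℕ}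
    (hm : m ≤ L.Q₁) {lam : ℝ} (hlam : lam ≤ 0) {h : ℕ → ℕ → ℝ} {G : ℝ}
    (hh : L.IsRelValue m 1 lam h G) {i : ℕ} (hi : 1 ≤ i) (hi' : i ≤ L.Q₁) :
    lam + 1 ≤ relDiff h i 0 := by
  have hμ := L.μ_sum
  have m0 := hL.μ₀_pos.le
  have m1 := hL.μ₁_pos.le
  have m2 := hL.μ₂_pos.le
  have m3 := hL.μ₃_pos.le
  have hcost : ∀ i j, (if j = 0 then (1 : ℝ) else 0) ≤ L.diffCost lam i j := by
    intro i j
    have : 0 ≤ -lam * if (j = 0 ∧ i + L.k₁ = L.Q₁ + 1) ∨ (j = 1 ∧ L.Q₁ < i + L.k₁)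
        then L.η₁ else 0 :=
      mul_nonneg (by linarith) (by split_ifs; exacts [hL.η₁_pos.le, le_rfl])
    unfold diffCost
    linarith
  have hstep : ∀ V : ℕ → ℕ → ℝ, (∀ i j, L.IsPair i j → lam ≤ V i j) → ∀ i j, L.IsPair i j →
      lam ≤ L.diffStep m lam V i j := by
    rintro V hV i j ⟨hi, hj, hpos⟩
    have hk := hL.k₁_pos
    have hQ₂ := hL.Q₂_pos
    have hhold : ∀ x, i ≤ x → lam ≤ L.holdNext m lam V x j := by
      intro x hx
      unfold holdNext
      split_ifs <;> first
        | exact hlam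
        | exact le_rfl
        | exact hV _ _ ⟨by omega, by omega, by omega⟩
    have hsend : ∀ x, i ≤ x → lam ≤ L.sendNext V x j := by
      intro x hx
      unfold sendNext
      split_ifs <;> first
        | exact hlam
        | exact hV _ _ ⟨by omega, by omega, by omega⟩
    have t0 := mul_le_mul_of_nonneg_left (hsend i le_rfl) m0
    have t1 := mul_le_mul_of_nonneg_left (hhold i le_rfl) m1
    have t2 := mul_le_mul_of_nonneg_left (hhold (i + L.k₁) (by omega)) m2
    have t3 := mul_le_mul_of_nonneg_left (hsend (i + L.k₁) (by omega)) m3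
    have e3 : L.μ₀ * lam + L.μ₁ * lam + L.μ₂ * lam + L.μ₃ * lam = lam := by
      rw [← add_mul, ← add_mul, ← add_mul, hμ, one_mul]
    unfold diffStep
    linarith
  have hle : ∀ i j, L.IsPair i j → lam ≤ relDiff h i j := fun i j hij =>
    le_of_diffStep hL hm (C := L.diffCost lam) (V := fun _ _ => lam) (fun i j hij => by
      have h1 := hstep (fun _ _ => lam) (fun _ _ _ => le_rfl) i j hij
      have h2 := hcost i j
      have h3 : (0 : ℝ) ≤ if j = 0 then 1 else 0 := by split_ifs <;> norm_num
      linarith) (fun i j hij => (relDiff_eq hL hk₁ hk₂ hm hh hij).ge) hij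
  have hp : L.IsPair i 0 := ⟨hi', Nat.zero_le _, by omega⟩
  have h1 := hcost i 0
  rw [if_pos rfl] at h1
  linarith [relDiff_eq hL hk₁ hk₂ hm hh hp, hstep _ hle i 0 hp]

/-! ### Batch data arrivals: a bound on the price of power -/

/-- A bound, independent of the capacity `Q₁`, on the price of power for which a threshold
`m ≤ m₀` is optimal. -/
def priceBound (L : Link) (m₀ : ℕ) : ℝ :=
  (1 / (1 - L.k₁ * L.η₁) * m₀
    + (1 + 1 / (1 - L.k₁ * L.η₁) * L.k₁) / (L.μ₀ / 2) ^ (m₀ + L.Q₂ + 1))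
    / (L.μ₀ / 2) ^ (m₀ + L.Q₂ + 1)

/-- The differences of relative values have a supersolution of the form
`c i + (K + lam) (1 - (μ₀ / 2) ^ d)`, where `d = i + Q₂ + 1 - j` bounds the number of slots with
energy but no data arrivals after which the two neighbouring states coincide. -/
theorem lam_le_priceBound (hL : L.Regular) (hk₁ : 1 < L.k₁) (hk₂ : L.k₂ = 1)
    (hstab : L.k₁ * L.η₁ < 1) {m m₀ : ℕ} (hm1 : 1 ≤ m) (hm₀ : m ≤ m₀) (hm : m ≤ L.Q₁) {lam : ℝ}
    (hlam : 0 ≤ lam) {h : ℕ → ℕ → ℝ} {G : ℝ} (hh : L.IsRelValue m 1 lam h G)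
    (htie : relDiff h m 0 = lam) : lam ≤ L.priceBound m₀ := by
  have hδ : 0 < 1 - L.k₁ * L.η₁ := by linarith
  have hQ₂ := hL.Q₂_pos
  have hμs := L.μ_sum
  have m0 := hL.μ₀_pos
  have m1 := hL.μ₁_pos.le
  have m2 := hL.μ₂_pos.le
  have m3 := hL.μ₃_pos.le
  have h23 : L.μ₂ + L.μ₃ = L.η₁ := by unfold μ₂ μ₃; ring
  unfold priceBound
  set c := 1 / (1 - L.k₁ * L.η₁) with hc
  set μ := L.μ₀ / 2 with hμ
  set D := m₀ + L.Q₂ + 1 with hD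
  set K := (1 + c * L.k₁) / μ ^ D with hK
  have hc0 : 0 < c := by positivity
  have hcδ : c * (1 - L.k₁ * L.η₁) = 1 := by rw [hc]; field_simp
  have hμ0 : 0 < μ := by positivity
  have hμ1 : μ ≤ 1 := by linarith
  have hK0 : 0 < K := by positivity
  have hKD : ∀ d ≤ D, 1 + c * L.k₁ ≤ K * μ ^ d := by
    intro d hd
    have h1 : K * μ ^ D = 1 + c * L.k₁ := by rw [hK]; field_simp
    have h2 := mul_le_mul_of_nonneg_left (pow_le_pow_of_le_one hμ0.le hμ1 hd) hK0.le
    linarith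
  set R := K + lam with hR
  have hR0 : 0 < R := by positivity
  set S : ℕ → ℕ → ℝ := fun i j => c * i + R * (1 - μ ^ (i + L.Q₂ + 1 - j)) with hS
  have hSle : ∀ i j, S i j ≤ c * i + R := by
    intro i j
    have := mul_pos hR0 (pow_pos hμ0 (i + L.Q₂ + 1 - j))
    simp only [hS]
    linarith
  have hcx : ∀ x : ℕ, 0 ≤ c * (x : ℝ) := fun x => by positivity
  have hcle : ∀ x y : ℕ, x ≤ y → c * (x : ℝ) ≤ c * (y : ℝ) := fun x y hxy =>
    mul_le_mul_of_nonneg_left (by exact_mod_cast hxy) hc0.le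
  have hsend : ∀ x j, L.sendNext S x j ≤ c * ((x - 1 : ℕ) : ℝ) + R := by
    intro x j
    unfold sendNext
    split_ifs
    · linarith [hSle 0 1, hcle 0 (x - 1) (Nat.zero_le _)]
    · exact hSle _ _
    · linarith [hcx (x - 1)]
    · linarith [hcx (x - 1)]
    · linarith [hSle 0 (j + 1), hcle 0 (x - 1) (Nat.zero_le _)]
    · linarith [hSle (min (x - 1) L.Q₁) j, hcle _ _ (min_le_left (x - 1) L.Q₁)]
  have hhold : ∀ x j, m < x → L.holdNext m lam S x j ≤ c * ((x - 1 : ℕ) : ℝ) + R := by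
    intro x j hx
    unfold holdNext
    split_ifs <;> first
      | omega
      | linarith [hcx (x - 1)]
      | exact hSle _ _
      | linarith [hSle (min (x - 1) L.Q₁) (j - 1), hcle _ _ (min_le_left (x - 1) L.Q₁)]
  have hhold' : ∀ x j, L.holdNext m lam S x j ≤ c * (x : ℝ) + R := by
    intro x j
    rcases Nat.lt_or_ge m x with hx | hx
    · linarith [hhold x j hx, hcle (x - 1) x (Nat.sub_le _ _)]
    · unfold holdNext
      split_ifs <;> first
        | omega
        | exact hSle _ _
        | linarith [hSle 0 j, hcle 0 x (Nat.zero_le _)]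
        | linarith [hSle (min (x - 1) L.Q₁) (j - 1), hcle (min (x - 1) L.Q₁) x (by omega)]
  -- the slots with energy but no data arrivals bring the two states closer
  have hdown : ∀ i j, L.IsPair i j →
      L.sendNext S i j ≤ c * ((i - 1 : ℕ) : ℝ) + R - 2 * (R * μ ^ (i + L.Q₂ + 1 - j)) / L.μ₀ := by
    rintro i j ⟨hi, hj, hpos⟩
    have hpow : 2 * (R * μ ^ (i + L.Q₂ + 1 - j)) / L.μ₀ = R * μ ^ (i + L.Q₂ - j) := by
      rw [show i + L.Q₂ + 1 - j = i + L.Q₂ - j + 1 by omega, pow_succ, hμ]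
      field_simp
    have hle : ∀ d ≤ i + L.Q₂ - j, R * μ ^ (i + L.Q₂ - j) ≤ R * μ ^ d := fun d hd =>
      mul_le_mul_of_nonneg_left (pow_le_pow_of_le_one hμ0.le hμ1 hd) hR0.le
    rw [hpow]
    unfold sendNext
    split_ifs with h1 h2 h3 h4 h5
    · have := hle (0 + L.Q₂ + 1 - 1) (by omega)
      have := hcle 0 (i - 1) (Nat.zero_le _)
      simp only [hS]
      linarith
    · have := hle (i - 1 + L.Q₂ + 1 - 0) (by omega)
      simp only [hS]
      linarith
    · omega
    · have := hle 0 (Nat.zero_le _)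
      have := hcx (i - 1)
      rw [pow_zero] at *
      linarith
    · have := hle (0 + L.Q₂ + 1 - (j + 1)) (by omega)
      have := hcle 0 (i - 1) (Nat.zero_le _)
      simp only [hS]
      linarith
    · have := hle (min (i - 1) L.Q₁ + L.Q₂ + 1 - j) (by omega)
      have := hcle _ _ (min_le_left (i - 1) L.Q₁)
      simp only [hS]
      linarith
  have hsup : ∀ i j, L.IsPair i j → L.diffCost lam i j + L.diffStep m lam S i j ≤ S i j := by
    rintro i j hp
    have hcost : L.diffCost lam i j ≤ 1 := by
      have h1 : 0 ≤ lam * if (j = 0 ∧ i + L.k₁ = L.Q₁ + 1) ∨ (j = 1 ∧ L.Q₁ < i + L.k₁)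
          then L.η₁ else 0 := mul_nonneg hlam (by split_ifs; exacts [hL.η₁_pos.le, le_rfl])
      have h2 : (if j = 0 then (1 : ℝ) else 0) ≤ 1 := by split_ifs <;> norm_num
      unfold diffCost
      linarith
    have t0 := mul_le_mul_of_nonneg_left (hdown i j hp) m0.le
    have e0 : L.μ₀ * (c * ((i - 1 : ℕ) : ℝ) + R - 2 * (R * μ ^ (i + L.Q₂ + 1 - j)) / L.μ₀)
        = L.μ₀ * (c * ((i - 1 : ℕ) : ℝ) + R) - 2 * (R * μ ^ (i + L.Q₂ + 1 - j)) := by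
      field_simp
    rw [e0] at t0
    have hRd := mul_pos hR0 (pow_pos hμ0 (i + L.Q₂ + 1 - j))
    have t3 := mul_le_mul_of_nonneg_left (hsend (i + L.k₁) j) m3
    simp only [hS]
    unfold diffStep
    rcases Nat.lt_or_ge m i with hi | hi
    · have t1 := mul_le_mul_of_nonneg_left (hhold i j hi) m1
      have t2 := mul_le_mul_of_nonneg_left (hhold (i + L.k₁) j (by omega)) m2
      have e1 : ((i - 1 : ℕ) : ℝ) = i - 1 := by rw [Nat.cast_sub (by omega), Nat.cast_one]
      have e2 : ((i + L.k₁ - 1 : ℕ) : ℝ) = i + L.k₁ - 1 := by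
        rw [Nat.cast_sub (by omega), Nat.cast_add, Nat.cast_one]
      rw [e1] at t0 t1
      rw [e2] at t2 t3
      have : L.μ₀ * (c * (i - 1) + R) + L.μ₁ * (c * (i - 1) + R)
          + L.μ₂ * (c * (i + L.k₁ - 1) + R) + L.μ₃ * (c * (i + L.k₁ - 1) + R)
          = c * i + R - c * (1 - L.k₁ * L.η₁) := by
        rw [← h23]
        linear_combination (c * (i - 1) + R) * hμs
      rw [hcδ] at this
      linarith
    · have t1 := mul_le_mul_of_nonneg_left (hhold' i j) m1
      have t2 := mul_le_mul_of_nonneg_left (hhold' (i + L.k₁) j) m2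
      have t0' := mul_le_mul_of_nonneg_left (hcle (i - 1) i (Nat.sub_le _ _)) m0.le
      have t3' := mul_le_mul_of_nonneg_left (hcle (i + L.k₁ - 1) (i + L.k₁) (Nat.sub_le _ _)) m3
      have hd := hKD (i + L.Q₂ + 1 - j) (by omega)
      have hd' := mul_nonneg hlam (pow_pos hμ0 (i + L.Q₂ + 1 - j)).le
      have e3 : R * μ ^ (i + L.Q₂ + 1 - j)
          = K * μ ^ (i + L.Q₂ + 1 - j) + lam * μ ^ (i + L.Q₂ + 1 - j) := by rw [hR]; ring
      rw [Nat.cast_add] at t2 t3'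
      have : L.μ₀ * (c * i + R) + L.μ₁ * (c * i + R) + L.μ₂ * (c * (i + L.k₁) + R)
          + L.μ₃ * (c * (i + L.k₁) + R) = c * i + R + L.η₁ * (c * L.k₁) := by
        rw [← h23]
        linear_combination (c * i + R) * hμs
      have h4 := mul_le_mul_of_nonneg_right hL.η₁_lt.le (hcx L.k₁)
      linarith
  have hp : L.IsPair m 0 := ⟨hm, Nat.zero_le _, by omega⟩
  have hle := le_of_diffStep hL hm (C := L.diffCost lam)
    (fun i j hij => (relDiff_eq hL hk₁ hk₂ hm hh hij).le) hsup hp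
  rw [htie] at hle
  simp only [hS, Nat.sub_zero] at hle
  rw [le_div_iff₀ (by positivity)]
  have h1 := mul_le_mul_of_nonneg_left
    (pow_le_pow_of_le_one hμ0.le hμ1 (show m + L.Q₂ + 1 ≤ D by omega)) hlam
  have h2 := mul_pos hK0 (pow_pos hμ0 (m + L.Q₂ + 1))
  have h3 := hcle m m₀ hm₀
  have h4 : R * (1 - μ ^ (m + L.Q₂ + 1))
      = K + lam - K * μ ^ (m + L.Q₂ + 1) - lam * μ ^ (m + L.Q₂ + 1) := by rw [hR]; ring
  linarith

/-! ### Batch data arrivals: a recursion with drift -/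

/-- The number `z = 1 + (1 - k η) / k` solves the characteristic inequality
`(1 - η) + η z ^ k ≤ z` of a recursion with downward drift, by Bernoulli's inequality. -/
theorem one_sub_add_mul_pow_le {η : ℝ} (hη : 0 < η) {k : ℕ} (hk : 1 ≤ k) (hkη : k * η < 1) :
    (1 - η) + η * (1 + (1 - k * η) / k) ^ k ≤ 1 + (1 - k * η) / k := by
  have hk0 : (0 : ℝ) < k := by exact_mod_cast hk
  have hk1 : (1 : ℝ) ≤ k := by exact_mod_cast hk
  have hkη0 : 0 < k * η := by positivity
  set ε := (1 - k * η) / k with hε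
  have hε0 : 0 < ε := div_pos (by linarith) hk0
  have hkε : k * ε = 1 - k * η := by rw [hε]; field_simp
  have hε1 : ε ≤ 1 := by nlinarith
  have h1 : 1 - k * ε ≤ (1 - ε) ^ k := by
    have := one_add_mul_le_pow (show (-2 : ℝ) ≤ -ε by linarith) k
    calc 1 - k * ε = 1 + k * (-ε) := by ring
      _ ≤ (1 + -ε) ^ k := this
      _ = (1 - ε) ^ k := by rw [← sub_eq_add_neg]
  have h2 : (1 - ε) ^ k * (1 + ε) ^ k ≤ 1 := by
    rw [← mul_pow]
    exact pow_le_one₀ (mul_nonneg (by linarith) (by linarith)) (by nlinarith)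
  have h3 : (k * η) * (1 + ε) ^ k ≤ 1 := by
    have := mul_le_mul_of_nonneg_right h1 (pow_nonneg (show 0 ≤ 1 + ε by linarith) k)
    rw [hkε] at this
    linarith
  have h4 : η * (1 + ε) ^ k ≤ 1 / k := by
    rw [le_div_iff₀ hk0]
    linarith
  have h5 : ε = 1 / k - η := by rw [hε]; field_simp
  linarith

/-- Subsolutions of a recursion with upward forcing `1` and downward drift: the sum of a linear
function and of a negative multiple of a growing power. -/
theorem exists_subsolution {η : ℝ} (hη0 : 0 < η) (hη1 : η < 1) {k : ℕ} (hk : 1 ≤ k)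
    (hkη : k * η < 1) {Λ R : ℝ} (hΛ : 0 ≤ Λ) (hR0 : 0 ≤ R) :
    ∃ N : ℕ, ∀ m Q : ℕ, m + N ≤ Q → ∃ f : ℕ → ℝ, f m ≤ 0 ∧
      (∀ i, 1 ≤ i → f i ≤ 1 + (1 - η) * f (i - 1) + η * f (i + k - 1)) ∧
      (∀ i, Q ≤ i → f i ≤ -(2 * Λ)) ∧ ∀ i, i < Q → Q ≤ i + k → R ≤ f i := by
  have hk0 : (0 : ℝ) < k := by exact_mod_cast (hk)
  set δ := 1 - k * η with hδ
  have hδ0 : 0 < δ := by linarith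
  set z := 1 + δ / k with hz
  have hchar : (1 - η) + η * z ^ k ≤ z := one_sub_add_mul_pow_le hη0 hk hkη
  have hε0 : 0 < z - 1 := by rw [hz, add_sub_cancel_left]; positivity
  have hz1 : 1 ≤ z := by linarith
  have hz0 : 0 < z := by linarith
  -- the size of `Q - m` that makes the linear part dominate before `Q` and the power beyond
  obtain ⟨N, hN⟩ := exists_nat_ge ((k * z + 2 * Λ * δ + R * z * δ + 1) / (z - 1))
  refine ⟨N, fun m Q hQ => ?_⟩
  rw [div_le_iff₀ hε0] at hN
  set M : ℝ := Q - m with hM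
  have hMN : (N : ℝ) ≤ M := by
    have : (m : ℝ) + N ≤ Q := by exact_mod_cast hQ
    linarith
  have hMε : k * z + 2 * Λ * δ + R * z * δ + 1 ≤ M * (z - 1) :=
    hN.trans (mul_le_mul_of_nonneg_right hMN hε0.le)
  have hM0 : 0 ≤ M := (Nat.cast_nonneg N).trans hMN
  set B := M / δ + 2 * Λ with hB
  have hB0 : 0 ≤ B := by positivity
  set b := B / z ^ Q with hb
  have hb0 : 0 ≤ b := by positivity
  have hbQ : b * z ^ Q = B := by rw [hb]; field_simp
  set f : ℕ → ℝ := fun i => ((i : ℝ) - m) / δ - b * z ^ i with hf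
  have F1 : ∀ i, 1 ≤ i → f i ≤ 1 + (1 - η) * f (i - 1) + η * f (i + k - 1) := by
    intro i hi
    obtain ⟨n, rfl⟩ : ∃ n, i = n + 1 := ⟨i - 1, by omega⟩
    have e : n + 1 + k - 1 = n + k := by omega
    simp only [hf, e, Nat.add_sub_cancel]
    have h1 := mul_le_mul_of_nonneg_left hchar (mul_nonneg hb0 (pow_nonneg hz0.le n))
    have h2 : ((n : ℝ) + 1 - m) / δ = 1 + (1 - η) * ((n - m) / δ) + η * ((n + k - m) / δ) := by
      field_simp
      rw [hδ]
      ring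
    push_cast
    rw [h2, pow_succ, pow_add]
    linarith
  have F2 : ∀ i, Q ≤ i → f i ≤ -(2 * Λ) := by
    intro i hi
    obtain ⟨t, rfl⟩ : ∃ t, i = Q + t := ⟨i - Q, by omega⟩
    have h1 : 1 + t * (z - 1) ≤ z ^ t := by
      have := one_add_mul_le_pow (show (-2 : ℝ) ≤ z - 1 by linarith) t
      rwa [show 1 + (z - 1) = z by ring] at this
    have h2 := mul_le_mul_of_nonneg_left h1 hB0
    have h3 : 1 / δ ≤ B * (z - 1) := by
      have h4 : 1 ≤ M * (z - 1) := by
        have : 0 ≤ k * z + 2 * Λ * δ + R * z * δ := by positivity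
        linarith
      have h5 : 1 / δ ≤ M * (z - 1) / δ := div_le_div_of_nonneg_right h4 hδ0.le
      have h6 : 0 ≤ 2 * Λ * (z - 1) := by positivity
      have h7 : B * (z - 1) = M * (z - 1) / δ + 2 * Λ * (z - 1) := by rw [hB]; ring
      linarith
    have h8 := mul_le_mul_of_nonneg_left h3 (Nat.cast_nonneg (α := ℝ) t)
    have h9 : (((Q + t : ℕ) : ℝ) - m) / δ = M / δ + t * (1 / δ) := by
      push_cast; rw [hM]; ring
    simp only [hf]
    rw [h9, pow_add, ← mul_assoc, hbQ]
    linarith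
  have F3 : ∀ i, i < Q → Q ≤ i + k → R ≤ f i := by
    intro i hi hik
    have h1 : b * z ^ i * z ≤ B := by
      rw [← hbQ, mul_assoc, ← pow_succ]
      exact mul_le_mul_of_nonneg_left (pow_le_pow_right₀ hz1 hi) hb0
    have h2 : M - k ≤ (i : ℝ) - m := by
      have : (Q : ℝ) ≤ i + k := by exact_mod_cast hik
      linarith
    have h3 : (M - k) * z - (M + 2 * Λ * δ) ≤ f i * (z * δ) := by
      have h4 : f i * (z * δ) = (i - m) * z - b * z ^ i * z * δ := by
        simp only [hf]; field_simp
      have h5 : B * δ = M + 2 * Λ * δ := by rw [hB]; field_simp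
      have h6 := mul_le_mul_of_nonneg_right h1 hδ0.le
      have h7 := mul_le_mul_of_nonneg_right h2 hz0.le
      linarith
    have h8 : R * (z * δ) ≤ f i * (z * δ) := by linarith
    exact le_of_mul_le_mul_right h8 (by positivity)
  have F4 : f m ≤ 0 := by
    simp only [hf, sub_self, zero_div, zero_sub]
    exact neg_nonpos.2 (by positivity)
  exact ⟨f, F4, F1, F2, F3⟩

/-- A recursion with upward forcing `1` and downward drift, started from `0`, stays positive up to
a boundary `Q`, where it may be pushed down by a bounded amount `lam`, if `Q` is large. -/
theorem pos_of_recursion {η : ℝ} (hη0 : 0 < η) (hη1 : η < 1) {k : ℕ} (hk : 2 ≤ k) (hkη : k * η < 1)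
    {Λ : ℝ} (hΛ : 0 ≤ Λ) :
    ∃ N : ℕ, ∀ (m Q : ℕ) (lam : ℝ) (ω : ℕ → ℝ), m + N ≤ Q → 0 ≤ lam → lam ≤ Λ → ω m = 0 →
      (∀ i, m < i → i ≤ Q → ω i = 1 + (1 - η) * ω (i - 1) + η * (if i + k ≤ Q then ω (i + k - 1)
        else if i + k = Q + 1 then ω Q - lam else -lam)) →
      ∀ i, m < i → i ≤ Q → 0 < ω i := by
  have hη1' : 0 < 1 - η := by linarith
  set R := Λ / (1 - η) with hR
  have hR0 : 0 ≤ R := by positivity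
  have hRΛ : (1 - η) * R = Λ := by rw [hR]; field_simp
  obtain ⟨N, hN⟩ := exists_subsolution hη0 hη1 (by omega) hkη hΛ hR0
  refine ⟨N + k + 1, fun m Q lam ω hQ hlam hlamΛ hωm H => ?_⟩
  obtain ⟨f, F4, F1, F2, F3⟩ := hN m Q (by omega)
  -- comparison with the subsolution
  have hcmp := nonneg_of_min_principle (fun i _ => ω i - f i) (fun i j => m < i ∧ i < Q ∧ j = 0)
    (fun i _ => i) Q (fun i j h => ⟨by omega, by omega⟩) (1 - η) hη1' ?_
  swap
  · rintro M' hM' hlow i j ⟨hi, hiQ, rfl⟩ -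
    have hX : M' ≤ (if i + k ≤ Q then ω (i + k - 1)
        else if i + k = Q + 1 then ω Q - lam else -lam) - f (i + k - 1) := by
      split_ifs with h1 h2
      · exact hlow (i + k - 1) 0 ⟨by omega, by omega, rfl⟩
      · have h3 := hlow (Q - 1) 0 ⟨by omega, by omega, rfl⟩
        have h4 := F3 (Q - 1) (by omega) (by omega)
        have h5 := F2 (i + k - 1) (by omega)
        have h6 := H Q (by omega) le_rfl
        rw [if_neg (by omega), if_neg (by omega)] at h6
        have h7 : (1 - η) * M' ≤ (1 - η) * ω (Q - 1) :=
          mul_le_mul_of_nonneg_left (by linarith) hη1'.le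
        have h8 : η * lam ≤ lam := by nlinarith
        nlinarith
      · have h5 := F2 (i + k - 1) (by omega)
        linarith
    have h1 := H i hi hiQ.le
    have h2 := F1 i (by omega)
    have h3 := mul_le_mul_of_nonneg_left hX hη0.le
    by_cases h4 : i - 1 = m
    · right
      rw [h4, hωm] at h1
      rw [h4] at h2
      have := mul_nonneg hη1'.le (neg_nonneg.2 F4)
      linarith
    · left
      exact ⟨i - 1, 0, ⟨by omega, by omega, rfl⟩, by omega, by linarith⟩
  have hupper : ∀ i, m < i → i < Q → Q ≤ i + k → R ≤ ω i := fun i hi hiQ hik => by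
    have := hcmp i 0 ⟨hi, hiQ, rfl⟩
    linarith [F3 i hiQ hik]
  -- positivity away from the boundary
  have hnonneg := nonneg_of_min_principle (fun i _ => ω i) (fun i j => m < i ∧ i < Q ∧ j = 0)
    (fun i _ => i) Q (fun i j h => ⟨by omega, by omega⟩) (1 - η) hη1' ?_
  swap
  · rintro M' hM' hlow i j ⟨hi, hiQ, rfl⟩ hneg
    have hik : i + k ≤ Q := by
      by_contra hcon
      linarith [hupper i hi hiQ (by omega)]
    have h1 := H i hi hiQ.le
    rw [if_pos hik] at h1
    have h3 := mul_le_mul_of_nonneg_left (hlow (i + k - 1) 0 ⟨by omega, by omega, rfl⟩) hη0.le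
    by_cases h4 : i - 1 = m
    · right
      rw [h4, hωm] at h1
      linarith
    · left
      exact ⟨i - 1, 0, ⟨by omega, by omega, rfl⟩, by omega, by linarith⟩
  have hnonneg' : ∀ i, m ≤ i → i < Q → 0 ≤ ω i := by
    intro i hi hiQ
    rcases hi.eq_or_lt with rfl | hi
    · exact hωm.ge
    · exact hnonneg i 0 ⟨hi, hiQ, rfl⟩
  have hηlam : η * lam ≤ Λ := by nlinarith
  have hhigh : ∀ i, m < i → i ≤ Q → Q < i + k → Λ ≤ (1 - η) * ω (i - 1) := by
    intro i hi hiQ hik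
    rw [← hRΛ]
    exact mul_le_mul_of_nonneg_left (hupper (i - 1) (by omega) (by omega) (by omega)) hη1'.le
  have hQpos : 0 < ω Q := by
    have h1 := H Q (by omega) le_rfl
    rw [if_neg (by omega), if_neg (by omega)] at h1
    linarith [hhigh Q (by omega) le_rfl (by omega)]
  intro i hi hiQ
  have h1 := H i hi hiQ
  by_cases hik : i + k ≤ Q
  · rw [if_pos hik] at h1
    have := mul_nonneg hη0.le (hnonneg' (i + k - 1) (by omega) (by omega))
    linarith [mul_nonneg hη1'.le (hnonneg' (i - 1) (by omega) (by omega))]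
  · have h4 := hhigh i hi hiQ (by omega)
    rw [if_neg hik] at h1
    split_ifs at h1
    · linarith [mul_pos hη0 hQpos]
    · linarith

/-! ### Batch data arrivals: convexity of relative values at the threshold -/

/-- Above the threshold, battery levels do not enter the recursion of the differences. -/
theorem relDiff_eq_above (hL : L.Regular) (hk₁ : 1 < L.k₁) (hk₂ : L.k₂ = 1) {m : ℕ}
    (hm1 : 1 ≤ m) (hm : m ≤ L.Q₁) {lam : ℝ} {h : ℕ → ℕ → ℝ} {G : ℝ}
    (hh : L.IsRelValue m 1 lam h G) (htie : relDiff h m 0 = lam) {i : ℕ} (hi : m < i)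
    (hi' : i ≤ L.Q₁) :
    relDiff h i 0 - lam = 1 + (1 - L.η₁) * (relDiff h (i - 1) 0 - lam)
      + L.η₁ * (if i + L.k₁ ≤ L.Q₁ then relDiff h (i + L.k₁ - 1) 0 - lam
        else if i + L.k₁ = L.Q₁ + 1 then relDiff h L.Q₁ 0 - lam - lam else -lam) := by
  have h01 : L.μ₀ + L.μ₁ = 1 - L.η₁ := by unfold μ₀ μ₁; ring
  have h23 : L.μ₂ + L.μ₃ = L.η₁ := by unfold μ₂ μ₃; ring
  have e := relDiff_eq hL hk₁ hk₂ hm hh (⟨hi', Nat.zero_le _, by omega⟩ : L.IsPair i 0)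
  have s0 : L.sendNext (relDiff h) i 0 = relDiff h (i - 1) 0 := by
    rw [sendNext, if_pos rfl, if_neg (by omega), if_pos (by omega)]
  have s1 : L.holdNext m lam (relDiff h) i 0 = relDiff h (i - 1) 0 := by
    rw [holdNext, if_pos rfl, if_neg (by omega)]
    split_ifs with h1 h2
    · rw [h1, Nat.add_sub_cancel, htie]
    · rfl
    · omega
  have s2 : L.holdNext m lam (relDiff h) (i + L.k₁) 0
      = if i + L.k₁ ≤ L.Q₁ + 1 then relDiff h (i + L.k₁ - 1) 0 else 0 := by
    rw [holdNext, if_pos rfl, if_neg (by omega), if_neg (by omega)]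
  have s3 : L.sendNext (relDiff h) (i + L.k₁) 0
      = if i + L.k₁ ≤ L.Q₁ + 1 then relDiff h (i + L.k₁ - 1) 0 else 0 := by
    rw [sendNext, if_pos rfl, if_neg (by omega)]
  rw [diffStep, s0, s1, s2, s3, diffCost, if_pos rfl] at e
  rw [e, ← h01, ← h23]
  have hμ := L.μ_sum
  rcases lt_trichotomy (i + L.k₁) (L.Q₁ + 1) with h1 | h1 | h1
  · rw [if_neg (by omega), if_pos (by omega), if_pos (by omega)]
    linear_combination lam * hμ
  · have e1 : i + L.k₁ - 1 = L.Q₁ := by omega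
    rw [if_pos (Or.inl ⟨rfl, h1⟩), if_pos (by omega), if_neg (by omega), if_pos h1, e1]
    linear_combination lam * hμ
  · rw [if_neg (by omega), if_neg (by omega), if_neg (by omega), if_neg (by omega)]
    linear_combination lam * hμ

/-- Below the threshold, the differences of relative values increase as long as they stay below the
price. -/
theorem relDiff_lt_below (hL : L.Regular) (hk₁ : 1 < L.k₁) (hk₂ : L.k₂ = 1) {m : ℕ}
    (hm : m + L.k₁ ≤ L.Q₁) {lam : ℝ} {h : ℕ → ℕ → ℝ} {G : ℝ}
    (hh : L.IsRelValue m 1 lam h G) (htie : relDiff h m 0 = lam)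
    (habove : ∀ i, m < i → i ≤ L.Q₁ → lam < relDiff h i 0) :
    ∀ d i, 1 ≤ i → i + d = m →
      (∀ i', i ≤ i' → i' ≤ L.Q₁ → relDiff h i 0 ≤ relDiff h i' 0) ∧
        (1 ≤ d → relDiff h i 0 < lam) := by
  have hμ := L.μ_sum
  have m0 := hL.μ₀_pos
  have m2 := hL.μ₂_pos.le
  have m3 := hL.μ₃_pos.le
  intro d
  induction d with
  | zero =>
    intro i hi him
    rw [add_zero] at him
    subst him
    refine ⟨fun i' h1 h2 => ?_, fun h1 => absurd h1 (by omega)⟩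
    rcases h1.eq_or_lt with rfl | h1
    · exact le_rfl
    · rw [htie]; exact (habove i' h1 h2).le
  | succ d ih =>
    intro i hi him
    obtain ⟨hle, hlt⟩ := ih (i + 1) (by omega) (by omega)
    have hlam : relDiff h (i + 1) 0 ≤ lam := htie ▸ hle m (by omega) (by omega)
    have e := relDiff_eq hL hk₁ hk₂ (by omega) hh
      (⟨by omega, Nat.zero_le _, by omega⟩ : L.IsPair (i + 1) 0)
    have s0 : L.sendNext (relDiff h) (i + 1) 0 = relDiff h i 0 := by
      rw [sendNext, if_pos rfl, if_neg (by omega), if_pos (by omega), Nat.add_sub_cancel]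
    have s1 : L.holdNext m lam (relDiff h) (i + 1) 0 = relDiff h (i + 1) 0 := by
      rw [holdNext, if_pos rfl, if_pos (by omega)]
    have s2 : relDiff h (i + 1) 0 ≤ L.holdNext m lam (relDiff h) (i + 1 + L.k₁) 0 := by
      rw [holdNext, if_pos rfl]
      split_ifs
      · exact hle _ (by omega) (by omega)
      · exact hlam
      · exact hle _ (by omega) (by omega)
      · omega
    have s3 : relDiff h (i + 1) 0 ≤ L.sendNext (relDiff h) (i + 1 + L.k₁) 0 := by
      rw [sendNext, if_pos rfl, if_neg (by omega), if_pos (by omega)]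
      exact hle _ (by omega) (by omega)
    rw [diffStep, s0, s1, diffCost, if_pos rfl, if_neg (by omega)] at e
    have t2 := mul_le_mul_of_nonneg_left s2 m2
    have t3 := mul_le_mul_of_nonneg_left s3 m3
    have key : relDiff h i 0 < relDiff h (i + 1) 0 := by
      have e1 : relDiff h (i + 1) 0 = L.μ₀ * relDiff h (i + 1) 0 + L.μ₁ * relDiff h (i + 1) 0
          + L.μ₂ * relDiff h (i + 1) 0 + L.μ₃ * relDiff h (i + 1) 0 := by
        rw [← add_mul, ← add_mul, ← add_mul, hμ, one_mul]
      have e2 : L.μ₀ * relDiff h i 0 < L.μ₀ * relDiff h (i + 1) 0 := by linarith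
      exact lt_of_mul_lt_mul_left e2 m0.le
    refine ⟨fun i' h1 h2 => ?_, fun _ => key.trans_le hlam⟩
    rcases h1.eq_or_lt with rfl | h1
    · exact le_rfl
    · exact key.le.trans (hle i' h1 h2)

/-- With batch data arrivals, an additional packet in the queue has a positive cost when power is
free. -/
theorem gap_pos_of_batch (hL : L.Regular) (hk₁ : 1 < L.k₁) (hk₂ : L.k₂ = 1) {h : ℕ → ℕ → ℝ}
    {G : ℝ} (hh : L.IsRelValue 0 1 0 h G) {i : ℕ} (hi : 1 ≤ i) (hi' : i ≤ L.Q₁) :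
    0 < h i 0 - h (i - 1) 0 := by
  rw [← relDiff_zero]
  linarith [le_relDiff_of_nonpos hL hk₁ hk₂ (Nat.zero_le _) le_rfl hh hi hi']

/-- With batch data arrivals and a large queue, the price of power for which a small threshold `m`
is optimal separates the gains from sending below and above the threshold. -/
theorem exists_price_of_batch (hL : L.Regular) (hk₁ : 1 < L.k₁) (hk₂ : L.k₂ = 1)
    (hstab : L.k₁ * L.η₁ < 1) (m₀ : ℕ) :
    ∃ N : ℕ, ∀ Q, N ≤ Q → ∀ m, 1 ≤ m → m ≤ m₀ → ∀ lam h G,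
      ({ L with Q₁ := Q } : Link).IsRelValue m 1 lam h G → h m 0 - h (m - 1) 0 = lam →
        0 ≤ lam ∧ (∀ i, 1 ≤ i → i < m → h i 0 - h (i - 1) 0 < lam) ∧
          ∀ i, m < i → i ≤ Q → lam < h i 0 - h (i - 1) 0 := by
  have hΛ : 0 ≤ L.priceBound m₀ := by
    have hδ : 0 < 1 - L.k₁ * L.η₁ := by linarith
    have := hL.μ₀_pos
    unfold priceBound
    positivity
  obtain ⟨N, hN⟩ := pos_of_recursion hL.η₁_pos hL.η₁_lt hk₁ hstab hΛ
  refine ⟨m₀ + N + L.k₁, fun Q hQ m hm1 hm lam h G hh htie => ?_⟩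
  have hL' : ({ L with Q₁ := Q } : Link).Regular :=
    ⟨hL.η₁_pos, hL.η₁_lt, hL.η₂_pos, hL.η₂_lt, hL.k₁_pos, hL.k₂_pos, hL.Q₂_pos⟩
  have hmQ : m ≤ ({ L with Q₁ := Q } : Link).Q₁ := by change m ≤ Q; omega
  rw [← relDiff_zero] at htie
  have hlam : 0 ≤ lam := by
    by_contra hneg
    have := le_relDiff_of_nonpos hL' hk₁ hk₂ hmQ (not_le.1 hneg).le hh hm1 hmQ
    linarith
  have hbound : lam ≤ L.priceBound m₀ :=
    lam_le_priceBound hL' hk₁ hk₂ hstab hm1 hm hmQ hlam hh htie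
  have hpos := hN m Q lam (fun i => relDiff h i 0 - lam) (by omega) hlam hbound
    (sub_eq_zero.2 htie) (fun i hi hi' => relDiff_eq_above hL' hk₁ hk₂ hm1 hmQ hh htie hi hi')
  have habove : ∀ i, m < i → i ≤ Q → lam < relDiff h i 0 := fun i hi hi' =>
    sub_pos.1 (hpos i hi hi')
  refine ⟨hlam, fun i hi him => ?_, fun i hi hi' => ?_⟩
  · rw [← relDiff_zero]
    exact (relDiff_lt_below hL' hk₁ hk₂ (show m + L.k₁ ≤ Q by omega) hh htie habove (m - i) i hi
      (by omega)).2 (by omega)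
  · rw [← relDiff_zero]
    exact habove i hi hi'

/-! ### Batch data arrivals: the power drawn by large thresholds -/

/-- The rate at which the threshold policy `m` uses the reliable source. -/
def useRate (L : Link) (m : ℕ) : ℝ :=
  ∑ s, L.thresholdSolution m s * L.step (thresholdPolicy m) 1 (fun _ _ => 0) s.1 s.2

theorem powerThreshold_le_useRate (hL : L.Regular) (hC : L.SmallArrivals)
    (hQ : 1 < L.k₁ → L.k₁ ≤ L.Q₁) {m : ℕ} (hm : m ≤ L.Q₁) : L.powerThreshold m ≤ L.useRate m := by
  obtain ⟨hb, h0, -⟩ := thresholdSolution_spec hL hC hm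
  unfold powerThreshold useRate
  rw [avgPower_eq hL hC hQ (fun i hi => by rw [thresholdPolicy, if_pos (by omega)]) hb]
  refine Finset.sum_le_sum fun s _ => mul_le_mul_of_nonneg_left ?_ (h0 s)
  have : 0 ≤ L.topCredit s.1 s.2 := by
    unfold topCredit; split_ifs; exacts [hL.η₁_pos.le, le_rfl]
  linarith

/-- The reliable source is never used in slots with an energy arrival. -/
theorem useRate_zero_le (hL : L.Regular) (hC : L.SmallArrivals) : L.useRate 0 ≤ 1 - L.η₂ := by
  obtain ⟨-, h0, h1⟩ := thresholdSolution_spec hL hC (Nat.zero_le _)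
  have hQ₂ := hL.Q₂_pos
  have hk₂ := hL.k₂_pos
  have m1 := hL.μ₁_pos.le
  have m2 := hL.μ₂_pos.le
  have hserve : ∀ x y, L.serve (thresholdPolicy 0) 1 (fun _ _ => 0) x y
      ≤ if y = 0 then 1 else 0 := by
    intro x y
    unfold serve thresholdPolicy
    split_ifs <;> first | omega | norm_num
  have hstep : ∀ i j, L.step (thresholdPolicy 0) 1 (fun _ _ => 0) i j ≤ 1 - L.η₂ := by
    intro i j
    have hone : ∀ x y, L.serve (thresholdPolicy 0) 1 (fun _ _ => 0) x y ≤ 1 := fun x y =>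
      (hserve x y).trans (by split_ifs <;> norm_num)
    have hzero : ∀ x, L.serve (thresholdPolicy 0) 1 (fun _ _ => 0) x (min (j + L.k₂) L.Q₂) ≤ 0 :=
      fun x => (hserve x _).trans (by rw [if_neg (by omega)])
    have t0 := mul_nonpos_of_nonneg_of_nonpos hL.μ₀_pos.le (hzero i)
    have t3 := mul_nonpos_of_nonneg_of_nonpos hL.μ₃_pos.le (hzero (i + L.k₁))
    have t1 := mul_le_mul_of_nonneg_left (hone i j) m1
    have t2 := mul_le_mul_of_nonneg_left (hone (i + L.k₁) j) m2
    have e : L.μ₁ + L.μ₂ = 1 - L.η₂ := by unfold μ₁ μ₂; ring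
    unfold step
    linarith
  calc L.useRate 0 ≤ ∑ s, L.thresholdSolution 0 s * (1 - L.η₂) :=
        Finset.sum_le_sum fun s _ => mul_le_mul_of_nonneg_left (hstep _ _) (h0 s)
    _ = 1 - L.η₂ := by rw [← Finset.sum_mul, h1, one_mul]

/-- Data are left at the end of a slot only if a packet was sent or the battery was empty, so that
the battery is not full. -/
theorem eq_zero_of_full_battery (hL : L.Regular) {c : ℕ → ℝ} {π : L.State → ℝ}
    (hπ : L.IsBalanced c π) (h0 : ∀ s, 0 ≤ π s) {s : L.State} (h1 : 1 ≤ (s.1 : ℕ))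
    (h2 : (s.2 : ℕ) = L.Q₂) : π s = 0 := by
  have hQ₂ := hL.Q₂_pos
  set h : ℕ → ℕ → ℝ := fun i j => if 1 ≤ i ∧ j = L.Q₂ then 1 else 0 with hh
  have hy : ∀ i j, j < L.Q₂ → h i j = 0 := fun i j hj => if_neg (by omega)
  have hserve : ∀ x y, y ≤ L.Q₂ → L.serve c 0 h x y = 0 := by
    intro x y hyQ
    unfold serve
    split_ifs with hx hy0
    · exact if_neg (by omega)
    · exact hy _ _ (by omega)
    · rw [hy _ _ hQ₂, hy _ _ hQ₂]; ring
  have hstep : ∀ i j, j ≤ L.Q₂ → L.step c 0 h i j = 0 := by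
    intro i j hj
    unfold step
    simp only [hserve _ _ (min_le_right _ _), hserve _ _ hj, mul_zero, add_zero]
  have hf := flow_eq_zero_of_isBalanced hπ h
  unfold flow at hf
  have hsum : ∑ s : L.State, π s * h s.1 s.2 = 0 := by
    rw [← neg_eq_zero, ← hf, ← Finset.sum_neg_distrib]
    refine Finset.sum_congr rfl fun s _ => ?_
    rw [hstep _ _ (by have := s.2.2; omega)]
    ring
  have hterm := (Finset.sum_eq_zero_iff_of_nonneg fun s _ => mul_nonneg (h0 s)
    (show 0 ≤ h s.1 s.2 by simp only [hh]; split_ifs <;> norm_num)).1 hsum s (Finset.mem_univ s)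
  have hone : h s.1 s.2 = 1 := if_pos ⟨h1, h2⟩
  rwa [hone, mul_one] at hterm

/-- The queue rarely exceeds the threshold by much: a quadratic test function. -/
theorem sum_excess_le (hL : L.Regular) (hk₁ : 1 < L.k₁) (hstab : L.k₁ * L.η₁ < 1) {m : ℕ}
    {π : L.State → ℝ} (hπ : L.IsBalanced (thresholdPolicy m) π) (h0 : ∀ s, 0 ≤ π s)
    (h1 : ∑ s, π s = 1) :
    ∑ s : L.State, π s * (((s.1 : ℕ) - m : ℕ) : ℝ) ≤ (L.k₁ : ℝ) ^ 2 / (2 * (1 - L.k₁ * L.η₁)) := by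
  have hδ : 0 < 1 - L.k₁ * L.η₁ := by linarith
  have hk : (1 : ℝ) < L.k₁ := by exact_mod_cast hk₁
  set F : ℕ → ℕ → ℝ := fun i _ => (((i - m : ℕ) : ℝ)) ^ 2 with hF
  have hmono : ∀ i i' : ℕ, i ≤ i' → ((i - m : ℕ) : ℝ) ^ 2 ≤ ((i' - m : ℕ) : ℝ) ^ 2 := fun i i' h =>
    pow_le_pow_left₀ (Nat.cast_nonneg _) (by exact_mod_cast (by omega)) 2
  have hserve : ∀ x y, L.serve (thresholdPolicy m) 0 F x y ≤ ((x - 1 - m : ℕ) : ℝ) ^ 2 := by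
    intro x y
    unfold serve thresholdPolicy
    split_ifs with hx hy hm
    · simp only [hF]; exact hmono 0 _ (Nat.zero_le _)
    · simp only [hF]; exact hmono _ _ (min_le_left _ _)
    · have := hmono _ _ (min_le_left (x - 1) L.Q₁)
      simp only [hF]; linarith
    · have := hmono _ _ (min_le_left x L.Q₁)
      rw [show x - m = x - 1 - m by omega] at this
      simp only [hF]; linarith
  have hstep : ∀ i j, L.step (thresholdPolicy m) 0 F i j - F i j
      ≤ (L.k₁ : ℝ) ^ 2 - 2 * (1 - L.k₁ * L.η₁) * ((i - m : ℕ) : ℝ) := by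
    intro i j
    have t0 := mul_le_mul_of_nonneg_left (hserve i (min (j + L.k₂) L.Q₂)) hL.μ₀_pos.le
    have t1 := mul_le_mul_of_nonneg_left (hserve i j) hL.μ₁_pos.le
    have t2 := mul_le_mul_of_nonneg_left (hserve (i + L.k₁) j) hL.μ₂_pos.le
    have t3 := mul_le_mul_of_nonneg_left (hserve (i + L.k₁) (min (j + L.k₂) L.Q₂)) hL.μ₃_pos.le
    have e01 : L.μ₀ + L.μ₁ = 1 - L.η₁ := by unfold μ₀ μ₁; ring
    have e23 : L.μ₂ + L.μ₃ = L.η₁ := by unfold μ₂ μ₃; ring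
    have hle : L.step (thresholdPolicy m) 0 F i j
        ≤ (1 - L.η₁) * ((i - 1 - m : ℕ) : ℝ) ^ 2 + L.η₁ * ((i + L.k₁ - 1 - m : ℕ) : ℝ) ^ 2 := by
      rw [← e01, ← e23]
      unfold step
      linarith
    have η0 := hL.η₁_pos
    have η1 := hL.η₁_lt
    rcases Nat.lt_or_ge m i with hi | hi
    · obtain ⟨n, rfl⟩ : ∃ n, i = m + 1 + n := ⟨i - m - 1, by omega⟩
      have e1 : ((m + 1 + n - 1 - m : ℕ) : ℝ) = n := by
        rw [show m + 1 + n - 1 - m = n by omega]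
      have e2 : ((m + 1 + n + L.k₁ - 1 - m : ℕ) : ℝ) = n + L.k₁ := by
        rw [show m + 1 + n + L.k₁ - 1 - m = n + L.k₁ by omega, Nat.cast_add]
      have e3 : ((m + 1 + n - m : ℕ) : ℝ) = n + 1 := by
        rw [show m + 1 + n - m = n + 1 by omega, Nat.cast_succ]
      rw [e1, e2] at hle
      simp only [hF]
      rw [e3]
      have h4 : (1 - L.η₁) * (L.k₁ : ℝ) ^ 2 ≥ (1 - L.η₁) * 1 :=
        mul_le_mul_of_nonneg_left (by nlinarith) (by linarith)
      nlinarith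
    · have e1 : ((i - 1 - m : ℕ) : ℝ) = 0 := by
        rw [show i - 1 - m = 0 by omega, Nat.cast_zero]
      have e2 : ((i + L.k₁ - 1 - m : ℕ) : ℝ) ^ 2 ≤ (L.k₁ : ℝ) ^ 2 :=
        pow_le_pow_left₀ (Nat.cast_nonneg _) (by exact_mod_cast (by omega)) 2
      have e3 : ((i - m : ℕ) : ℝ) = 0 := by
        rw [show i - m = 0 by omega, Nat.cast_zero]
      rw [e1] at hle
      simp only [hF]
      rw [e3]
      have h4 := mul_le_mul_of_nonneg_left e2 η0.le
      have h5 := mul_le_mul_of_nonneg_right η1.le (sq_nonneg (L.k₁ : ℝ))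
      linarith
  have hf := flow_eq_zero_of_isBalanced hπ F
  unfold flow at hf
  have hsum : ∑ s : L.State, π s * (L.step (thresholdPolicy m) 0 F s.1 s.2 - F s.1 s.2)
      ≤ ∑ s : L.State, π s * ((L.k₁ : ℝ) ^ 2
        - 2 * (1 - L.k₁ * L.η₁) * (((s.1 : ℕ) - m : ℕ) : ℝ)) :=
    Finset.sum_le_sum fun s _ => mul_le_mul_of_nonneg_left (hstep _ _) (h0 s)
  have e : ∑ s : L.State, π s * ((L.k₁ : ℝ) ^ 2
        - 2 * (1 - L.k₁ * L.η₁) * (((s.1 : ℕ) - m : ℕ) : ℝ))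
      = (L.k₁ : ℝ) ^ 2
        - 2 * (1 - L.k₁ * L.η₁) * ∑ s : L.State, π s * (((s.1 : ℕ) - m : ℕ) : ℝ) := by
    simp only [mul_sub, Finset.sum_sub_distrib, ← Finset.sum_mul, h1, one_mul, Finset.mul_sum]
    congr 1
    exact Finset.sum_congr rfl fun _ _ => by ring
  rw [hf, e] at hsum
  rw [le_div_iff₀ (by positivity)]
  linarith

/-- The test function `(i - j + Q₂) ^ 2` bounds the use of the reliable source: each use decreases
it by at least `2 m`. -/
theorem mul_useRate_le (hL : L.Regular) (hC : L.SmallArrivals) (hk₁ : 1 < L.k₁) (hk₂ : L.k₂ = 1)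
    {m : ℕ} (hm : m ≤ L.Q₁) :
    2 * m * L.useRate m ≤ (L.k₁ : ℝ) ^ 2 + 2 * (L.k₁ * L.η₁ - L.η₂)
      * ∑ s : L.State, L.thresholdSolution m s * ((s.1 : ℕ) + L.Q₂ - (s.2 : ℕ)) := by
  obtain ⟨hb, h0, h1⟩ := thresholdSolution_spec hL hC hm
  have hQ₂ : (1 : ℝ) ≤ L.Q₂ := by exact_mod_cast hL.Q₂_pos
  have hk : (1 : ℝ) ≤ L.k₁ := by exact_mod_cast hk₁.le
  unfold useRate
  set π := L.thresholdSolution m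
  set H : ℕ → ℕ → ℝ := fun i j => ((i : ℝ) + L.Q₂ - j) ^ 2 with hH
  set U : ℕ → ℕ → ℝ := L.serve (thresholdPolicy m) 1 (fun _ _ => 0) with hU
  have hmono : ∀ i i' : ℕ, ∀ j ≤ L.Q₂, i ≤ i' → H i j ≤ H i' j := by
    intro i i' j hj hi
    have h2 : (j : ℝ) ≤ L.Q₂ := by exact_mod_cast hj
    have h3 : (i : ℝ) ≤ i' := by exact_mod_cast hi
    have h4 : (0 : ℝ) ≤ i := Nat.cast_nonneg i
    exact pow_le_pow_left₀ (by linarith) (by linarith) 2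
  have hserve : ∀ x y, y ≤ L.Q₂ →
      L.serve (thresholdPolicy m) 0 H x y + 2 * m * U x y ≤ H x y := by
    intro x y hy
    simp only [hU]
    rcases Nat.eq_zero_or_pos x with rfl | hx
    · rw [serve_zero, serve_zero, mul_zero, add_zero]
    have hc : ((x - 1 : ℕ) : ℝ) = x - 1 := by rw [Nat.cast_sub hx, Nat.cast_one]
    rcases Nat.eq_zero_or_pos y with rfl | hy0
    · rw [serve_empty _ _ _ hx, serve_empty _ _ _ hx, thresholdPolicy]
      split_ifs with hxm
      · have h2 := hmono _ _ 0 hy (min_le_left (x - 1) L.Q₁)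
        have h3 : (m : ℝ) + 1 ≤ x := by exact_mod_cast hxm
        have h4 : H (x - 1) 0 + 2 * m ≤ H x 0 := by
          simp only [hH]; rw [hc]; push_cast; nlinarith
        linarith
      · have h2 := hmono _ _ 0 hy (min_le_left x L.Q₁)
        linarith
    · rw [serve_pos _ _ _ hx hy0, serve_pos _ _ _ hx hy0, mul_zero, add_zero]
      refine (hmono _ _ _ (by omega) (min_le_left (x - 1) L.Q₁)).trans (le_of_eq ?_)
      simp only [hH]
      rw [hc, Nat.cast_sub hy0, Nat.cast_one]
      ring
  have hstep : ∀ s : L.State, π s * (L.step (thresholdPolicy m) 0 H s.1 s.2 - H s.1 s.2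
      + 2 * m * L.step (thresholdPolicy m) 1 (fun _ _ => 0) s.1 s.2)
      ≤ π s * ((L.k₁ : ℝ) ^ 2
        + 2 * (L.k₁ * L.η₁ - L.η₂) * ((s.1 : ℕ) + L.Q₂ - (s.2 : ℕ))) := by
    intro s
    by_cases hfull : 1 ≤ (s.1 : ℕ) ∧ (s.2 : ℕ) = L.Q₂
    · rw [eq_zero_of_full_battery hL hb h0 hfull.1 hfull.2, zero_mul, zero_mul]
    refine mul_le_mul_of_nonneg_left ?_ (h0 s)
    have hj : (s.2 : ℕ) ≤ L.Q₂ := by have := s.2.2; omega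
    generalize (s.1 : ℕ) = i at hfull ⊢
    generalize (s.2 : ℕ) = j at hfull hj ⊢
    set w : ℝ := i + L.Q₂ - j with hw
    have hk2 : (1 : ℝ) ≤ (L.k₁ : ℝ) ^ 2 := one_le_pow₀ hk
    have b1 : H i j ≤ w ^ 2 + (L.k₁ : ℝ) ^ 2 := by
      simp only [hH]; linarith
    have b2 : H (i + L.k₁) j ≤ w ^ 2 + 2 * w * L.k₁ + (L.k₁ : ℝ) ^ 2 := by
      simp only [hH]; push_cast; rw [hw]; nlinarith
    -- energy is lost only at the state with empty queue and full battery, where `w = 0`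
    have b03 : H i (min (j + 1) L.Q₂) ≤ w ^ 2 - 2 * w + (L.k₁ : ℝ) ^ 2 ∧
        H (i + L.k₁) (min (j + 1) L.Q₂) ≤ w ^ 2 + 2 * w * (L.k₁ - 1) + (L.k₁ : ℝ) ^ 2 := by
      rcases hj.eq_or_lt with rfl | hj'
      · obtain rfl : i = 0 := by omega
        have hw0 : w = 0 := by rw [hw]; push_cast; ring
        rw [hw0, min_eq_right (by omega)]
        simp only [hH]
        push_cast
        constructor <;> nlinarith
      · rw [min_eq_left (by omega)]
        simp only [hH]
        push_cast
        have : ((i : ℝ) + L.Q₂ - (j + 1)) = w - 1 := by rw [hw]; ring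
        have h' : ((i : ℝ) + L.k₁ + L.Q₂ - (j + 1)) = w + (L.k₁ - 1) := by rw [hw]; ring
        rw [this, h']
        constructor <;> nlinarith
    have t0 := mul_le_mul_of_nonneg_left
      ((hserve i (min (j + 1) L.Q₂) (min_le_right _ _)).trans b03.1) hL.μ₀_pos.le
    have t1 := mul_le_mul_of_nonneg_left ((hserve i j hj).trans b1) hL.μ₁_pos.le
    have t2 := mul_le_mul_of_nonneg_left ((hserve (i + L.k₁) j hj).trans b2) hL.μ₂_pos.le
    have t3 := mul_le_mul_of_nonneg_left
      ((hserve (i + L.k₁) (min (j + 1) L.Q₂) (min_le_right _ _)).trans b03.2) hL.μ₃_pos.le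
    have e : L.μ₀ * (w ^ 2 - 2 * w + (L.k₁ : ℝ) ^ 2) + L.μ₁ * (w ^ 2 + (L.k₁ : ℝ) ^ 2)
        + L.μ₂ * (w ^ 2 + 2 * w * L.k₁ + (L.k₁ : ℝ) ^ 2)
        + L.μ₃ * (w ^ 2 + 2 * w * (L.k₁ - 1) + (L.k₁ : ℝ) ^ 2)
        = w ^ 2 + ((L.k₁ : ℝ) ^ 2 + 2 * (L.k₁ * L.η₁ - L.η₂) * w) := by
      unfold μ₀ μ₁ μ₂ μ₃; ring
    have eH : H i j = w ^ 2 := rfl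
    rw [eH]
    unfold step
    rw [hk₂]
    simp only [hU] at t0 t1 t2 t3
    linarith
  have hf := flow_eq_zero_of_isBalanced hb H
  unfold flow at hf
  have hsum := Finset.sum_le_sum fun s (_ : s ∈ Finset.univ) => hstep s
  simp only [mul_add, Finset.sum_add_distrib, ← Finset.sum_mul] at hsum
  rw [hf, h1, zero_add, one_mul] at hsum
  have e1 : ∑ s : L.State, π s * (2 * m * L.step (thresholdPolicy m) 1 (fun _ _ => 0) s.1 s.2)
      = 2 * m * ∑ s : L.State, π s * L.step (thresholdPolicy m) 1 (fun _ _ => 0) s.1 s.2 := by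
    rw [Finset.mul_sum]; exact Finset.sum_congr rfl fun _ _ => by ring
  have e2 : ∑ s : L.State, π s * (2 * (L.k₁ * L.η₁ - L.η₂) * ((s.1 : ℕ) + L.Q₂ - (s.2 : ℕ)))
      = 2 * (L.k₁ * L.η₁ - L.η₂)
        * ∑ s : L.State, π s * ((s.1 : ℕ) + L.Q₂ - (s.2 : ℕ)) := by
    rw [Finset.mul_sum]; exact Finset.sum_congr rfl fun _ _ => by ring
  rw [e1, e2] at hsum
  exact hsum

/-- The power of the threshold policies is at most the data rate not covered by the harvested
energy, up to a term of order `1 / m` that does not depend on the capacity of the data queue. -/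
theorem mul_powerThreshold_le (hL : L.Regular) (hC : L.SmallArrivals) (hk₁ : 1 < L.k₁)
    (hk₂ : L.k₂ = 1) (hstab : L.k₁ * L.η₁ < 1) (hQ : L.k₁ ≤ L.Q₁) {m : ℕ} (hm : m ≤ L.Q₁) {ρ : ℝ}
    (hρ0 : 0 ≤ ρ) (hρ : L.k₁ * L.η₁ - L.η₂ ≤ ρ) :
    2 * m * L.powerThreshold m ≤ 2 * m * ρ + ((L.k₁ : ℝ) ^ 2
      + 2 * ρ * (L.Q₂ + (L.k₁ : ℝ) ^ 2 / (2 * (1 - L.k₁ * L.η₁)))) := by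
  obtain ⟨hb, h0, h1⟩ := thresholdSolution_spec hL hC hm
  have hmean := sum_excess_le hL hk₁ hstab hb h0 h1
  have huse := mul_useRate_le hL hC hk₁ hk₂ hm
  have hp := mul_le_mul_of_nonneg_left (powerThreshold_le_useRate hL hC (fun _ => hQ) hm)
    (show (0 : ℝ) ≤ 2 * m by positivity)
  set W := ∑ s : L.State, L.thresholdSolution m s * (((s.1 : ℕ) : ℝ) + L.Q₂ - (s.2 : ℕ)) with hW
  have hW0 : 0 ≤ W := Finset.sum_nonneg fun s _ => mul_nonneg (h0 s) (by
    have : ((s.2 : ℕ) : ℝ) ≤ L.Q₂ := by exact_mod_cast (by have := s.2.2; omega)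
    have : (0 : ℝ) ≤ (s.1 : ℕ) := Nat.cast_nonneg _
    linarith)
  have hWle : W ≤ m + L.Q₂ + (L.k₁ : ℝ) ^ 2 / (2 * (1 - L.k₁ * L.η₁)) := by
    have h2 : W ≤ ∑ s : L.State, L.thresholdSolution m s
        * ((m + L.Q₂ : ℝ) + (((s.1 : ℕ) - m : ℕ) : ℝ)) := by
      refine Finset.sum_le_sum fun s _ => mul_le_mul_of_nonneg_left ?_ (h0 s)
      have h3 : ((s.1 : ℕ) : ℝ) ≤ m + (((s.1 : ℕ) - m : ℕ) : ℝ) := by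
        exact_mod_cast (by omega : (s.1 : ℕ) ≤ m + ((s.1 : ℕ) - m))
      have h4 : (0 : ℝ) ≤ (s.2 : ℕ) := Nat.cast_nonneg _
      linarith
    simp only [mul_add _ (m + L.Q₂ : ℝ), Finset.sum_add_distrib, ← Finset.sum_mul, h1,
      one_mul] at h2
    linarith
  have h5 := mul_le_mul_of_nonneg_right hρ hW0
  have h6 := mul_le_mul_of_nonneg_left hWle hρ0
  linarith

/-- A power budget above the data rate not covered by the harvested energy is respected by a
threshold that does not depend on the capacity of the data queue. -/
theorem exists_powerThreshold_le (hL : L.Regular) (hk₁ : 1 < L.k₁) (hk₂ : L.k₂ = 1)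
    (hQ₂ : 2 ≤ L.Q₂) {p : ℝ} (hp : 0 < p) (hstable : L.k₁ * L.η₁ - L.η₂ < p) :
    ∃ m₀ : ℕ, (m₀ = 0 ∨ L.k₁ * L.η₁ < 1) ∧ ∀ Q, m₀ ≤ Q → L.k₁ ≤ Q →
      ({ L with Q₁ := Q } : Link).powerThreshold m₀ ≤ p := by
  have hL' : ∀ Q, ({ L with Q₁ := Q } : Link).Regular := fun Q =>
    ⟨hL.η₁_pos, hL.η₁_lt, hL.η₂_pos, hL.η₂_lt, hL.k₁_pos, hL.k₂_pos, hL.Q₂_pos⟩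
  have hC : ∀ Q, ({ L with Q₁ := Q } : Link).SmallArrivals := fun Q =>
    Or.inr (Or.inr ⟨hk₁, hk₂, hQ₂⟩)
  rcases lt_or_ge ((L.k₁ : ℝ) * L.η₁) 1 with hstab | hstab
  swap
  -- here `p > 1 - η₂`, and no policy uses the reliable source in a slot with an energy arrival
  · refine ⟨0, Or.inl rfl, fun Q _ hQ => ?_⟩
    have h1 := powerThreshold_le_useRate (hL' Q) (hC Q) (fun _ => hQ) (Nat.zero_le _)
    have h2 := useRate_zero_le (hL' Q) (hC Q)
    have h3 : ({ L with Q₁ := Q } : Link).η₂ = L.η₂ := rfl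
    rw [h3] at h2
    linarith
  set ρ := max 0 (L.k₁ * L.η₁ - L.η₂) with hρ
  have hρp : 0 < p - ρ := sub_pos.2 (max_lt hp hstable)
  set C : ℝ := (L.k₁ : ℝ) ^ 2 + 2 * ρ * (L.Q₂ + (L.k₁ : ℝ) ^ 2 / (2 * (1 - L.k₁ * L.η₁))) with hCdef
  obtain ⟨n, hn⟩ := exists_nat_ge (C / (2 * (p - ρ)))
  refine ⟨n + 1, Or.inr hstab, fun Q hmQ hQ => ?_⟩
  have h1 : 2 * ((n + 1 : ℕ) : ℝ) * ({ L with Q₁ := Q } : Link).powerThreshold (n + 1)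
      ≤ 2 * ((n + 1 : ℕ) : ℝ) * ρ + C :=
    mul_powerThreshold_le (hL' Q) (hC Q) hk₁ hk₂ hstab hQ hmQ (le_max_left _ _) (le_max_right _ _)
  rw [div_le_iff₀ (by positivity)] at hn
  push_cast at h1
  have h2 : 2 * ((n : ℝ) + 1) * ({ L with Q₁ := Q } : Link).powerThreshold (n + 1)
      ≤ 2 * ((n : ℝ) + 1) * p := by nlinarith
  exact le_of_mul_le_mul_left h2 (by positivity)

/-! ### The structure of optimal solutions -/

/-- If some threshold `n` respects the power budget, and the prices of power of the thresholds up to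
`n` separate the gains from sending below and above the threshold, then optimal solutions are
governed by the least threshold that respects the budget. -/
theorem IsOptimal.exists_structure (hL : L.Regular) (hC : L.SmallArrivals)
    (hQ : 1 < L.k₁ → L.k₁ ≤ L.Q₁) {p : ℝ} {n : ℕ} (hn : n ≤ L.Q₁) (hnp : L.powerThreshold n ≤ p)
    (hfree : ∀ h G, L.IsRelValue 0 1 0 h G → ∀ i, 1 ≤ i → i ≤ L.Q₁ → 0 < h i 0 - h (i - 1) 0)
    (hprice : ∀ m, 1 ≤ m → m ≤ n → ∀ lam h G, L.IsRelValue m 1 lam h G →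
      h m 0 - h (m - 1) 0 = lam →
      0 ≤ lam ∧ (∀ i, 1 ≤ i → i < m → h i 0 - h (i - 1) 0 < lam) ∧
        ∀ i, m < i → i ≤ L.Q₁ → lam < h i 0 - h (i - 1) 0)
    {π : L.State → ℝ} (hπ : L.IsOptimal p π) :
    ∃ m, IsLeast {m : ℕ | m ≤ L.Q₁ ∧ L.powerThreshold m ≤ p} m ∧
      L.avgPower π ≤ p ∧
      (∀ i, 1 ≤ i → i < m → L.upperSlack i π = 0) ∧
      (∀ i, m < i → i ≤ L.Q₁ → L.lowerSlack i π = 0) ∧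
      ∃ g f : ℕ → ℝ, L.IsThresholdPolicy m g f ∧ L.IsStationary g f π := by
  classical
  have hex : ∃ m, m ≤ L.Q₁ ∧ L.powerThreshold m ≤ p := ⟨n, hn, hnp⟩
  have hleast : IsLeast {m : ℕ | m ≤ L.Q₁ ∧ L.powerThreshold m ≤ p} (Nat.find hex) :=
    ⟨Nat.find_spec hex, fun m hm => Nat.find_min' hex hm⟩
  have hle : Nat.find hex ≤ n := Nat.find_min' hex ⟨hn, hnp⟩
  exact ⟨Nat.find hex, hleast, hπ.structure_of_convex hL hC hQ hleast (fun _ => hfree)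
    (fun h1 => hprice _ h1 hle)⟩

end Link

theorem mainTheorem1 (k₁ k₂ Q₂ : ℕ) (η₁ η₂ pmax : ℝ)
    (hη₁ : 0 < η₁ ∧ η₁ < 1) (hη₂ : 0 < η₂ ∧ η₂ < 1)
    (hcase : (k₁ = 1 ∧ k₂ = 1 ∧ 1 ≤ Q₂) ∨ (k₁ = 1 ∧ 1 < k₂ ∧ 2 ≤ Q₂) ∨
      (1 < k₁ ∧ k₂ = 1 ∧ 2 ≤ Q₂))
    (hstable : (k₁ : ℝ) * η₁ - k₂ * η₂ < pmax) (hpos : 1 < k₁ → 0 < pmax) :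
    ∃ Q₀ : ℕ, (k₁ = 1 → Q₀ = 1) ∧ ∀ Q₁ : ℕ, Q₀ ≤ Q₁ →
      let L : Link := ⟨k₁, k₂, Q₁, Q₂, η₁, η₂⟩
      (∀ m, m ≤ Q₁ → ∃! π, L.SolvesThresholdSystem m π) ∧
      ((∃ m, m ≤ Q₁ ∧ L.powerThreshold m ≤ pmax) → ∃ π, L.IsOptimal pmax π) ∧
      ∀ π, L.IsOptimal pmax π →
        ∃ m, IsLeast {m : ℕ | m ≤ Q₁ ∧ L.powerThreshold m ≤ pmax} m ∧
          L.avgPower π ≤ pmax ∧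
          (∀ i, 1 ≤ i → i < m → L.upperSlack i π = 0) ∧
          (∀ i, m < i → i ≤ Q₁ → L.lowerSlack i π = 0) ∧
          ∃ g f : ℕ → ℝ, L.IsThresholdPolicy m g f ∧ L.IsStationary g f π := by
  have hL : ∀ Q₁, (⟨k₁, k₂, Q₁, Q₂, η₁, η₂⟩ : Link).Regular := fun Q₁ =>
    ⟨hη₁.1, hη₁.2, hη₂.1, hη₂.2, by dsimp only; omega, by dsimp only; omega, by dsimp only; omega⟩
  have hC : ∀ Q₁, (⟨k₁, k₂, Q₁, Q₂, η₁, η₂⟩ : Link).SmallArrivals := by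
    intro Q₁
    change (k₁ = 1 ∧ k₂ = 1) ∨ (k₁ = 1 ∧ 1 < k₂ ∧ 2 ≤ Q₂) ∨ (1 < k₁ ∧ k₂ = 1 ∧ 2 ≤ Q₂)
    tauto
  have hexists : ∀ Q₁, let L : Link := ⟨k₁, k₂, Q₁, Q₂, η₁, η₂⟩
      (∃ m, m ≤ Q₁ ∧ L.powerThreshold m ≤ pmax) → ∃ π, L.IsOptimal pmax π := by
    rintro Q₁ L ⟨m, hm, hp⟩
    obtain ⟨-, hb, h0, hs, hbal⟩ := Link.thresholdSolution_isFeasible (hL Q₁) (hC Q₁) hm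
    exact Link.exists_isOptimal ⟨hp, hb, h0, hs, hbal⟩
  rcases (show k₁ = 1 ∨ (1 < k₁ ∧ k₂ = 1 ∧ 2 ≤ Q₂) by omega) with hk₁ | ⟨hk₁, hk₂, hQ₂⟩
  · -- the largest threshold draws the least power, so that it respects every feasible budget
    refine ⟨1, fun _ => rfl, fun Q₁ _ => ⟨fun m hm =>
      Link.existsUnique_thresholdSystem (hL Q₁) (hC Q₁) hm, hexists Q₁, fun π hπ => ?_⟩⟩
    have hp := (Link.powerThreshold_le_avgPower (hL Q₁) (hC Q₁) hk₁ hπ.1).trans hπ.1.power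
    exact hπ.exists_structure (hL Q₁) (hC Q₁) (fun h => absurd hk₁ h.ne') le_rfl hp
      (fun h G hh i hi hi' => Link.gap_pos_of_single (hL Q₁) hk₁ hh hi hi')
      (fun m h1 hm lam h G hh htie => Link.price_of_single (hL Q₁) hk₁ h1 hm hh htie)
  · have hstable' : (k₁ : ℝ) * η₁ - η₂ < pmax := by
      rw [hk₂, Nat.cast_one, one_mul] at hstable
      exact hstable
    obtain ⟨m₀, hm₀, hpow⟩ := Link.exists_powerThreshold_le (hL 0) hk₁ hk₂ hQ₂ (hpos hk₁) hstable'
    obtain ⟨N, hN⟩ : ∃ N : ℕ, ∀ Q, N ≤ Q → ∀ m, 1 ≤ m → m ≤ m₀ → ∀ lam h G,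
        (⟨k₁, k₂, Q, Q₂, η₁, η₂⟩ : Link).IsRelValue m 1 lam h G → h m 0 - h (m - 1) 0 = lam →
        0 ≤ lam ∧ (∀ i, 1 ≤ i → i < m → h i 0 - h (i - 1) 0 < lam) ∧
          ∀ i, m < i → i ≤ Q → lam < h i 0 - h (i - 1) 0 := by
      rcases hm₀ with rfl | hstab
      · exact ⟨0, fun Q _ m h1 h2 => absurd h1 (by omega)⟩
      · exact Link.exists_price_of_batch (hL 0) hk₁ hk₂ hstab m₀
    refine ⟨N + m₀ + k₁, fun h => absurd h hk₁.ne', fun Q₁ hQ => ⟨fun m hm =>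
      Link.existsUnique_thresholdSystem (hL Q₁) (hC Q₁) hm, hexists Q₁, fun π hπ => ?_⟩⟩
    exact hπ.exists_structure (hL Q₁) (hC Q₁) (fun _ => show k₁ ≤ Q₁ by omega)
      (show m₀ ≤ Q₁ by omega) (hpow Q₁ (by omega) (show k₁ ≤ Q₁ by omega))
      (fun h G hh i hi hi' => Link.gap_pos_of_batch (hL Q₁) hk₁ hk₂ hh hi hi')
      (hN Q₁ (by omega))

end
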